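/- Work in the Euclidean plane $\mathbb{C}=\mathbb{R}^2$; curves are lines, circles and nondegenerate conics. Consider the following elementary operations ("axioms"), applied to ordered lists of points and curves for which they make sense. Construction axioms (producing curves): Line$(A,B)$, the line through $A\neq B$; Circle$(A,B)$, the circle with center $A$ through $B\ne A$; RadiusCircle$(A,B,C)$, the circle with center $A$ and radius $|BC|>0$; Bisector$(\ell,\ell')$, the two bisectors of the angles formed by two distinct intersecting lines; PerpendicularBisector$(A,B)$ for $A\neq B$; Perpendicular$(\ell,P)$, the line through $P$ perpendicular to the line $\ell$; Tangent$(\ell,F,A)$, the tangents through $A$ to the parabola with directrix $\ell$ and focus $F\notin\ell$; CommonTangent$(\ell,F,\ell',F')$, the common tangents of the parabola with directrix $\ell$ and focus $F\notin\ell$ and the parabola with directrix $\ell'$ and focus $F'\notin\ell'$, if these are distinct; PerpendicularTangent$(\ell_1,F,\ell_2)$, the tangent, perpendicular to the line $\ell_2$, of the parabola with directrix $\ell_1$ and focus $F\notin\ell_1$; Conic$(\ell,F,A,B)$, the conic with directrix $\ell$, focus $F\notin \ell$ and eccentricity $|AB|>0$. Intersection axioms (producing points): LineIntersect, CircleIntersect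 and ConicIntersect produce the intersection points of two distinct lines, circles, or conics respectively; LineCircleIntersect, ConicLineIntersect and ConicCircleIntersect produce the intersection points of a line and a circle, of a conic and a line, and of a conic and a circle, where "conic" means a curve given by directrix, focus and eccentricity as above. A tool $\mathcal{E}=\langle\mathcal{A},\mathcal{I}\rangle$ consists of a nonempty finite set $\mathcal{A}$ of construction axioms and a nonempty finite set $\mathcal{I}$ of intersection axioms. Consider the tools - compass $\mathcal{C}=\langle\{$Circle, RadiusCircle$\},\{$CircleIntersect$\}\rangle$; - ruler and compass $\mathcal{RC}=\langle\{$Line, Circle, RadiusCircle$\},\{$LineIntersect, CircleIntersect, LineCircleIntersect$\}\rangle$; - Euclidean compass $\mathcal{EC}=\langle\{$Circle$\},\{$CircleIntersect$\}\rangle$; - ruler and Euclidean compass $\mathcal{REC}=\langle\{$Line, Circle$\},\{$LineIntersect, CircleIntersect, LineCircleIntersect$\}\rangle$; - origami $\mathcal{O}=\langle\{$Line, PerpendicularBisector, Bisector, Perpendicular, Tangent, CommonTangent, PerpendicularTangent$\},\{$LineIntersect$\}\rangle$; - conics $\mathcal{CO}=\langle\{$Line, Circle, RadiusCircle, Conic$\},\{$LineIntersect,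 CircleIntersect, LineCircleIntersect, ConicLineIntersect, ConicCircleIntersect, ConicIntersect$\}\rangle$. A map $M=(\mathcal{E},U_0)$ is a tool $\mathcal{E}=\langle\mathcal{A},\mathcal{I}\rangle$ together with a nonempty finite initial set $U_0=[C_0,P_0]$ of curves ($C_0$) and points ($P_0$). Its layers $U_n=[C_n,P_n]$ are defined recursively: $C_n$ is the union of $C_{n-1}$ and all curves obtained by applying the axioms of $\mathcal{A}$ in all possible ways to elements of $[C_{n-1},P_{n-1}]$, and $P_n$ is the union of $P_{n-1}$ and all points obtained by applying the axioms of $\mathcal{I}$ in all possible ways to elements of $[C_n,P_{n-1}]$. Put $U^M=\bigcup_n U_n$ and $P^M=\bigcup_n P_n$. The map is infinite if $U^M$ is infinite, and two maps $M,M'$ are equivalent if $P^M=P^{M'}$. The map uses all axioms of its tool if every axiom in $\mathcal{A}$ can, for some $n\geq 1$, be applied to elements of $[C_{n-1},P_{n-1}]$ so as to produce a curve not in $C_{n-1}$, and every axiom in $\mathcal{I}$ can, for some $n\ge1$, be applied to elements of $[C_n,P_{n-1}]$ so as to produce a point not in $P_{n-1}$. Two tools $\mathcal{E},\mathcal{E}'$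 are arithmetically equivalent if there are nonempty finite sets of points $U_0,U_0'$ such that the maps $(\mathcal{E},U_0)$ and $(\mathcal{E}',U_0')$ are infinite and equivalent, and each of them uses all axioms of its tool. **Theorem.** (i) The tools $\mathcal{C}$, $\mathcal{RC}$, $\mathcal{EC}$ and $\mathcal{REC}$ are pairwise arithmetically equivalent. (ii) The tools $\mathcal{O}$ and $\mathcal{CO}$ are arithmetically equivalent. -/

import Mathlib

namespace GeometricTools

/-! ### Curves of the plane. The plane is `ℂ`, and a curve is a set of points. -/

/-- `ℓ` is a straight line. -/
def IsLine (ℓ : Set ℂ) : Prop :=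
  ∃ A B : ℂ, A ≠ B ∧ ℓ = (line[ℝ, A, B] : Set ℂ)

/-- `c` is a circle (of positive radius). -/
def IsCircle (c : Set ℂ) : Prop :=
  ∃ (O : ℂ) (r : ℝ), 0 < r ∧ c = Metric.sphere O r

/-- The points whose distance to the focus `F` is `e` times their distance to the directrix `ℓ`. -/
def conicSet (ℓ : Set ℂ) (F : ℂ) (e : ℝ) : Set ℂ :=
  {P | dist P F = e * Metric.infDist P ℓ}

/-- `c` is a nondegenerate conic given by directrix, focus and eccentricity. -/
def IsConic (c : Set ℂ) : Prop :=
  ∃ (ℓ : Set ℂ) (F : ℂ) (e : ℝ), IsLine ℓ ∧ F ∉ ℓ ∧ 0 < e ∧ c = conicSet ℓ F e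

/-- The parabola with directrix `ℓ` and focus `F` (used for `F ∉ ℓ`). -/
def parabola (ℓ : Set ℂ) (F : ℂ) : Set ℂ := conicSet ℓ F 1

/-- The lines `m` and `ℓ` are perpendicular. -/
def Perp (m ℓ : Set ℂ) : Prop :=
  IsLine m ∧ IsLine ℓ ∧ ∀ A ∈ m, ∀ B ∈ m, ∀ C ∈ ℓ, ∀ D ∈ ℓ, inner ℝ (B - A) (D - C) = 0

/-- `m` is a tangent line of the (nondegenerate) parabola with directrix `ℓ` and focus `F`: it
meets the parabola in exactly one point and it is not parallel to the axis, that is,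
not perpendicular to the directrix. -/
def IsTangent (m ℓ : Set ℂ) (F : ℂ) : Prop :=
  IsLine m ∧ IsLine ℓ ∧ F ∉ ℓ ∧ ¬ Perp m ℓ ∧ ∃ T, m ∩ parabola ℓ F = {T}

/-- `m` is one of the two bisectors of the angles formed by the two distinct lines `ℓ` and `ℓ'`,
which meet at `O` and have unit direction vectors `u` and `v`. (Replacing `v` by `-v` yields the
other bisector.) -/
def IsBisector (m ℓ ℓ' : Set ℂ) : Prop :=
  ∃ O u v : ℂ, ‖u‖ = 1 ∧ ‖v‖ = 1 ∧ ℓ ≠ ℓ' ∧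
    ℓ = (line[ℝ, O, O + u] : Set ℂ) ∧ ℓ' = (line[ℝ, O, O + v] : Set ℂ) ∧
    m = (line[ℝ, O, O + (u + v)] : Set ℂ)

/-! ### Axioms and tools -/

/-- A point or a curve. -/
inductive Element where
  | point (P : ℂ)
  | curve (c : Set ℂ)

/-- Names of the construction axioms. -/
inductive ConstructionAxiom where
  | line
  | circle
  | radiusCircle
  | bisector
  | perpendicularBisector
  | perpendicular
  | pointPerpendicular
  | tangent
  | commonTangent
  | perpendicularTangent
  | conic
  deriving DecidableEq

/-- Names of the intersection axioms. -/
inductive IntersectionAxiom where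
  | lineIntersect
  | circleIntersect
  | lineCircleIntersect
  | conicIntersect
  | lineConicIntersect
  | circleConicIntersect
  deriving DecidableEq

/-- `a.Generates I c`: the curve `c` is one of the curves that the construction axiom `a` generates
from the ordered input `I`. -/
inductive ConstructionAxiom.Generates : ConstructionAxiom → List Element → Set ℂ → Prop
  /-- The line through `A` and `B`. -/
  | line (A B : ℂ) (h : A ≠ B) :
      Generates .line [.point A, .point B] (line[ℝ, A, B] : Set ℂ)
  /-- The circle with center `A` through `B`. -/
  | circle (A B : ℂ) (h : A ≠ B) :
      Generates .circle [.point A, .point B] (Metric.sphere A (dist A B))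
  /-- The circle with center `A` and radius the distance `BC`. -/
  | radiusCircle (A B C : ℂ) (h : B ≠ C) :
      Generates .radiusCircle [.point A, .point B, .point C] (Metric.sphere A (dist B C))
  /-- The bisectors of the angle formed by two lines. -/
  | bisector (ℓ ℓ' m : Set ℂ) (h : IsBisector m ℓ ℓ') :
      Generates .bisector [.curve ℓ, .curve ℓ'] m
  /-- The perpendicular bisector of the segment `AB`. -/
  | perpendicularBisector (A B : ℂ) (h : A ≠ B) :
      Generates .perpendicularBisector [.point A, .point B]
        (AffineSubspace.perpBisector A B : Set ℂ)
  /-- The line perpendicular to `ℓ` through `P`. -/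
  | perpendicular (ℓ m : Set ℂ) (P : ℂ) (h : Perp m ℓ) (hP : P ∈ m) :
      Generates .perpendicular [.curve ℓ, .point P] m
  /-- The line perpendicular to the segment `AB` through `C`. -/
  | pointPerpendicular (A B C : ℂ) (m : Set ℂ) (hAB : A ≠ B)
      (h : Perp m (line[ℝ, A, B] : Set ℂ)) (hC : C ∈ m) :
      Generates .pointPerpendicular [.point A, .point B, .point C] m
  /-- The tangents through `A` to the parabola with directrix `ℓ` and focus `F`. -/
  | tangent (ℓ m : Set ℂ) (F A : ℂ) (h : IsTangent m ℓ F) (hA : A ∈ m) :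
      Generates .tangent [.curve ℓ, .point F, .point A] m
  /-- The common tangents to two distinct parabolas. -/
  | commonTangent (ℓ ℓ' m : Set ℂ) (F F' : ℂ) (h : IsTangent m ℓ F) (h' : IsTangent m ℓ' F')
      (hne : parabola ℓ F ≠ parabola ℓ' F') :
      Generates .commonTangent [.curve ℓ, .point F, .curve ℓ', .point F'] m
  /-- The tangent, perpendicular to `ℓ₂`, to the parabola with directrix `ℓ₁` and focus `F`. -/
  | perpendicularTangent (ℓ₁ ℓ₂ m : Set ℂ) (F : ℂ) (h : IsTangent m ℓ₁ F) (h₂ : Perp m ℓ₂) :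
      Generates .perpendicularTangent [.curve ℓ₁, .point F, .curve ℓ₂] m
  /-- The conic with directrix `ℓ`, focus `F` and eccentricity the distance `AB`. -/
  | conic (ℓ : Set ℂ) (F A B : ℂ) (hℓ : IsLine ℓ) (hF : F ∉ ℓ) (h : A ≠ B) :
      Generates .conic [.curve ℓ, .point F, .point A, .point B] (conicSet ℓ F (dist A B))

/-- `a.Generates I P`: the point `P` is one of the points that the intersection axiom `a` generates
from the ordered input `I`. -/
inductive IntersectionAxiom.Generates : IntersectionAxiom → List Element → ℂ → Prop
  | lineIntersect (ℓ ℓ' : Set ℂ) (P : ℂ) (hℓ : IsLine ℓ) (hℓ' : IsLine ℓ') (h : ℓ ≠ ℓ')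
      (hP : P ∈ ℓ ∩ ℓ') : Generates .lineIntersect [.curve ℓ, .curve ℓ'] P
  | circleIntersect (c c' : Set ℂ) (P : ℂ) (hc : IsCircle c) (hc' : IsCircle c') (h : c ≠ c')
      (hP : P ∈ c ∩ c') : Generates .circleIntersect [.curve c, .curve c'] P
  | lineCircleIntersect (ℓ c : Set ℂ) (P : ℂ) (hℓ : IsLine ℓ) (hc : IsCircle c)
      (hP : P ∈ ℓ ∩ c) : Generates .lineCircleIntersect [.curve ℓ, .curve c] P
  | conicIntersect (c c' : Set ℂ) (P : ℂ) (hc : IsConic c) (hc' : IsConic c') (h : c ≠ c')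
      (hP : P ∈ c ∩ c') : Generates .conicIntersect [.curve c, .curve c'] P
  | lineConicIntersect (ℓ c : Set ℂ) (P : ℂ) (hℓ : IsLine ℓ) (hc : IsConic c)
      (hP : P ∈ ℓ ∩ c) : Generates .lineConicIntersect [.curve ℓ, .curve c] P
  | circleConicIntersect (c c' : Set ℂ) (P : ℂ) (hc : IsCircle c) (hc' : IsConic c')
      (hP : P ∈ c ∩ c') : Generates .circleConicIntersect [.curve c, .curve c'] P

/-- A tool: nonempty finite sets of construction axioms and of intersection axioms. -/
structure Tool where
  construction : Finset ConstructionAxiom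
  intersection : Finset IntersectionAxiom
  construction_nonempty : construction.Nonempty
  intersection_nonempty : intersection.Nonempty

/-- The compass `C`. -/
def compass : Tool where
  construction := {.circle, .radiusCircle}
  intersection := {.circleIntersect}
  construction_nonempty := by simp
  intersection_nonempty := by simp

/-- The ruler and compass `RC`. -/
def rulerCompass : Tool where
  construction := {.line, .circle, .radiusCircle}
  intersection := {.lineIntersect, .circleIntersect, .lineCircleIntersect}
  construction_nonempty := by simp
  intersection_nonempty := by simp

/-- The Euclidean compass `EC`. -/
def euclideanCompass : Tool where
  construction := {.circle}
  intersection := {.circleIntersect}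
  construction_nonempty := by simp
  intersection_nonempty := by simp

/-- The ruler and Euclidean compass `REC`. -/
def rulerEuclideanCompass : Tool where
  construction := {.line, .circle}
  intersection := {.lineIntersect, .circleIntersect, .lineCircleIntersect}
  construction_nonempty := by simp
  intersection_nonempty := by simp

/-- The origami tool `O`. -/
def origami : Tool where
  construction := {.line, .perpendicularBisector, .bisector, .perpendicular, .tangent,
    .commonTangent, .perpendicularTangent}
  intersection := {.lineIntersect}
  construction_nonempty := by simp
  intersection_nonempty := by simp

/-- The conics tool `CO`. -/
def conics : Tool where
  construction := {.line, .circle, .radiusCircle, .conic}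
  intersection := {.lineIntersect, .circleIntersect, .lineCircleIntersect, .lineConicIntersect,
    .circleConicIntersect, .conicIntersect}
  construction_nonempty := by simp
  intersection_nonempty := by simp

/-! ### Maps and constructible points and curves -/

/-- A set `[C, P]` of curves and points. -/
structure Figure where
  curves : Set (Set ℂ)
  points : Set ℂ

/-- The elements of `[C, P]`. -/
def Figure.elements (U : Figure) : Set Element :=
  Element.curve '' U.curves ∪ Element.point '' U.points

/-- The curves obtained by applying the construction axiom `a` in all possible ways to elements
of `U`. -/
def ConstructionAxiom.obtained (a : ConstructionAxiom) (U : Figure) : Set (Set ℂ) :=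
  {c | ∃ I : List Element, (∀ x ∈ I, x ∈ U.elements) ∧ a.Generates I c}

/-- The points obtained by applying the intersection axiom `a` in all possible ways to elements
of `U`. -/
def IntersectionAxiom.obtained (a : IntersectionAxiom) (U : Figure) : Set ℂ :=
  {P | ∃ I : List Element, (∀ x ∈ I, x ∈ U.elements) ∧ a.Generates I P}

/-- A map: a tool with a nonempty finite initial set of points and curves. -/
structure ToolMap where
  tool : Tool
  initial : Figure
  initial_finite : initial.elements.Finite
  initial_nonempty : initial.elements.Nonempty

namespace ToolMap

/-- The curves of the layer that follows the layer `U`. -/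
def nextCurves (M : ToolMap) (U : Figure) : Set (Set ℂ) :=
  U.curves ∪ ⋃ a ∈ M.tool.construction, a.obtained U

/-- The points of the layer that follows the layer `U`; the intersection axioms are applied to the
new set of curves and the old set of points. -/
def nextPoints (M : ToolMap) (U : Figure) : Set ℂ :=
  U.points ∪ ⋃ a ∈ M.tool.intersection, a.obtained ⟨M.nextCurves U, U.points⟩

/-- The sequence of layers. -/
def layer (M : ToolMap) : ℕ → Figure
  | 0 => M.initial
  | n + 1 => ⟨M.nextCurves (M.layer n), M.nextPoints (M.layer n)⟩

/-- The constructible points and curves. -/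
def constructible (M : ToolMap) : Figure :=
  ⟨⋃ n, (M.layer n).curves, ⋃ n, (M.layer n).points⟩

/-- The map is infinite. -/
def IsInfinite (M : ToolMap) : Prop :=
  M.constructible.elements.Infinite

/-- Two maps are equivalent if they have the same constructible points. -/
def Equivalent (M M' : ToolMap) : Prop :=
  M.constructible.points = M'.constructible.points

/-- All axioms of the tool take part in the construction of the layers: each of them
generates, at some stage, an object which was not available at the previous stage. -/
def UsesAllAxioms (M : ToolMap) : Prop :=
  (∀ a ∈ M.tool.construction, ∃ n, ∃ c ∈ a.obtained (M.layer n), c ∉ (M.layer n).curves) ∧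
  (∀ a ∈ M.tool.intersection, ∃ n,
    ∃ P ∈ a.obtained ⟨(M.layer (n + 1)).curves, (M.layer n).points⟩, P ∉ (M.layer n).points)

end ToolMap

/-- Two tools are arithmetically equivalent: for suitable finite initial sets of points, the
resulting maps are infinite and equivalent, and all axioms of both tools are used. -/
def ArithmeticallyEquivalent (E E' : Tool) : Prop :=
  ∃ M M' : ToolMap, M.tool = E ∧ M'.tool = E' ∧
    M.initial.curves = ∅ ∧ M'.initial.curves = ∅ ∧
    M.IsInfinite ∧ M'.IsInfinite ∧ M.Equivalent M' ∧
    M.UsesAllAxioms ∧ M'.UsesAllAxioms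

end GeometricTools

namespace GeometricTools

/-! ### Lines, circles, conics and tangents in coordinates -/

/-! The constructible points of each map are the plane over a subfield `X` of `ℝ`, and the maps are
compared through closure properties of `X`, without ever describing `X` explicitly.

For (i), all four maps start from `0` and `1`. Lower bound: a set that contains `0` and `1` and is
closed under intersecting circles with centers in it is `plane X` for a subfield `X` closed under
real square roots (`CircleClosed.exists_eq_plane`). This is a Mohr–Mascheroni argument that needs
only the Euclidean compass. Upper bound: for every such `X`, ruler and compass never leave `plane X`
(`rulerCompass_points_subset`), because the intersections solve equations of degree at most two. As
the upper bound holds for every closed field, it applies to the field of any other of the four maps,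
which gives both inclusions.

For (ii), the closure property also includes the real roots of depressed cubics. Through the
resolvent cubic such a field contains the real roots of quartics, hence the intersections of two
conics (`conics_points_subset`). A common tangent of two parabolas is governed by a cubic
(`origami_points_subset`), because a tangent is the perpendicular bisector of the focus and a point
of the directrix. Conversely, conics solve cubics by intersecting a parabola with a circle
(`cubicClosed_of_conics`), and origami solves them by a common tangent (`cubicClosed_origamiField`).
Again each upper bound is applied to the field of the other map.

That all axioms are used is shown by explicit witnesses in the first two layers: the point `(2, √3)`
for the conics and the line `x + y = 1/2` for origami. -/

/-- The set with the equation `a x + b y = c`. -/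
def eqLine (a b c : ℝ) : Set ℂ := {z | a * z.re + b * z.im = c}

theorem mem_eqLine {a b c : ℝ} {z : ℂ} : z ∈ eqLine a b c ↔ a * z.re + b * z.im = c := Iff.rfl

theorem sq_dist (z w : ℂ) : dist z w ^ 2 = (z.re - w.re) ^ 2 + (z.im - w.im) ^ 2 := by
  rw [Complex.dist_eq_re_im, Real.sq_sqrt (by positivity)]

theorem dist_eq_iff {z w : ℂ} {r : ℝ} (hr : 0 ≤ r) :
    dist z w = r ↔ (z.re - w.re) ^ 2 + (z.im - w.im) ^ 2 = r ^ 2 := by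
  rw [← sq_dist, sq_eq_sq₀ dist_nonneg hr]

theorem dist_eq_dist_iff {z w z' w' : ℂ} :
    dist z w = dist z' w' ↔ (z.re - w.re) ^ 2 + (z.im - w.im) ^ 2 =
      (z'.re - w'.re) ^ 2 + (z'.im - w'.im) ^ 2 := by
  rw [dist_eq_iff dist_nonneg, sq_dist]

theorem sub_ne_zero_re_im {A B : ℂ} (h : A ≠ B) : B.re - A.re ≠ 0 ∨ B.im - A.im ≠ 0 := by
  by_contra! H
  exact h (Complex.ext (by linarith [H.1]) (by linarith [H.2]))

theorem mem_line_iff {A B z : ℂ} : z ∈ (line[ℝ, A, B] : Set ℂ) ↔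
    ∃ t : ℝ, z.re = A.re + t * (B.re - A.re) ∧ z.im = A.im + t * (B.im - A.im) := by
  rw [SetLike.mem_coe, mem_affineSpan_pair_iff_exists_lineMap_eq]
  refine exists_congr fun t => ?_
  simp only [AffineMap.lineMap_apply, vsub_eq_sub, vadd_eq_add, Complex.ext_iff, Complex.add_re,
    Complex.add_im, Complex.real_smul, Complex.re_ofReal_mul, Complex.im_ofReal_mul,
    Complex.sub_re, Complex.sub_im]
  constructor <;> rintro ⟨h1, h2⟩ <;> constructor <;> linarith

theorem line_eq_eqLine {A B : ℂ} (h : A ≠ B) {a b c : ℝ} (hab : a ≠ 0 ∨ b ≠ 0)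
    (hA : A ∈ eqLine a b c) (hB : B ∈ eqLine a b c) : (line[ℝ, A, B] : Set ℂ) = eqLine a b c := by
  rw [mem_eqLine] at hA hB
  ext z
  rw [mem_line_iff, mem_eqLine]
  constructor
  · rintro ⟨t, h1, h2⟩
    rw [h1, h2]
    linear_combination t * hB + (1 - t) * hA
  · intro hz
    have key : (B.im - A.im) * (z.re - A.re) = (B.re - A.re) * (z.im - A.im) := by
      rcases hab with h0 | h0 <;> apply mul_left_cancel₀ h0
      · linear_combination (B.im - A.im) * (hz - hA) - (z.im - A.im) * (hB - hA)
      · linear_combination -(B.re - A.re) * (hz - hA) + (z.re - A.re) * (hB - hA)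
    rcases sub_ne_zero_re_im h with h0 | h0
    · refine ⟨(z.re - A.re) / (B.re - A.re), ?_, ?_⟩ <;> field_simp
      · ring
      · linear_combination -key
    · refine ⟨(z.im - A.im) / (B.im - A.im), ?_, ?_⟩ <;> field_simp
      · linear_combination key
      · ring

theorem line_eq {A B : ℂ} (h : A ≠ B) : (line[ℝ, A, B] : Set ℂ) =
    eqLine (B.im - A.im) (-(B.re - A.re)) ((B.im - A.im) * A.re - (B.re - A.re) * A.im) := by
  refine line_eq_eqLine h ?_ ?_ ?_
  · rw [neg_ne_zero]; exact (sub_ne_zero_re_im h).symm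
  · rw [mem_eqLine]; ring
  · rw [mem_eqLine]; ring

theorem isLine_eqLine {a b c : ℝ} (hab : a ≠ 0 ∨ b ≠ 0) : IsLine (eqLine a b c) := by
  have h : 0 < a ^ 2 + b ^ 2 := by
    rcases hab with h | h <;> positivity
  refine ⟨⟨c * a / (a ^ 2 + b ^ 2), c * b / (a ^ 2 + b ^ 2)⟩,
    ⟨c * a / (a ^ 2 + b ^ 2) - b, c * b / (a ^ 2 + b ^ 2) + a⟩, ?_, ?_⟩
  · intro H
    have h1 := congrArg Complex.re H
    have h2 := congrArg Complex.im H
    simp only [left_eq_add, eq_comm (a := c * a / (a ^ 2 + b ^ 2)), sub_eq_self] at h1 h2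
    simp [h1, h2] at hab
  · refine (line_eq_eqLine ?_ hab ?_ ?_).symm
    · intro H
      have h1 := congrArg Complex.re H
      have h2 := congrArg Complex.im H
      simp only [left_eq_add, sub_eq_self, eq_comm (a := c * a / (a ^ 2 + b ^ 2))] at h1 h2
      simp [h1, h2] at hab
    · rw [mem_eqLine]; field_simp
    · rw [mem_eqLine]; field_simp; ring

theorem eqLine_mul {a b c k : ℝ} (hk : k ≠ 0) : eqLine (k * a) (k * b) (k * c) = eqLine a b c := by
  ext z
  simp only [mem_eqLine]
  constructor
  · intro h; apply mul_left_cancel₀ hk; linear_combination h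
  · intro h; linear_combination k * h

theorem IsLine.exists_eqLine {ℓ : Set ℂ} (h : IsLine ℓ) :
    ∃ a b c : ℝ, (a ≠ 0 ∨ b ≠ 0) ∧ ℓ = eqLine a b c := by
  obtain ⟨A, B, hAB, rfl⟩ := h
  exact ⟨_, _, _, by rw [neg_ne_zero]; exact (sub_ne_zero_re_im hAB).symm, line_eq hAB⟩

theorem eqLine_normalize {a b c : ℝ} (hab : a ≠ 0 ∨ b ≠ 0) :
    (a / √(a ^ 2 + b ^ 2)) ^ 2 + (b / √(a ^ 2 + b ^ 2)) ^ 2 = 1 ∧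
    eqLine a b c = eqLine (a / √(a ^ 2 + b ^ 2)) (b / √(a ^ 2 + b ^ 2)) (c / √(a ^ 2 + b ^ 2)) := by
  have h : 0 < a ^ 2 + b ^ 2 := by
    rcases hab with h | h <;> positivity
  constructor
  · rw [div_pow, div_pow, Real.sq_sqrt h.le, ← add_div, div_self h.ne']
  · have h' := (Real.sqrt_pos.2 h).ne'
    rw [← eqLine_mul (a := a) (b := b) (c := c) (inv_ne_zero h')]
    simp only [div_eq_inv_mul]

theorem IsLine.exists_unit_eqLine {ℓ : Set ℂ} (h : IsLine ℓ) :
    ∃ a b c : ℝ, a ^ 2 + b ^ 2 = 1 ∧ ℓ = eqLine a b c := by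
  obtain ⟨a, b, c, hab, rfl⟩ := h.exists_eqLine
  exact ⟨_, _, _, eqLine_normalize hab⟩

theorem ne_zero_of_unit {a b : ℝ} (h : a ^ 2 + b ^ 2 = 1) : a ≠ 0 ∨ b ≠ 0 := by
  by_contra! H
  simp [H.1, H.2] at h

/-- The foot of the perpendicular from the origin, moved along the line. -/
theorem unit_param_mem {a b c : ℝ} (h : a ^ 2 + b ^ 2 = 1) (s : ℝ) :
    (⟨c * a - s * b, c * b + s * a⟩ : ℂ) ∈ eqLine a b c := by
  rw [mem_eqLine]; linear_combination c * h

theorem eqLine_eq_eqLine {a b c a' b' c' : ℝ} (hab : a ≠ 0 ∨ b ≠ 0) (hab' : a' ≠ 0 ∨ b' ≠ 0)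
    (h : eqLine a b c = eqLine a' b' c') : ∃ k, k ≠ 0 ∧ a' = k * a ∧ b' = k * b ∧ c' = k * c := by
  have hpos : 0 < a ^ 2 + b ^ 2 := by
    rcases hab with h | h <;> positivity
  -- Here `s` parametrizes the first line. The values `0` and `1` give two of its points, so the
  -- normals are parallel; `k` is then the projection coefficient of the second normal on the first.
  have h1 : ∀ s : ℝ, a' * ((c * a - s * b) / (a ^ 2 + b ^ 2)) +
      b' * ((c * b + s * a) / (a ^ 2 + b ^ 2)) = c' := by
    intro s
    have : (⟨(c * a - s * b) / (a ^ 2 + b ^ 2), (c * b + s * a) / (a ^ 2 + b ^ 2)⟩ : ℂ) ∈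
        eqLine a b c := by
      rw [mem_eqLine]; field_simp; ring
    rw [h] at this
    exact this
  have h2 := h1 0
  have h3 := h1 1
  field_simp at h2 h3
  have h4 : b' * a = a' * b := by linarith
  have e1 : a' = (a * a' + b * b') / (a ^ 2 + b ^ 2) * a := by
    field_simp; linear_combination -b * h4
  have e2 : b' = (a * a' + b * b') / (a ^ 2 + b ^ 2) * b := by
    field_simp; linear_combination a * h4
  refine ⟨(a * a' + b * b') / (a ^ 2 + b ^ 2), ?_, e1, e2, ?_⟩
  · intro H
    rw [H, zero_mul] at e1 e2
    simp [e1, e2] at hab'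
  · field_simp; linear_combination -h2

theorem perp_eqLine_iff {a b c a' b' c' : ℝ} (hab : a ≠ 0 ∨ b ≠ 0) (hab' : a' ≠ 0 ∨ b' ≠ 0) :
    Perp (eqLine a b c) (eqLine a' b' c') ↔ a * a' + b * b' = 0 := by
  constructor
  · rintro ⟨-, -, h⟩
    have hpos : 0 < a ^ 2 + b ^ 2 := by
      rcases hab with h | h <;> positivity
    have hpos' : 0 < a' ^ 2 + b' ^ 2 := by
      rcases hab' with h | h <;> positivity
    have := h ⟨c * a / (a ^ 2 + b ^ 2), c * b / (a ^ 2 + b ^ 2)⟩ (by rw [mem_eqLine]; field_simp)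
      ⟨c * a / (a ^ 2 + b ^ 2) - b, c * b / (a ^ 2 + b ^ 2) + a⟩
      (by rw [mem_eqLine]; field_simp; ring)
      ⟨c' * a' / (a' ^ 2 + b' ^ 2) - b', c' * b' / (a' ^ 2 + b' ^ 2) + a'⟩
      (by rw [mem_eqLine]; field_simp; ring)
      ⟨c' * a' / (a' ^ 2 + b' ^ 2), c' * b' / (a' ^ 2 + b' ^ 2)⟩
      (by rw [mem_eqLine]; field_simp)
    rw [Complex.inner] at this
    simp at this
    linear_combination -this
  · intro h
    refine ⟨isLine_eqLine hab, isLine_eqLine hab', fun A hA B hB C hC D hD => ?_⟩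
    rw [mem_eqLine] at hA hB hC hD
    rw [Complex.inner]
    simp
    have e1 : a * (B.re - A.re) + b * (B.im - A.im) = 0 := by linarith
    have e2 : a' * (D.re - C.re) + b' * (D.im - C.im) = 0 := by linarith
    have e4 : a * (D.im - C.im) = b * (D.re - C.re) := by
      rcases hab' with h0 | h0 <;> apply mul_left_cancel₀ h0
      · linear_combination (D.im - C.im) * h - b * e2
      · linear_combination -(D.re - C.re) * h + a * e2
    rcases hab with h0 | h0 <;> apply mul_left_cancel₀ h0
    · linear_combination (B.im - A.im) * e4 + (D.re - C.re) * e1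
    · linear_combination -(B.re - A.re) * e4 + (D.im - C.im) * e1

theorem perpBisector_eq (A B : ℂ) : (AffineSubspace.perpBisector A B : Set ℂ) =
    eqLine (2 * (B.re - A.re)) (2 * (B.im - A.im))
      (B.re ^ 2 + B.im ^ 2 - A.re ^ 2 - A.im ^ 2) := by
  ext z
  rw [SetLike.mem_coe, AffineSubspace.mem_perpBisector_iff_dist_eq, dist_eq_dist_iff, mem_eqLine]
  constructor <;> intro h <;> linarith

theorem infDist_eqLine {a b c : ℝ} (h : a ^ 2 + b ^ 2 = 1) (z : ℂ) :
    Metric.infDist z (eqLine a b c) = |a * z.re + b * z.im - c| := by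
  apply le_antisymm
  · have hm : (⟨z.re - (a * z.re + b * z.im - c) * a, z.im - (a * z.re + b * z.im - c) * b⟩ : ℂ) ∈
        eqLine a b c := by
      rw [mem_eqLine]; linear_combination -(a * z.re + b * z.im - c) * h
    refine (Metric.infDist_le_dist_of_mem hm).trans_eq ?_
    rw [dist_eq_iff (abs_nonneg _), sq_abs]
    linear_combination (a * z.re + b * z.im - c) ^ 2 * h
  · rw [Metric.le_infDist ⟨_, unit_param_mem h 0⟩]
    intro w hw
    rw [mem_eqLine] at hw
    apply abs_le_of_sq_le_sq _ dist_nonneg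
    rw [sq_dist, ← hw]
    -- Cauchy–Schwarz for the unit normal, in the form of Lagrange's identity.
    linear_combination (exp := 1) sq_nonneg (a * (z.im - w.im) - b * (z.re - w.re)) +
       ((z.re - w.re) ^ 2 + (z.im - w.im) ^ 2) * h

theorem mem_conicSet_eqLine {a b c e : ℝ} (h : a ^ 2 + b ^ 2 = 1) (he : 0 < e) {F z : ℂ} :
    z ∈ conicSet (eqLine a b c) F e ↔
      (z.re - F.re) ^ 2 + (z.im - F.im) ^ 2 = e ^ 2 * (a * z.re + b * z.im - c) ^ 2 := by
  rw [conicSet, Set.mem_ofPred_eq, infDist_eqLine h, dist_eq_iff (by positivity), mul_pow, sq_abs]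

theorem mem_sphere_iff {O z : ℂ} {r : ℝ} (hr : 0 ≤ r) :
    z ∈ Metric.sphere O r ↔ (z.re - O.re) ^ 2 + (z.im - O.im) ^ 2 = r ^ 2 := by
  rw [Metric.mem_sphere, dist_eq_iff hr]

/-! ### Tangents of a parabola as perpendicular bisectors -/

/-- A point `P` of the bisector is as far from `F` as from `F'`, and its distance to `F'` is at
least its distance to the directrix. Equality holds exactly on the perpendicular to the directrix at
`F'`, so the bisector meets the parabola once. -/
theorem isTangent_perpBisector {a b c : ℝ} (h : a ^ 2 + b ^ 2 = 1) {F F' : ℂ}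
    (hF : F ∉ eqLine a b c) (hF' : F' ∈ eqLine a b c) :
    IsTangent (AffineSubspace.perpBisector F F' : Set ℂ) (eqLine a b c) F := by
  have hne : F ≠ F' := fun H => hF (H ▸ hF')
  have hab := ne_zero_of_unit h
  have hm : 2 * (F'.re - F.re) ≠ 0 ∨ 2 * (F'.im - F.im) ≠ 0 := by
    simpa using sub_ne_zero_re_im hne
  rw [mem_eqLine] at hF hF'
  have hd : a * F.re + b * F.im - c ≠ 0 := sub_ne_zero.2 hF
  rw [perpBisector_eq]
  refine ⟨isLine_eqLine hm, isLine_eqLine hab, hF, ?_, ?_⟩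
  · rw [perp_eqLine_iff hm hab]
    intro H
    apply hd
    linear_combination hF' - H / 2
  -- The point of contact is `F' + τ (a, b)`; the equation for `τ` says that it is equidistant from
  -- `F` and `F'`.
  · have e : ∃ τ, 2 * τ * (a * F.re + b * F.im - c) =
        (F'.re - F.re) ^ 2 + (F'.im - F.im) ^ 2 :=
      ⟨((F'.re - F.re) ^ 2 + (F'.im - F.im) ^ 2) / (a * F.re + b * F.im - c) / 2, by
        rw [mul_div_cancel₀ _ two_ne_zero, div_mul_cancel₀ _ hd]⟩
    obtain ⟨τ, hτ⟩ := e
    refine ⟨⟨F'.re + τ * a, F'.im + τ * b⟩, Set.eq_singleton_iff_unique_mem.2 ⟨⟨?_, ?_⟩, ?_⟩⟩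
    · rw [mem_eqLine]
      linear_combination -hτ + 2 * τ * hF'
    · rw [parabola, mem_conicSet_eqLine h one_pos]
      have e1 : a * (F'.re + τ * a) + b * (F'.im + τ * b) - c = τ := by
        linear_combination hF' + τ * h
      simp only [e1]
      linear_combination τ ^ 2 * h - hτ + 2 * τ * hF'
    · rintro P ⟨hPm, hP⟩
      rw [mem_eqLine] at hPm
      rw [parabola, mem_conicSet_eqLine h one_pos] at hP
      have e1 : -b * (P.re - F'.re) + a * (P.im - F'.im) = 0 := by
        apply pow_eq_zero_iff (two_ne_zero) |>.1
        linear_combination hP - hPm + ((P.re - F'.re) ^ 2 + (P.im - F'.im) ^ 2) * h +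
          (a * P.re + b * P.im - c + (a * (P.re - F'.re) + b * (P.im - F'.im))) * hF'
      obtain ⟨δ, hδ⟩ : ∃ δ, δ = a * P.re + b * P.im - c := ⟨_, rfl⟩
      have e2 : P.re = F'.re + δ * a := by
        rw [hδ]
        linear_combination -(P.re - F'.re) * h - b * e1 - a * hF'
      have e3 : P.im = F'.im + δ * b := by
        rw [hδ]
        linear_combination -(P.im - F'.im) * h + a * e1 - b * hF'
      have e4 : δ = τ := by
        apply mul_left_cancel₀ hd
        rw [e2, e3] at hPm
        linear_combination δ * hF' - hPm / 2 - hτ / 2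
      exact Complex.ext (e4 ▸ e2) (e4 ▸ e3)

/-- Substituting `T` moved by `t` along `m` into the parabola gives a quadratic in `t` with root
`0`. Uniqueness of the common point makes this a double root, and the vanishing linear term says
that `m` is perpendicular to the segment from `F` to the foot `F'` of `T` on the directrix. -/
theorem IsTangent.exists_perpBisector {a b c : ℝ} (h : a ^ 2 + b ^ 2 = 1) {F : ℂ} {m : Set ℂ}
    (hm : IsTangent m (eqLine a b c) F) :
    ∃ F' ∈ eqLine a b c, m = (AffineSubspace.perpBisector F F' : Set ℂ) := by
  obtain ⟨hml, -, hF, hperp, T, hT⟩ := hm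
  obtain ⟨α, β, γ, h', rfl⟩ := hml.exists_unit_eqLine
  rw [perp_eqLine_iff (ne_zero_of_unit h') (ne_zero_of_unit h)] at hperp
  obtain ⟨⟨hTm, hTp⟩, huniq⟩ := Set.eq_singleton_iff_unique_mem.1 hT
  rw [parabola, mem_conicSet_eqLine h one_pos] at hTp
  rw [mem_eqLine] at hTm hF
  obtain ⟨u, hu⟩ : ∃ u, u = a * T.re + b * T.im - c := ⟨_, rfl⟩
  rw [← hu] at hTp
  obtain ⟨q, hq⟩ : ∃ q, q = (-β * (T.re - F.re) + α * (T.im - F.im)) - u * (α * b - β * a) :=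
    ⟨_, rfl⟩
  -- The other root of that quadratic. Its leading coefficient `(α a + β b) ^ 2` is nonzero because
  -- `m` is not parallel to the axis.
  obtain ⟨t, ht⟩ : ∃ t, t * (α * a + β * b) ^ 2 = -2 * q := ⟨-2 * q / (α * a + β * b) ^ 2, by
    field_simp⟩
  have hmem := huniq ⟨T.re - t * β, T.im + t * α⟩ ⟨by rw [mem_eqLine]; linear_combination hTm, by
    rw [parabola, mem_conicSet_eqLine h one_pos]
    have e1 : a * (T.re - t * β) + b * (T.im + t * α) - c = u + t * (α * b - β * a) := by
      rw [hu]; ring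
    simp only [e1]
    linear_combination hTp + t * ht - 2 * t * hq - t ^ 2 * (α ^ 2 + β ^ 2) * h⟩
  have ht0 : t = 0 := by
    have h1 := congrArg Complex.re hmem
    have h2 := congrArg Complex.im hmem
    simp only [sub_eq_self, add_eq_left, mul_eq_zero] at h1 h2
    rcases h1 with h1 | h1
    · exact h1
    · rcases h2 with h2 | h2
      · exact h2
      · simp [h1, h2] at h'
  have hq0 : q = 0 := by
    rw [ht0] at ht
    linarith
  rw [hq] at hq0
  refine ⟨⟨T.re - u * a, T.im - u * b⟩, ?_, ?_⟩
  · rw [mem_eqLine, hu]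
    linear_combination (c - a * T.re - b * T.im) * h
  · rw [perpBisector_eq]
    simp only
    obtain ⟨k, hk⟩ : ∃ k, k = α * (T.re - u * a - F.re) + β * (T.im - u * b - F.im) := ⟨_, rfl⟩
    have e1 : T.re - u * a - F.re = k * α := by
      rw [hk]; linear_combination -(T.re - u * a - F.re) * h' - β * hq0
    have e2 : T.im - u * b - F.im = k * β := by
      rw [hk]; linear_combination -(T.im - u * b - F.im) * h' + α * hq0
    have hk0 : k ≠ 0 := by
      intro H
      rw [H, zero_mul] at e1 e2
      apply hF
      linear_combination -a * e1 - b * e2 - u * h - hu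
    rw [e1, e2, ← eqLine_mul (k := 2 * k) (by simpa using hk0)]
    congr 1
    · ring
    · ring
    · linear_combination hTp - 2 * T.re * e1 - 2 * T.im * e2 - u ^ 2 * h - 2 * k * hTm

/-! ### Layers of a map -/

@[simp] theorem Figure.point_mem_elements {U : Figure} {P : ℂ} :
    Element.point P ∈ U.elements ↔ P ∈ U.points := by
  simp [Figure.elements]

@[simp] theorem Figure.curve_mem_elements {U : Figure} {c : Set ℂ} :
    Element.curve c ∈ U.elements ↔ c ∈ U.curves := by
  simp [Figure.elements]

theorem Figure.elements_mono {U V : Figure} (hc : U.curves ⊆ V.curves) (hp : U.points ⊆ V.points) :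
    U.elements ⊆ V.elements :=
  Set.union_subset_union (Set.image_mono hc) (Set.image_mono hp)

namespace ToolMap

variable {M : ToolMap}

theorem monotone_curves (M : ToolMap) : Monotone fun n => (M.layer n).curves :=
  monotone_nat_of_le_succ fun _ => Set.subset_union_left

theorem monotone_points (M : ToolMap) : Monotone fun n => (M.layer n).points :=
  monotone_nat_of_le_succ fun _ => Set.subset_union_left

theorem monotone_elements (M : ToolMap) : Monotone fun n => (M.layer n).elements :=
  fun _ _ h => Figure.elements_mono (M.monotone_curves h) (M.monotone_points h)

/-- Layers increase and an input is a finite list, so its elements are all available at one stage.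
-/
theorem exists_layer {I : List Element} (hI : ∀ x ∈ I, x ∈ M.constructible.elements) :
    ∃ n, ∀ x ∈ I, x ∈ (M.layer n).elements := by
  induction I with
  | nil => exact ⟨0, by simp⟩
  | cons x I ih =>
    obtain ⟨n, hn⟩ := ih fun y hy => hI y (List.mem_cons_of_mem _ hy)
    obtain ⟨k, hk⟩ : ∃ k, x ∈ (M.layer k).elements := by
      have := hI x List.mem_cons_self
      cases x <;> simpa [constructible] using this
    refine ⟨max n k, fun y hy => ?_⟩
    rcases List.mem_cons.1 hy with rfl | hy
    · exact M.monotone_elements (le_max_right _ _) hk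
    · exact M.monotone_elements (le_max_left _ _) (hn y hy)

theorem mem_layer_succ_curves {n : ℕ} {a : ConstructionAxiom} (ha : a ∈ M.tool.construction)
    {c : Set ℂ} (h : c ∈ a.obtained (M.layer n)) : c ∈ (M.layer (n + 1)).curves :=
  Or.inr (Set.mem_biUnion (by exact ha) h)

theorem mem_layer_succ_points {n : ℕ} {a : IntersectionAxiom} (ha : a ∈ M.tool.intersection)
    {P : ℂ} (h : P ∈ a.obtained ⟨(M.layer (n + 1)).curves, (M.layer n).points⟩) :
    P ∈ (M.layer (n + 1)).points :=
  Or.inr (Set.mem_biUnion (by exact ha) h)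

theorem curve_mem {a : ConstructionAxiom} (ha : a ∈ M.tool.construction) {I : List Element}
    {c : Set ℂ} (hc : a.Generates I c) (hI : ∀ x ∈ I, x ∈ M.constructible.elements) :
    c ∈ M.constructible.curves := by
  obtain ⟨n, hn⟩ := exists_layer hI
  exact Set.mem_iUnion.2 ⟨n + 1, mem_layer_succ_curves ha ⟨I, hn, hc⟩⟩

theorem point_mem {a : IntersectionAxiom} (ha : a ∈ M.tool.intersection) {I : List Element}
    {P : ℂ} (hP : a.Generates I P) (hI : ∀ x ∈ I, x ∈ M.constructible.elements) :
    P ∈ M.constructible.points := by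
  obtain ⟨n, hn⟩ := exists_layer hI
  refine Set.mem_iUnion.2 ⟨n + 1, mem_layer_succ_points ha ⟨I, fun x hx => ?_, hP⟩⟩
  exact Figure.elements_mono (U := M.layer n)
    (V := ⟨(M.layer (n + 1)).curves, (M.layer n).points⟩)
    (M.monotone_curves n.le_succ) (Set.Subset.refl _) (hn x hx)

theorem initial_points_subset (M : ToolMap) : M.initial.points ⊆ M.constructible.points :=
  fun _ hP => Set.mem_iUnion.2 ⟨0, hP⟩

/-- Induction over the layers with one invariant for curves and one for points. The figure `U` is
arbitrary because points arise from a mixed figure, with the new curves and the old points. -/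
theorem forall_constructible_points {p : Set ℂ → Prop} {q : ℂ → Prop}
    (hc₀ : ∀ c ∈ M.initial.curves, p c) (hp₀ : ∀ P ∈ M.initial.points, q P)
    (hc : ∀ U : Figure, (∀ c ∈ U.curves, p c) → (∀ P ∈ U.points, q P) →
      ∀ a ∈ M.tool.construction, ∀ c ∈ a.obtained U, p c)
    (hp : ∀ U : Figure, (∀ c ∈ U.curves, p c) → (∀ P ∈ U.points, q P) →
      ∀ a ∈ M.tool.intersection, ∀ P ∈ a.obtained U, q P) :
    ∀ P ∈ M.constructible.points, q P := by
  have key : ∀ n, (∀ c ∈ (M.layer n).curves, p c) ∧ ∀ P ∈ (M.layer n).points, q P := by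
    intro n
    induction n with
    | zero => exact ⟨hc₀, hp₀⟩
    | succ n ih =>
      have h1 : ∀ c ∈ (M.layer (n + 1)).curves, p c := by
        rintro c (h | h)
        · exact ih.1 c h
        · obtain ⟨a, ha, h⟩ := Set.mem_iUnion₂.1 h
          exact hc _ ih.1 ih.2 a ha c h
      refine ⟨h1, ?_⟩
      rintro P (h | h)
      · exact ih.2 P h
      · obtain ⟨a, ha, h⟩ := Set.mem_iUnion₂.1 h
        exact hp ⟨(M.layer (n + 1)).curves, (M.layer n).points⟩ h1 ih.2 a ha P h
  intro P hP
  obtain ⟨n, hn⟩ := Set.mem_iUnion.1 hP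
  exact (key n).2 P hn

/-- The map of a tool whose initial set consists of finitely many points. -/
def ofPoints (E : Tool) (s : Finset ℂ) (hs : s.Nonempty) : ToolMap where
  tool := E
  initial := ⟨∅, s⟩
  initial_finite := by
    simpa [Figure.elements] using s.finite_toSet.image Element.point
  initial_nonempty := by
    simpa [Figure.elements] using hs

theorem isInfinite_of_natCast_mem (h : ∀ n : ℕ, (n : ℂ) ∈ M.constructible.points) :
    M.IsInfinite := by
  refine Set.infinite_of_injective_forall_mem (f := fun n : ℕ => Element.point n) ?_ ?_
  · intro m n hmn
    simpa using hmn
  · intro n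
    simpa using h n

end ToolMap

/-! ### Planes over subfields of the real numbers -/

/-- The points with coordinates in `X`. -/
def plane (X : Subfield ℝ) : Set ℂ := {z | z.re ∈ X ∧ z.im ∈ X}

/-- `X` contains the real square roots of its elements. -/
def SqrtClosed (X : Subfield ℝ) : Prop := ∀ x : ℝ, x ^ 2 ∈ X → x ∈ X

/-- `X` contains the real roots of depressed cubics with coefficients in `X`. -/
def CubicClosed (X : Subfield ℝ) : Prop :=
  ∀ p ∈ X, ∀ q ∈ X, ∀ x : ℝ, x ^ 3 + p * x + q = 0 → x ∈ X

theorem isInfinite_of_plane_subset {M : ToolMap} {X : Subfield ℝ}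
    (h : plane X ⊆ M.constructible.points) : M.IsInfinite :=
  ToolMap.isInfinite_of_natCast_mem fun n => h ⟨by simp, by simp⟩

/-! ### Sets closed under the intersection of circles -/

/-- `E` contains the common points of the circles whose centers are distinct points of `E` and
which pass through points of `E`. -/
def CircleClosed (E : Set ℂ) : Prop :=
  ∀ A ∈ E, ∀ B ∈ E, ∀ C ∈ E, ∀ D ∈ E, A ≠ C → ∀ P, ‖P - A‖ = ‖B - A‖ → ‖P - C‖ = ‖D - C‖ → P ∈ E

/-- The apex of the equilateral triangle on `0` and `1`. The two circles with radius one about these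
points meet there and at `1 - ω`. -/
theorem exists_sixth_root : ∃ ω : ℂ, ω ^ 2 = ω - 1 ∧ ‖ω‖ = 1 ∧ ‖ω - 1‖ = 1 ∧
    (starRingEnd ℂ) ω = 1 - ω := by
  refine ⟨⟨1 / 2, √3 / 2⟩, ?_, ?_, ?_, ?_⟩
  · apply Complex.ext
    · simp [sq]; ring_nf; norm_num
    · simp [sq]; ring
  · rw [← sq_eq_sq₀ (norm_nonneg _) zero_le_one, Complex.sq_norm, Complex.normSq_apply]
    simp only; ring_nf; norm_num
  · rw [← sq_eq_sq₀ (norm_nonneg _) zero_le_one, Complex.sq_norm, Complex.normSq_apply]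
    simp; ring_nf; norm_num
  · apply Complex.ext
    · simp; norm_num
    · simp

namespace CircleClosed

variable {E : Set ℂ}

theorem add_mul_sub (hE : CircleClosed E) {ω : ℂ} (h1 : ‖ω‖ = 1) (h2 : ‖ω - 1‖ = 1) {A B : ℂ}
    (hA : A ∈ E) (hB : B ∈ E) :
    A + ω * (B - A) ∈ E := by
  rcases eq_or_ne A B with rfl | h
  · simpa
  · refine hE A hA B hB B hB A hA h _ ?_ ?_
    · rw [add_sub_cancel_left, norm_mul, h1, one_mul]
    · rw [show A + ω * (B - A) - B = (ω - 1) * (B - A) by ring, norm_mul, h2, one_mul, norm_sub_rev]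

/-- Three rotations by sixty degrees about `A` make a half-turn, as `ω ^ 3 = -1`. -/
theorem two_mul_sub (hE : CircleClosed E) {A B : ℂ} (hA : A ∈ E) (hB : B ∈ E) : 2 * A - B ∈ E := by
  obtain ⟨ω, h0, h1, h2, -⟩ := exists_sixth_root
  have := hE.add_mul_sub h1 h2 hA (hE.add_mul_sub h1 h2 hA (hE.add_mul_sub h1 h2 hA hB))
  convert this using 1
  linear_combination -(B - A) * (ω + 1) * h0

/-- Euclid's transfer of a distance, which makes `RadiusCircle` redundant. Take `D` to be the mirror
image of `C` in the perpendicular bisector of `AB`, which exchanges `A` and `B`. The apexes of the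
equilateral triangles on `AB` lie on this bisector, so the circles about them through `C` also pass
through `D`. -/
theorem exists_copy (hE : CircleClosed E) {A B C : ℂ} (hA : A ∈ E) (hB : B ∈ E) (hC : C ∈ E) :
    ∃ D ∈ E, ‖D - A‖ = ‖C - B‖ := by
  rcases eq_or_ne A B with rfl | h
  · exact ⟨C, hC, rfl⟩
  obtain ⟨ω, h0, h1, h2, h3⟩ := exists_sixth_root
  have hBA : B - A ≠ 0 := sub_ne_zero.2 h.symm
  -- In the coordinate in which `A` is `0` and `B` is `1`, `C` is `1 + t` and its mirror image is
  -- `-conj t`.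
  obtain ⟨t, rfl⟩ : ∃ t, C = B + (B - A) * t := ⟨(C - B) / (B - A), by field_simp; ring⟩
  have hX := hE.add_mul_sub h1 h2 hA hB
  have h1' : ‖1 - ω‖ = 1 := by rw [norm_sub_rev, h2]
  have h2' : ‖1 - ω - 1‖ = 1 := by rw [← h1, ← norm_neg ω]; congr 1; ring
  have hY := hE.add_mul_sub h1' h2' hA hB
  have aux : ∀ η : ℂ, (starRingEnd ℂ) η = 1 - η →
      ‖A - (B - A) * (starRingEnd ℂ) t - (A + η * (B - A))‖ =
        ‖B + (B - A) * t - (A + η * (B - A))‖ := by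
    intro η hη
    have e1 : A - (B - A) * (starRingEnd ℂ) t - (A + η * (B - A)) =
      -((B - A) * (starRingEnd ℂ) (1 + t - η)) := by
      simp only [map_add, map_sub, map_one, hη]; ring
    have e2 : B + (B - A) * t - (A + η * (B - A)) = (B - A) * (1 + t - η) := by ring
    rw [e1, e2, norm_neg, norm_mul, norm_mul, Complex.norm_conj]
  refine ⟨A - (B - A) * (starRingEnd ℂ) t, ?_, ?_⟩
  · refine hE _ hX _ hC _ hY _ hC ?_ _ (aux _ h3) (aux _ ?_)
    -- The two apexes differ because `(2 ω - 1) ^ 2 = -3`.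
    · intro H
      have H' : (2 * ω - 1) * (B - A) = 0 := by linear_combination H
      have H2 := (mul_eq_zero.1 H').resolve_right hBA
      have : (3 : ℂ) = 0 := by linear_combination (1 - 2 * ω) * H2 + 4 * h0
      norm_num at this
    · rw [map_sub, map_one, h3]
  · rw [show A - (B - A) * (starRingEnd ℂ) t - A = -((B - A) * (starRingEnd ℂ) t) by ring,
      add_sub_cancel_left, norm_neg, norm_mul, norm_mul, Complex.norm_conj]

/-- The circles may have radii which are distances of points. -/
theorem mem_of_norm_eq (hE : CircleClosed E) {A B B' C D D' : ℂ} (hA : A ∈ E) (hB : B ∈ E)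
    (hB' : B' ∈ E) (hC : C ∈ E)
    (hD : D ∈ E) (hD' : D' ∈ E) (hAC : A ≠ C) {P : ℂ} (h1 : ‖P - A‖ = ‖B' - B‖)
    (h2 : ‖P - C‖ = ‖D' - D‖) : P ∈ E := by
  obtain ⟨Q, hQ, hQ'⟩ := hE.exists_copy hA hB hB'
  obtain ⟨R, hR, hR'⟩ := hE.exists_copy hC hD hD'
  exact hE A hA Q hQ C hC R hR hAC P (h1.trans hQ'.symm) (h2.trans hR'.symm)

/-- The fourth vertex of a parallelogram is determined by its distances to `A` and `B`, which equal
the opposite sides. -/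
theorem add_sub (hE : CircleClosed E) {A B C : ℂ} (hA : A ∈ E) (hB : B ∈ E) (hC : C ∈ E) :
    A + B - C ∈ E := by
  rcases eq_or_ne A B with rfl | h
  · rw [← two_mul]; exact hE.two_mul_sub hA hC
  · refine hE.mem_of_norm_eq hA hC hB hB hC hA h ?_ ?_
    · congr 1; ring
    · congr 1; ring

theorem add (hE : CircleClosed E) (h0 : (0 : ℂ) ∈ E) {A B : ℂ} (hA : A ∈ E) (hB : B ∈ E) :
    A + B ∈ E := by
  simpa using hE.add_sub hA hB h0

theorem neg (hE : CircleClosed E) (h0 : (0 : ℂ) ∈ E) {A : ℂ} (hA : A ∈ E) : -A ∈ E := by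
  simpa using hE.two_mul_sub h0 hA

theorem sub (hE : CircleClosed E) (h0 : (0 : ℂ) ∈ E) {A B : ℂ} (hA : A ∈ E) (hB : B ∈ E) :
    A - B ∈ E := by
  simpa using hE.add_sub hA h0 hB

theorem natCast_mul (hE : CircleClosed E) (h0 : (0 : ℂ) ∈ E) (n : ℕ) {A : ℂ} (hA : A ∈ E) :
    n * A ∈ E := by
  induction n with
  | zero => simpa
  | succ n ih => push_cast; rw [add_mul, one_mul]; exact hE.add h0 ih hA

/-- The circles about `±1` with radius `|ω + 1| = √3` meet at `√2 i`; those with radius `|√2 i| =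
√2` meet at `i`. -/
theorem I_mem (hE : CircleClosed E) (h0 : (0 : ℂ) ∈ E) (h1 : (1 : ℂ) ∈ E) : Complex.I ∈ E := by
  obtain ⟨ω, e0, e1, e2, e3⟩ := exists_sixth_root
  have hω : ω ∈ E := by simpa using hE.add_mul_sub e1 e2 h0 h1
  have hneg := hE.neg h0 h1
  have hne : (1 : ℂ) ≠ -1 := by norm_num
  have e4 : ‖ω + 1‖ = √3 := by
    rw [eq_comm, Real.sqrt_eq_iff_mul_self_eq (by norm_num) (norm_nonneg _), ← sq, Complex.sq_norm]
    apply Complex.ofReal_injective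
    rw [Complex.normSq_eq_conj_mul_self, map_add, map_one, e3]
    push_cast
    linear_combination e0
  have hs : (√2 : ℝ) * Complex.I ∈ E := by
    refine hE.mem_of_norm_eq h1 hneg hω hneg hneg hω hne ?_ ?_
    · rw [sub_neg_eq_add, e4, eq_comm, Real.sqrt_eq_iff_mul_self_eq (by norm_num) (norm_nonneg _),
        ← sq, Complex.sq_norm, Complex.normSq_apply]
      simp
      norm_num
    · rw [sub_neg_eq_add, sub_neg_eq_add, e4, eq_comm,
        Real.sqrt_eq_iff_mul_self_eq (by norm_num) (norm_nonneg _),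
        ← sq, Complex.sq_norm, Complex.normSq_apply]
      simp
      norm_num
  have e5 : ‖(√2 : ℝ) * Complex.I - 0‖ = √2 := by simp
  refine hE.mem_of_norm_eq h1 h0 hs hneg h0 hs hne ?_ ?_
  · rw [e5, eq_comm, Real.sqrt_eq_iff_mul_self_eq (by norm_num) (norm_nonneg _),
        ← sq, Complex.sq_norm, Complex.normSq_apply]
    simp
    norm_num
  · rw [e5, eq_comm, Real.sqrt_eq_iff_mul_self_eq (by norm_num) (norm_nonneg _),
        ← sq, Complex.sq_norm, Complex.normSq_apply]
    simp
    norm_num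

theorem conj (hE : CircleClosed E) (h0 : (0 : ℂ) ∈ E) (h1 : (1 : ℂ) ∈ E) {A : ℂ} (hA : A ∈ E) :
    (starRingEnd ℂ) A ∈ E := by
  refine hE 0 h0 A hA 1 h1 A hA zero_ne_one _ ?_ ?_
  · simp
  · rw [← Complex.norm_conj]; simp

theorem inv (hE : CircleClosed E) (h0 : (0 : ℂ) ∈ E) (h1 : (1 : ℂ) ∈ E) {A : ℂ} (hA : A ∈ E) :
    A⁻¹ ∈ E := by
  -- the inverse point is the sum of two points on the unit circle
  have key : ∀ A ∈ E, 1 ≤ ‖A‖ → ((starRingEnd ℂ) A)⁻¹ ∈ E := by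
    intro A hA hn
    have hA0 : A ≠ 0 := norm_pos_iff.1 (by linarith)
    have hN : 1 ≤ Complex.normSq A := by
      rw [Complex.normSq_eq_norm_sq]; nlinarith
    obtain ⟨N, hNe⟩ : ∃ N, N = Complex.normSq A := ⟨_, rfl⟩
    rw [← hNe] at hN
    have hN0 : (0 : ℝ) < N := by linarith
    obtain ⟨y, hy⟩ : ∃ y : ℝ, y ^ 2 = 1 / N - 1 / (4 * N ^ 2) := by
      refine ⟨√(1 / N - 1 / (4 * N ^ 2)), Real.sq_sqrt ?_⟩
      rw [sub_nonneg, div_le_div_iff₀ (by positivity) (by positivity)]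
      nlinarith
    -- These are the common points of the unit circle and of the circle about `A` through `0`. They
    -- exist because `4 N ≥ 1`.
    have aux : ∀ y : ℝ, y ^ 2 = 1 / N - 1 / (4 * N ^ 2) → A * ⟨1 / (2 * N), y⟩ ∈ E := by
      intro y hy
      refine hE 0 h0 1 h1 A hA 0 h0 hA0.symm _ ?_ ?_
      · rw [sub_zero, sub_zero, norm_one, ← sq_eq_sq₀ (norm_nonneg _) zero_le_one, Complex.sq_norm,
          Complex.normSq_mul, ← hNe, Complex.normSq_mk, ← sq y, hy]
        field_simp
        ring
      · rw [show A * ⟨1 / (2 * N), y⟩ - A = A * (⟨1 / (2 * N), y⟩ - 1) by ring, zero_sub, norm_neg,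
          norm_mul]
        convert mul_one _
        rw [← sq_eq_sq₀ (norm_nonneg _) zero_le_one, Complex.sq_norm, Complex.normSq_apply]
        simp only [Complex.sub_re, Complex.sub_im, Complex.one_re, Complex.one_im, sub_zero]
        rw [← sq y, hy]
        field_simp
        ring
    have := hE.add h0 (aux y hy) (aux (-y) (by rw [neg_sq, hy]))
    convert this using 1
    rw [← mul_add]
    have e : (⟨1 / (2 * N), y⟩ + ⟨1 / (2 * N), -y⟩ : ℂ) = (N : ℂ)⁻¹ := by
      rw [← Complex.ofReal_inv]
      apply Complex.ext
      · simp; field_simp; norm_num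
      · simp
    have hc : (starRingEnd ℂ) A ≠ 0 := by simpa using hA0
    rw [e, hNe, Complex.normSq_eq_conj_mul_self]
    field_simp
  rcases eq_or_ne A 0 with rfl | hA0
  · simpa
  -- A small `A` is first multiplied by `n` so that its modulus is at least one; the factor is
  -- restored after inverting.
  obtain ⟨n, hn⟩ := exists_nat_ge ‖A‖⁻¹
  have hpos : 0 < ‖A‖ := norm_pos_iff.2 hA0
  have hn0 : (0 : ℝ) < n := (inv_pos.2 hpos).trans_le hn
  have h2 := key (n * A) (hE.natCast_mul h0 n hA) (by
    rw [norm_mul, Complex.norm_natCast]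
    rwa [inv_le_iff_one_le_mul₀ hpos] at hn)
  have h3 := hE.conj h0 h1 (hE.natCast_mul h0 n h2)
  convert h3 using 1
  have : (n : ℂ) ≠ 0 := by exact_mod_cast hn0.ne'
  simp
  field_simp

/-- Squares come from inverses and sums: `A⁻¹ + (1 - A)⁻¹` is the inverse of `A - A ^ 2`. Products
then follow by polarization. -/
theorem sq (hE : CircleClosed E) (h0 : (0 : ℂ) ∈ E) (h1 : (1 : ℂ) ∈ E) {A : ℂ} (hA : A ∈ E) :
    A ^ 2 ∈ E := by
  rcases eq_or_ne A 0 with rfl | hA0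
  · simpa
  rcases eq_or_ne A 1 with rfl | hA1
  · simpa
  have h2 : 1 - A ≠ 0 := sub_ne_zero.2 hA1.symm
  have := hE.sub h0 hA (hE.inv h0 h1 (hE.add h0 (hE.inv h0 h1 hA)
    (hE.inv h0 h1 (hE.sub h0 h1 hA))))
  convert this using 1
  have e : A⁻¹ + (1 - A)⁻¹ = (A * (1 - A))⁻¹ := by field_simp; ring
  rw [e, inv_inv]
  ring

theorem half (hE : CircleClosed E) (h0 : (0 : ℂ) ∈ E) (h1 : (1 : ℂ) ∈ E) {A : ℂ} (hA : A ∈ E) :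
    A / 2 ∈ E := by
  have := hE.inv h0 h1 (hE.natCast_mul h0 2 (hE.inv h0 h1 hA))
  simpa [div_eq_mul_inv, mul_comm] using this

theorem mul (hE : CircleClosed E) (h0 : (0 : ℂ) ∈ E) (h1 : (1 : ℂ) ∈ E) {A B : ℂ} (hA : A ∈ E)
    (hB : B ∈ E) : A * B ∈ E := by
  have := hE.half h0 h1 (hE.sub h0 (hE.sub h0 (hE.sq h0 h1 (hE.add h0 hA hB)) (hE.sq h0 h1 hA))
    (hE.sq h0 h1 hB))
  convert this using 1
  ring

/-- The field consists of the real points of `E`. Its closure under square roots is the geometric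
content; the description of `E` follows since `E` contains `i` and is closed under conjugation. -/
theorem exists_eq_plane (hE : CircleClosed E) (h0 : (0 : ℂ) ∈ E) (h1 : (1 : ℂ) ∈ E) : ∃ X :
    Subfield ℝ, SqrtClosed X ∧ E = plane X := by
  have hI := hE.I_mem h0 h1
  let X : Subfield ℝ :=
    { carrier := {x | (x : ℂ) ∈ E}
      zero_mem' := by simpa using h0
      one_mem' := by simpa using h1
      add_mem' := fun {a b} ha hb => by
        show ((a + b : ℝ) : ℂ) ∈ E
        rw [Complex.ofReal_add]; exact hE.add h0 ha hb
      mul_mem' := fun {a b} ha hb => by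
        show ((a * b : ℝ) : ℂ) ∈ E
        rw [Complex.ofReal_mul]; exact hE.mul h0 h1 ha hb
      neg_mem' := fun {a} ha => by
        show ((-a : ℝ) : ℂ) ∈ E
        rw [Complex.ofReal_neg]; exact hE.neg h0 ha
      inv_mem' := fun a ha => by
        show ((a⁻¹ : ℝ) : ℂ) ∈ E
        rw [Complex.ofReal_inv]; exact hE.inv h0 h1 ha }
  have hX : ∀ x : ℝ, x ∈ X ↔ (x : ℂ) ∈ E := fun x => Iff.rfl
  refine ⟨X, ?_, ?_⟩
  · intro x hx
    -- For `x ^ 2 = 1` the two centers used below coincide.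
    rcases eq_or_ne (x ^ 2) 1 with h | h
    · rcases sq_eq_one_iff.1 h with rfl | rfl
      · exact one_mem X
      · exact neg_mem (one_mem X)
    have h2 : (x ^ 2 - 1) / 2 ∈ X := div_mem (sub_mem hx (one_mem X)) (ofNat_mem X 2)
    have h3 : (x ^ 2 + 1) / 2 ∈ X := div_mem (add_mem hx (one_mem X)) (ofNat_mem X 2)
    have hne : (((x ^ 2 - 1) / 2 : ℝ) : ℂ) ≠ ((-((x ^ 2 - 1) / 2) : ℝ) : ℂ) := by
      intro H
      apply h
      have := Complex.ofReal_injective H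
      linarith
    -- The point `x i` is common to the circles about `±(x ^ 2 - 1) / 2` with radius `(x ^ 2 + 1) /
    -- 2`, since the squares of radius and abscissa differ by `x ^ 2`.
    have aux : ∀ c : ℝ, c ^ 2 = ((x ^ 2 - 1) / 2) ^ 2 →
        ‖x * Complex.I - c‖ = ‖(((x ^ 2 + 1) / 2 : ℝ) : ℂ) - 0‖ := by
      intro c hc
      rw [← sq_eq_sq₀ (norm_nonneg _) (norm_nonneg _), Complex.sq_norm, Complex.sq_norm,
        Complex.normSq_apply, Complex.normSq_apply]
      simp only [Complex.sub_re, Complex.mul_re, Complex.ofReal_re, Complex.I_re, Complex.ofReal_im,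
        Complex.I_im, Complex.sub_im, Complex.mul_im, Complex.zero_re, Complex.zero_im]
      linear_combination hc
    have := hE.mem_of_norm_eq ((hX _).1 h2) h0 ((hX _).1 h3) ((hX _).1 (neg_mem h2)) h0
      ((hX _).1 h3) hne (aux _ rfl) (aux _ (neg_sq _))
    rw [hX]
    have h4 := hE.mul h0 h1 (hE.neg h0 hI) this
    convert h4 using 1
    linear_combination (x : ℂ) * Complex.I_sq
  · ext z
    constructor
    · intro hz
      have hzc := hE.conj h0 h1 hz
      constructor
      · rw [hX]
        convert hE.half h0 h1 (hE.add h0 hz hzc) using 1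
        rw [Complex.add_conj]; push_cast; ring
      · rw [hX]
        convert hE.half h0 h1 (hE.mul h0 h1 (hE.neg h0 hI) (hE.sub h0 hz hzc)) using 1
        rw [Complex.sub_conj]; push_cast
        linear_combination (z.im : ℂ) * Complex.I_sq
    · rintro ⟨h2, h3⟩
      rw [← Complex.re_add_im z]
      exact hE.add h0 h2 (hE.mul h0 h1 h3 hI)

end CircleClosed

/-! ### Real roots of polynomials of degree at most four -/

variable {X : Subfield ℝ}

theorem SqrtClosed.quadratic (hX : SqrtClosed X) {a b c : ℝ} (ha : a ∈ X) (hb : b ∈ X) (hc : c ∈ X)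
    (hne : ¬ (a = 0 ∧ b = 0 ∧ c = 0)) {x : ℝ} (h : a * x ^ 2 + b * x + c = 0) : x ∈ X := by
  rcases eq_or_ne a 0 with rfl | ha0
  · have hb0 : b ≠ 0 := by
      rintro rfl
      apply hne
      simpa using h
    have : x = -c / b := by field_simp; linear_combination h
    rw [this]
    exact div_mem (neg_mem hc) hb
  · have h1 : 2 * a * x + b ∈ X := by
      apply hX
      have : (2 * a * x + b) ^ 2 = b ^ 2 - 4 * a * c := by linear_combination 4 * a * h
      rw [this]
      have h4 : (4 : ℝ) ∈ X := ofNat_mem X 4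
      exact sub_mem (pow_mem hb 2) (mul_mem (mul_mem h4 ha) hc)
    have : x = (2 * a * x + b - b) / (2 * a) := by field_simp; ring
    rw [this]
    exact div_mem (sub_mem h1 hb) (mul_mem (ofNat_mem X 2) ha)

theorem CubicClosed.cubic (hX : SqrtClosed X) (hX' : CubicClosed X) {a b c d : ℝ} (ha : a ∈ X)
    (hb : b ∈ X) (hc : c ∈ X) (hd : d ∈ X) (hne : ¬ (a = 0 ∧ b = 0 ∧ c = 0 ∧ d = 0)) {x : ℝ}
    (h : a * x ^ 3 + b * x ^ 2 + c * x + d = 0) : x ∈ X := by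
  rcases eq_or_ne a 0 with rfl | ha0
  · exact hX.quadratic hb hc hd (by simpa using hne) (by linear_combination h)
  · have hs : b / (3 * a) ∈ X := div_mem hb (mul_mem (ofNat_mem X 3) ha)
    obtain ⟨s, hs'⟩ : ∃ s, s = b / (3 * a) := ⟨_, rfl⟩
    rw [← hs'] at hs
    have hb' : b = 3 * a * s := by rw [hs']; field_simp
    have h3 : (3 : ℝ) ∈ X := ofNat_mem X 3
    have h2 : (2 : ℝ) ∈ X := ofNat_mem X 2
    have h1 : x + s ∈ X := by
      refine hX' (c / a - 3 * s ^ 2) (sub_mem (div_mem hc ha) (mul_mem h3 (pow_mem hs 2)))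
        (d / a - c / a * s + 2 * s ^ 3)
        (add_mem (sub_mem (div_mem hd ha) (mul_mem (div_mem hc ha) hs))
          (mul_mem h2 (pow_mem hs 3))) _ ?_
      rw [hb'] at h
      field_simp
      linear_combination h
    simpa using sub_mem h1 hs

/-- Ferrari's method: if `v` solves the resolvent and `w ^ 2 = v`, the quartic is `(x ^ 2 + (v + p)
/ 2) ^ 2 - (w x - q / (2 w)) ^ 2`, a product of two quadratics. A positive `v` is needed to keep `w`
real and nonzero. -/
theorem CubicClosed.depressed_quartic (hX : SqrtClosed X) (hX' : CubicClosed X) {p q r : ℝ}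
    (hp : p ∈ X) (hq : q ∈ X) (hr : r ∈ X) {x : ℝ} (h : x ^ 4 + p * x ^ 2 + q * x + r = 0) :
    x ∈ X := by
  rcases eq_or_ne q 0 with rfl | hq0
  · apply hX
    exact hX.quadratic (one_mem X) hp hr (by simp) (by linear_combination h)
  -- the resolvent cubic
  obtain ⟨v, hv0, hv⟩ : ∃ v : ℝ, 0 < v ∧ v * ((v + p) ^ 2 - 4 * r) = q ^ 2 := by
    -- At `0` the function is at most `q ^ 2`. At the right endpoint its first factor is at least `q
    -- ^ 2` and its second at least `1`, so the intermediate value theorem applies.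
    have hcont : ContinuousOn (fun v : ℝ => v * ((v + p) ^ 2 - 4 * r))
        (Set.Icc 0 (q ^ 2 + 1 + |p| + 4 * |r|)) := by fun_prop
    have hle : (0 : ℝ) ≤ q ^ 2 + 1 + |p| + 4 * |r| := by positivity
    have hmem : q ^ 2 ∈ Set.Icc ((fun v : ℝ => v * ((v + p) ^ 2 - 4 * r)) 0)
        ((fun v : ℝ => v * ((v + p) ^ 2 - 4 * r)) (q ^ 2 + 1 + |p| + 4 * |r|)) := by
      constructor
      · simp only [zero_mul]; positivity
      · have e1 : q ^ 2 + 1 + 4 * |r| ≤ q ^ 2 + 1 + |p| + 4 * |r| + p := by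
          linarith [neg_abs_le p]
        have e2 : (q ^ 2 + 1 + 4 * |r|) ^ 2 ≤ (q ^ 2 + 1 + |p| + 4 * |r| + p) ^ 2 :=
          pow_le_pow_left₀ (by positivity) e1 2
        have e3 : 1 ≤ (q ^ 2 + 1 + |p| + 4 * |r| + p) ^ 2 - 4 * r := by
          nlinarith [le_abs_self r, abs_nonneg r, sq_nonneg q, mul_nonneg (sq_nonneg q)
            (abs_nonneg r)]
        show q ^ 2 ≤ (q ^ 2 + 1 + |p| + 4 * |r|) *
          ((q ^ 2 + 1 + |p| + 4 * |r| + p) ^ 2 - 4 * r)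
        have e4 : q ^ 2 ≤ q ^ 2 + 1 + |p| + 4 * |r| := by
          linarith [abs_nonneg p, abs_nonneg r]
        exact e4.trans (le_mul_of_one_le_right hle e3)
    obtain ⟨v, hv, hv'⟩ := intermediate_value_Icc hle hcont hmem
    refine ⟨v, lt_of_le_of_ne hv.1 ?_, hv'⟩
    rintro rfl
    simp only [zero_mul] at hv'
    exact hq0 (pow_eq_zero_iff two_ne_zero |>.1 hv'.symm)
  have h2 : (2 : ℝ) ∈ X := ofNat_mem X 2
  have h4 : (4 : ℝ) ∈ X := ofNat_mem X 4
  have hvX : v ∈ X := by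
    refine CubicClosed.cubic hX hX' (one_mem X) (mul_mem h2 hp)
      (sub_mem (pow_mem hp 2) (mul_mem h4 hr)) (neg_mem (pow_mem hq 2)) (by simp) (x := v) ?_
    linear_combination hv
  have hw : √v ∈ X := hX _ (by rwa [Real.sq_sqrt hv0.le])
  obtain ⟨w, hw'⟩ : ∃ w, w = √v := ⟨_, rfl⟩
  have hwv : w ^ 2 = v := by rw [hw', Real.sq_sqrt hv0.le]
  rw [← hw'] at hw
  have hw0 : w ≠ 0 := by
    rintro rfl
    simp at hwv
    exact hv0.ne hwv
  have hdX : q / (2 * w) ∈ X := div_mem hq (mul_mem h2 hw)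
  have hsX : (v + p) / 2 ∈ X := div_mem (add_mem hvX hp) h2
  have key : (x ^ 2 + (v + p) / 2 - (w * x - q / (2 * w))) *
      (x ^ 2 + (v + p) / 2 + (w * x - q / (2 * w))) = 0 := by
    have e : (q / (2 * w)) ^ 2 = (v + p) ^ 2 / 4 - r := by
      rw [div_pow, mul_pow, hwv]
      field_simp
      linear_combination -4 * hv
    have e' : 2 * w * (q / (2 * w)) = q := by field_simp
    linear_combination h - x ^ 2 * hwv + x * e' - e
  rcases mul_eq_zero.1 key with h | h
  · exact hX.quadratic (one_mem X) (neg_mem hw) (add_mem hsX hdX) (by simp)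
      (by linear_combination h)
  · exact hX.quadratic (one_mem X) hw (sub_mem hsX hdX) (by simp)
      (by linear_combination h)

theorem CubicClosed.quartic (hX : SqrtClosed X) (hX' : CubicClosed X) {a b c d e : ℝ} (ha : a ∈ X)
    (hb : b ∈ X) (hc : c ∈ X) (hd : d ∈ X) (he : e ∈ X)
    (hne : ¬ (a = 0 ∧ b = 0 ∧ c = 0 ∧ d = 0 ∧ e = 0)) {x : ℝ}
    (h : a * x ^ 4 + b * x ^ 3 + c * x ^ 2 + d * x + e = 0) : x ∈ X := by
  rcases eq_or_ne a 0 with rfl | ha0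
  · exact CubicClosed.cubic hX hX' hb hc hd he (by simpa using hne) (by linear_combination h)
  · have hs : b / (4 * a) ∈ X := div_mem hb (mul_mem (ofNat_mem X 4) ha)
    obtain ⟨s, hs'⟩ : ∃ s, s = b / (4 * a) := ⟨_, rfl⟩
    rw [← hs'] at hs
    have hb' : b = 4 * a * s := by rw [hs']; field_simp
    have h2 : (2 : ℝ) ∈ X := ofNat_mem X 2
    have h3 : (3 : ℝ) ∈ X := ofNat_mem X 3
    have h6 : (6 : ℝ) ∈ X := ofNat_mem X 6
    have h8 : (8 : ℝ) ∈ X := ofNat_mem X 8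
    have hc' := div_mem hc ha
    have hd' := div_mem hd ha
    have he' := div_mem he ha
    have h1 : x + s ∈ X := by
      refine CubicClosed.depressed_quartic hX hX' (p := c / a - 6 * s ^ 2)
        (q := d / a - 2 * (c / a) * s + 8 * s ^ 3)
        (r := e / a - d / a * s + c / a * s ^ 2 - 3 * s ^ 4)
        (sub_mem hc' (mul_mem h6 (pow_mem hs 2)))
        (add_mem (sub_mem hd' (mul_mem (mul_mem h2 hc') hs)) (mul_mem h8 (pow_mem hs 3)))
        (sub_mem (add_mem (sub_mem he' (mul_mem hd' hs)) (mul_mem hc' (pow_mem hs 2)))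
          (mul_mem h3 (pow_mem hs 4))) ?_
      rw [hb'] at h
      field_simp
      linear_combination h
    simpa using sub_mem h1 hs

/-! ### Curves over a subfield and their intersections -/

/-- A line with coefficients in `X`. -/
def IsLineOver (X : Subfield ℝ) (ℓ : Set ℂ) : Prop :=
  ∃ a ∈ X, ∃ b ∈ X, ∃ c ∈ X, a ^ 2 + b ^ 2 = 1 ∧ ℓ = eqLine a b c

/-- A circle with coefficients in `X`. -/
def IsCircleOver (X : Subfield ℝ) (s : Set ℂ) : Prop :=
  ∃ O ∈ plane X, ∃ r ∈ X, 0 < r ∧ s = Metric.sphere O r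

/-- A conic with coefficients in `X`. -/
def IsConicOver (X : Subfield ℝ) (s : Set ℂ) : Prop :=
  ∃ a ∈ X, ∃ b ∈ X, ∃ c ∈ X, ∃ F ∈ plane X, ∃ e ∈ X,
    a ^ 2 + b ^ 2 = 1 ∧ F ∉ eqLine a b c ∧ 0 < e ∧ s = conicSet (eqLine a b c) F e

/-! ### Lines, circles and conics are different kinds of curves -/

/-- Curves are bare sets, so their kinds must be told apart. Along a line with unit speed the
squared distance to a fixed point has second difference `2`, so it cannot be constant. -/
theorem not_isCircle_of_isLine {c : Set ℂ} (h : IsLine c) : ¬ IsCircle c := by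
  rintro ⟨O, r, hr, h'⟩
  obtain ⟨a, b, d, hab, rfl⟩ := h.exists_unit_eqLine
  have key : ∀ s : ℝ, (d * a - s * b - O.re) ^ 2 + (d * b + s * a - O.im) ^ 2 = r ^ 2 := by
    intro s
    have := unit_param_mem (c := d) hab s
    rwa [h', mem_sphere_iff hr.le] at this
  have h0 := key 0
  have h1 := key 1
  have h2 := key (-1)
  have : (1 : ℝ) = 0 := by linear_combination (h1 + h2) / 2 - h0 - hab
  norm_num at this

/-- The second difference along the line shows that it is not parallel to the directrix. At the
point where it meets the directrix the distance to the focus would be zero, which puts `F` on the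
directrix. -/
theorem not_isConic_of_isLine {c : Set ℂ} (h : IsLine c) : ¬ IsConic c := by
  rintro ⟨ℓ, F, e, hℓ, hF, he, h'⟩
  obtain ⟨a, b, d, hab, rfl⟩ := h.exists_unit_eqLine
  obtain ⟨α, β, γ, hαβ, rfl⟩ := hℓ.exists_unit_eqLine
  have key : ∀ s : ℝ, (d * a - s * b - F.re) ^ 2 + (d * b + s * a - F.im) ^ 2 =
      e ^ 2 * (α * (d * a - s * b) + β * (d * b + s * a) - γ) ^ 2 := by
    intro s
    have := unit_param_mem (c := d) hab s
    rwa [h', mem_conicSet_eqLine hαβ he] at this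
  have e1 : 1 = e ^ 2 * (β * a - α * b) ^ 2 := by
    linear_combination (key 1 + key (-1)) / 2 - key 0 - hab
  have e2 : β * a - α * b ≠ 0 := by
    intro H
    rw [H] at e1
    norm_num at e1
  obtain ⟨s, hs⟩ : ∃ s, s * (β * a - α * b) = γ - α * d * a - β * d * b :=
    ⟨_, div_mul_cancel₀ _ e2⟩
  have e3 : α * (d * a - s * b) + β * (d * b + s * a) - γ = 0 := by linear_combination hs
  have e4 := key s
  rw [e3] at e4
  have e5 : d * a - s * b - F.re = 0 := by
    nlinarith [sq_nonneg (d * a - s * b - F.re), sq_nonneg (d * b + s * a - F.im)]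
  have e6 : d * b + s * a - F.im = 0 := by
    nlinarith [sq_nonneg (d * a - s * b - F.re), sq_nonneg (d * b + s * a - F.im)]
  apply hF
  rw [mem_eqLine]
  linear_combination e3 - α * e5 - β * e6

/-- Add the conic equation over two antipodal points of the circle. The left side does not depend on
the diameter, while the right side is larger by `2 e ^ 2 r ^ 2` for the diameter normal to the
directrix than for the parallel one. -/
theorem not_isConic_of_isCircle {c : Set ℂ} (h : IsCircle c) : ¬ IsConic c := by
  rintro ⟨ℓ, F, e, hℓ, hF, he, h'⟩
  obtain ⟨α, β, γ, hαβ, rfl⟩ := hℓ.exists_unit_eqLine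
  obtain ⟨O, r, hr, rfl⟩ := h
  have key : ∀ x y : ℝ, x ^ 2 + y ^ 2 = r ^ 2 → (O.re + x - F.re) ^ 2 + (O.im + y - F.im) ^ 2 =
      e ^ 2 * (α * (O.re + x) + β * (O.im + y) - γ) ^ 2 := by
    intro x y hxy
    have : (⟨O.re + x, O.im + y⟩ : ℂ) ∈ Metric.sphere O r := by
      rw [mem_sphere_iff hr.le]
      linear_combination hxy
    rwa [h', mem_conicSet_eqLine hαβ he] at this
  have h1 := key (r * α) (r * β) (by linear_combination r ^ 2 * hαβ)
  have h2 := key (-(r * α)) (-(r * β)) (by linear_combination r ^ 2 * hαβ)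
  have h3 := key (r * β) (-(r * α)) (by linear_combination r ^ 2 * hαβ)
  have h4 := key (-(r * β)) (r * α) (by linear_combination r ^ 2 * hαβ)
  have : (e * r) ^ 2 * (α ^ 2 + β ^ 2) ^ 2 = 0 := by
    linear_combination (h3 + h4 - h1 - h2) / 2
  rw [hαβ] at this
  have h5 : 0 < e * r := by positivity
  nlinarith

variable {X : Subfield ℝ}

theorem isLineOver_eqLine (hX : SqrtClosed X) {a b c : ℝ} (ha : a ∈ X) (hb : b ∈ X) (hc : c ∈ X)
    (hab : a ≠ 0 ∨ b ≠ 0) : IsLineOver X (eqLine a b c) := by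
  have hs : √(a ^ 2 + b ^ 2) ∈ X := by
    apply hX
    rw [Real.sq_sqrt (by positivity)]
    exact add_mem (pow_mem ha 2) (pow_mem hb 2)
  exact ⟨_, div_mem ha hs, _, div_mem hb hs, _, div_mem hc hs, eqLine_normalize hab⟩

theorem isLineOver_line (hX : SqrtClosed X) {A B : ℂ} (hA : A ∈ plane X) (hB : B ∈ plane X)
    (h : A ≠ B) : IsLineOver X (line[ℝ, A, B] : Set ℂ) := by
  rw [line_eq h]
  refine isLineOver_eqLine hX (sub_mem hB.2 hA.2) (neg_mem (sub_mem hB.1 hA.1))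
    (sub_mem (mul_mem (sub_mem hB.2 hA.2) hA.1) (mul_mem (sub_mem hB.1 hA.1) hA.2)) ?_
  rw [neg_ne_zero]
  exact (sub_ne_zero_re_im h).symm

theorem dist_mem (hX : SqrtClosed X) {A B : ℂ} (hA : A ∈ plane X) (hB : B ∈ plane X) :
    dist A B ∈ X := by
  apply hX
  rw [sq_dist]
  exact add_mem (pow_mem (sub_mem hA.1 hB.1) 2) (pow_mem (sub_mem hA.2 hB.2) 2)

theorem isCircleOver_sphere (hX : SqrtClosed X) {A B C : ℂ} (hA : A ∈ plane X) (hB : B ∈ plane X)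
    (hC : C ∈ plane X) (h : B ≠ C) : IsCircleOver X (Metric.sphere A (dist B C)) :=
  ⟨A, hA, _, dist_mem hX hB hC, dist_pos.2 h, rfl⟩

/-! ### Intersections stay in the plane over `X` -/

theorem IsLineOver.inter_line {ℓ ℓ' : Set ℂ} (h : IsLineOver X ℓ) (h' : IsLineOver X ℓ')
    (hne : ℓ ≠ ℓ') {z : ℂ} (hz : z ∈ ℓ) (hz' : z ∈ ℓ') : z ∈ plane X := by
  obtain ⟨a, ha, b, hb, c, hc, hab, rfl⟩ := h
  obtain ⟨a', ha', b', hb', c', hc', hab', rfl⟩ := h'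
  rw [mem_eqLine] at hz hz'
  have hd : a * b' - a' * b ≠ 0 := by
    intro H
    have hk : (a * a' + b * b') ^ 2 = 1 := by
      linear_combination hab * (a' ^ 2 + b' ^ 2) + hab' - (a * b' - a' * b) * H
    have hk0 : a * a' + b * b' ≠ 0 := by
      intro h
      rw [h] at hk
      norm_num at hk
    apply hne
    rw [← eqLine_mul hk0]
    have e1 : (a * a' + b * b') * a = a' := by linear_combination a' * hab + b * H
    have e2 : (a * a' + b * b') * b = b' := by linear_combination b' * hab - a * H
    rw [← hz, ← hz', mul_add, ← mul_assoc, ← mul_assoc, e1, e2]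
  have e1 : z.re = (c * b' - c' * b) / (a * b' - a' * b) := by
    rw [eq_div_iff hd]; linear_combination b' * hz - b * hz'
  have e2 : z.im = (a * c' - a' * c) / (a * b' - a' * b) := by
    rw [eq_div_iff hd]; linear_combination a * hz' - a' * hz
  have hdX := sub_mem (mul_mem ha hb') (mul_mem ha' hb)
  constructor
  · rw [e1]; exact div_mem (sub_mem (mul_mem hc hb') (mul_mem hc' hb)) hdX
  · rw [e2]; exact div_mem (sub_mem (mul_mem ha hc') (mul_mem ha' hc)) hdX

/-- The rotation that takes the line to a coordinate axis has entries in `X`, and so has its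
inverse, the transpose. -/
theorem mem_plane_of_unit {a b c : ℝ} (ha : a ∈ X) (hb : b ∈ X) (hc : c ∈ X)
    (hab : a ^ 2 + b ^ 2 = 1) {z : ℂ} (h1 : a * z.re + b * z.im - c ∈ X)
    (h2 : -b * z.re + a * z.im ∈ X) : z ∈ plane X := by
  have e1 : z.re = a * (a * z.re + b * z.im - c + c) - b * (-b * z.re + a * z.im) := by
    linear_combination -z.re * hab
  have e2 : z.im = b * (a * z.re + b * z.im - c + c) + a * (-b * z.re + a * z.im) := by
    linear_combination -z.im * hab
  constructor
  · rw [e1]; exact sub_mem (mul_mem ha (add_mem h1 hc)) (mul_mem hb h2)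
  · rw [e2]; exact add_mem (mul_mem hb (add_mem h1 hc)) (mul_mem ha h2)

theorem IsLineOver.inter_circle (hX : SqrtClosed X) {ℓ s : Set ℂ} (h : IsLineOver X ℓ)
    (h' : IsCircleOver X s) {z : ℂ} (hz : z ∈ ℓ) (hz' : z ∈ s) : z ∈ plane X := by
  obtain ⟨a, ha, b, hb, c, hc, hab, rfl⟩ := h
  obtain ⟨O, hO, r, hr, hr0, rfl⟩ := h'
  rw [mem_eqLine] at hz
  rw [mem_sphere_iff hr0.le] at hz'
  refine mem_plane_of_unit ha hb hc hab (by rw [hz, sub_self]; exact zero_mem X) ?_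
  have h2 : (2 : ℝ) ∈ X := ofNat_mem X 2
  obtain ⟨hO1, hO2⟩ := hO
  refine hX.quadratic (one_mem X) (b := 2 * (O.re * b - O.im * a))
    (c := c ^ 2 - 2 * c * (a * O.re + b * O.im) + O.re ^ 2 + O.im ^ 2 - r ^ 2)
    (mul_mem h2 (sub_mem (mul_mem hO1 hb) (mul_mem hO2 ha)))
    (sub_mem (add_mem (add_mem (sub_mem (pow_mem hc 2) (mul_mem (mul_mem h2 hc)
      (add_mem (mul_mem ha hO1) (mul_mem hb hO2)))) (pow_mem hO1 2)) (pow_mem hO2 2))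
      (pow_mem hr 2)) (by simp) ?_
  rw [← hz]
  linear_combination hz' + ((z.re ^ 2 + z.im ^ 2) - 2 * (z.re * O.re + z.im * O.im)) * hab

/-- The difference of the two equations is the radical line, which reduces the claim to a line and a
circle. Distinct circles with a common point are not concentric, so this is really a line. -/
theorem IsCircleOver.inter_circle (hX : SqrtClosed X) {s s' : Set ℂ} (h : IsCircleOver X s)
    (h' : IsCircleOver X s') (hne : s ≠ s') {z : ℂ} (hz : z ∈ s) (hz' : z ∈ s') :
    z ∈ plane X := by
  have hs := h
  obtain ⟨O, hO, r, hr, hr0, rfl⟩ := h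
  obtain ⟨O', hO', r', hr', hr0', rfl⟩ := h'
  rcases eq_or_ne O O' with rfl | hOO
  · rw [Metric.mem_sphere] at hz hz'
    exact absurd (by rw [← hz, ← hz']) hne
  · have h2 : (2 : ℝ) ∈ X := ofNat_mem X 2
    have hl := isLineOver_eqLine hX (a := O'.re - O.re) (b := O'.im - O.im)
      (c := (r ^ 2 - r' ^ 2 - O.re ^ 2 - O.im ^ 2 + O'.re ^ 2 + O'.im ^ 2) / 2)
      (sub_mem hO'.1 hO.1) (sub_mem hO'.2 hO.2)
      (div_mem (add_mem (add_mem (sub_mem (sub_mem (sub_mem (pow_mem hr 2) (pow_mem hr' 2))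
        (pow_mem hO.1 2)) (pow_mem hO.2 2)) (pow_mem hO'.1 2)) (pow_mem hO'.2 2)) h2)
      (sub_ne_zero_re_im hOO)
    refine hl.inter_circle hX hs ?_ hz
    rw [mem_sphere_iff hr0.le] at hz
    rw [mem_sphere_iff hr0'.le] at hz'
    rw [mem_eqLine]
    linear_combination hz / 2 - hz' / 2

/-- The common points of a conic, in coordinates such that the directrix is the first axis, and
of another conic. -/
theorem mem_of_conic_of_quadratic (hX : SqrtClosed X) (hX' : CubicClosed X)
    {w E k₁ k₂ k₃ k₄ k₅ k₆ : ℝ} (hw : w ∈ X) (hE : E ∈ X) (h₁ : k₁ ∈ X) (h₂ : k₂ ∈ X) (h₃ : k₃ ∈ X)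
    (h₄ : k₄ ∈ X) (h₅ : k₅ ∈ X) (h₆ : k₆ ∈ X) (hw0 : w ≠ 0)
    (hne : ¬ (k₁ = -k₃ * (E - 1) ∧ k₂ = 0 ∧ k₄ = -2 * k₃ * w ∧ k₅ = 0 ∧ k₆ = k₃ * w ^ 2))
    {u v : ℝ} (h : (u - w) ^ 2 + v ^ 2 = E * u ^ 2)
    (h' : k₁ * u ^ 2 + k₂ * u * v + k₃ * v ^ 2 + k₄ * u + k₅ * v + k₆ = 0) : u ∈ X ∧ v ∈ X := by
  have two : (2 : ℝ) ∈ X := ofNat_mem X 2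
  obtain ⟨A2, hA2⟩ : ∃ A, A = E - 1 := ⟨_, rfl⟩
  obtain ⟨A1, hA1⟩ : ∃ A, A = 2 * w := ⟨_, rfl⟩
  obtain ⟨B2, hB2⟩ : ∃ B, B = k₁ + k₃ * (E - 1) := ⟨_, rfl⟩
  obtain ⟨B1, hB1⟩ : ∃ B, B = k₄ + 2 * k₃ * w := ⟨_, rfl⟩
  obtain ⟨B0, hB0⟩ : ∃ B, B = k₆ - k₃ * w ^ 2 := ⟨_, rfl⟩
  have mA2 : A2 ∈ X := hA2 ▸ sub_mem hE (one_mem X)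
  have mA1 : A1 ∈ X := hA1 ▸ mul_mem two hw
  have mB2 : B2 ∈ X := hB2 ▸ add_mem h₁ (mul_mem h₃ (sub_mem hE (one_mem X)))
  have mB1 : B1 ∈ X := hB1 ▸ add_mem h₄ (mul_mem (mul_mem two h₃) hw)
  have mB0 : B0 ∈ X := hB0 ▸ sub_mem h₆ (mul_mem h₃ (pow_mem hw 2))
  -- The first conic expresses `v ^ 2` through `u`; substituted into the second, it leaves an
  -- equation linear in `v`. Eliminating `v` gives a quartic for `u`.
  have hv : v ^ 2 = A2 * u ^ 2 + A1 * u - w ^ 2 := by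
    rw [hA1, hA2]; linear_combination h
  have hl : (k₂ * u + k₅) * v + (B2 * u ^ 2 + B1 * u + B0) = 0 := by
    rw [hB2, hB1, hB0]; linear_combination h' - k₃ * h
  have hu : u ∈ X := by
    refine CubicClosed.quartic hX hX' (a := B2 ^ 2 - k₂ ^ 2 * A2)
      (b := 2 * B2 * B1 - (k₂ ^ 2 * A1 + 2 * k₂ * k₅ * A2))
      (c := B1 ^ 2 + 2 * B2 * B0 - (2 * k₂ * k₅ * A1 + k₅ ^ 2 * A2 - k₂ ^ 2 * w ^ 2))
      (d := 2 * B1 * B0 - (k₅ ^ 2 * A1 - 2 * k₂ * k₅ * w ^ 2))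
      (e := B0 ^ 2 + k₅ ^ 2 * w ^ 2) ?_ ?_ ?_ ?_ ?_ ?_ ?_
    · exact sub_mem (pow_mem mB2 2) (mul_mem (pow_mem h₂ 2) mA2)
    · exact sub_mem (mul_mem (mul_mem two mB2) mB1) (add_mem (mul_mem (pow_mem h₂ 2) mA1)
        (mul_mem (mul_mem (mul_mem two h₂) h₅) mA2))
    · exact sub_mem (add_mem (pow_mem mB1 2) (mul_mem (mul_mem two mB2) mB0))
        (sub_mem (add_mem (mul_mem (mul_mem (mul_mem two h₂) h₅) mA1) (mul_mem (pow_mem h₅ 2) mA2))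
          (mul_mem (pow_mem h₂ 2) (pow_mem hw 2)))
    · exact sub_mem (mul_mem (mul_mem two mB1) mB0) (sub_mem (mul_mem (pow_mem h₅ 2) mA1)
        (mul_mem (mul_mem (mul_mem two h₂) h₅) (pow_mem hw 2)))
    · exact add_mem (pow_mem mB0 2) (mul_mem (pow_mem h₅ 2) (pow_mem hw 2))
    -- If the quartic vanishes identically, its constant term, a sum of two squares, forces `B0 = k₅
    -- = 0` as `w ≠ 0`. Then the coefficient of `u ^ 2` forces `B1 = k₂ = 0` and the leading one `B2
    -- = 0`. The second equation is then a multiple of the first, contrary to `hne`.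
    · rintro ⟨e4, -, e2, -, e0⟩
      have z5 : k₅ * w = 0 := by nlinarith [sq_nonneg B0, sq_nonneg (k₅ * w)]
      have z0 : B0 = 0 := by nlinarith [sq_nonneg B0, sq_nonneg (k₅ * w)]
      have z5' : k₅ = 0 := (mul_eq_zero.1 z5).resolve_right hw0
      rw [z0, z5'] at e2
      have z2 : k₂ * w = 0 := by nlinarith [sq_nonneg B1, sq_nonneg (k₂ * w)]
      have z1 : B1 = 0 := by nlinarith [sq_nonneg B1, sq_nonneg (k₂ * w)]
      have z2' : k₂ = 0 := (mul_eq_zero.1 z2).resolve_right hw0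
      have z3 : B2 = 0 := by
        rw [z2'] at e4
        exact (pow_eq_zero_iff two_ne_zero).1 (by linear_combination e4)
      exact hne ⟨by linear_combination z3 - hB2, z2', by linear_combination z1 - hB1, z5',
        by linear_combination z0 - hB0⟩
    · linear_combination (k₂ * u + k₅) ^ 2 * hv +
        (B2 * u ^ 2 + B1 * u + B0 - (k₂ * u + k₅) * v) * hl
  refine ⟨hu, hX _ ?_⟩
  rw [hv]
  exact sub_mem (add_mem (mul_mem mA2 (pow_mem hu 2)) (mul_mem mA1 hu)) (pow_mem hw 2)

/-- The common points of a conic over `X` and of a curve which has a quadratic equation in the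
orthonormal coordinates given by the directrix and the focus. -/
theorem mem_plane_of_conic_of_quadratic (hX : SqrtClosed X) (hX' : CubicClosed X)
    {a b c e : ℝ} {F : ℂ} (ha : a ∈ X) (hb : b ∈ X) (hc : c ∈ X) (hF : F ∈ plane X) (he : e ∈ X)
    (hab : a ^ 2 + b ^ 2 = 1) (hFℓ : F ∉ eqLine a b c) (he0 : 0 < e) {z : ℂ}
    (hz : z ∈ conicSet (eqLine a b c) F e) {k₁ k₂ k₃ k₄ k₅ k₆ : ℝ}
    (h₁ : k₁ ∈ X) (h₂ : k₂ ∈ X) (h₃ : k₃ ∈ X) (h₄ : k₄ ∈ X) (h₅ : k₅ ∈ X) (h₆ : k₆ ∈ X)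
    (hne : ¬ (k₁ = -k₃ * (e ^ 2 - 1) ∧ k₂ = 0 ∧ k₄ = -2 * k₃ * (a * F.re + b * F.im - c) ∧ k₅ = 0 ∧
      k₆ = k₃ * (a * F.re + b * F.im - c) ^ 2)) {u v : ℝ} (hu : u = a * z.re + b * z.im - c)
    (hv : v = -b * (z.re - F.re) + a * (z.im - F.im))
    (h' : k₁ * u ^ 2 + k₂ * u * v + k₃ * v ^ 2 + k₄ * u + k₅ * v + k₆ = 0) : z ∈ plane X := by
  rw [mem_conicSet_eqLine hab he0] at hz
  obtain ⟨mu, mv⟩ := mem_of_conic_of_quadratic hX hX'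
    (sub_mem (add_mem (mul_mem ha hF.1) (mul_mem hb hF.2)) hc) (pow_mem he 2)
    h₁ h₂ h₃ h₄ h₅ h₆ (sub_ne_zero.2 hFℓ) hne
    (by
      rw [hu, hv]
      linear_combination hz + ((z.re - F.re) ^ 2 + (z.im - F.im) ^ 2) * hab) h'
  refine mem_plane_of_unit ha hb hc hab (hu ▸ mu) ?_
  have : -b * z.re + a * z.im = v + (-b * F.re + a * F.im) := by rw [hv]; ring
  rw [this]
  exact add_mem mv (add_mem (mul_mem (neg_mem hb) hF.1) (mul_mem ha hF.2))

theorem IsConicOver.inter_line (hX : SqrtClosed X) (hX' : CubicClosed X) {s ℓ : Set ℂ}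
    (h : IsConicOver X s) (h' : IsLineOver X ℓ) {z : ℂ} (hz : z ∈ s) (hz' : z ∈ ℓ) :
    z ∈ plane X := by
  obtain ⟨a, ha, b, hb, c, hc, F, hF, e, he, hab, hFℓ, he0, rfl⟩ := h
  obtain ⟨p, hp, q, hq, r, hr, hpq, rfl⟩ := h'
  rw [mem_eqLine] at hz'
  refine mem_plane_of_conic_of_quadratic hX hX' ha hb hc hF he hab hFℓ he0 hz (zero_mem X)
    (zero_mem X) (zero_mem X) (k₄ := p * a + q * b) (k₅ := -p * b + q * a)
    (k₆ := (p * a + q * b) * c + (-p * b + q * a) * (-b * F.re + a * F.im) - r)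
    (add_mem (mul_mem hp ha) (mul_mem hq hb)) (add_mem (mul_mem (neg_mem hp) hb) (mul_mem hq ha))
    (sub_mem (add_mem (mul_mem (add_mem (mul_mem hp ha) (mul_mem hq hb)) hc)
      (mul_mem (add_mem (mul_mem (neg_mem hp) hb) (mul_mem hq ha))
        (add_mem (mul_mem (neg_mem hb) hF.1) (mul_mem ha hF.2)))) hr) ?_ rfl rfl ?_
  -- In the rotated frame the normal of the line is still a unit vector, so the linear terms do not
  -- both vanish.
  · rintro ⟨-, -, e4, e5, -⟩
    have : (1 : ℝ) = 0 := by
      linear_combination -hpq - (p ^ 2 + q ^ 2) * hab + (p * a + q * b) * e4 +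
        (-p * b + q * a) * e5
    norm_num at this
  · linear_combination hz' + (p * z.re + q * z.im) * hab

theorem IsConicOver.inter_circle (hX : SqrtClosed X) (hX' : CubicClosed X) {s s' : Set ℂ}
    (h : IsConicOver X s) (h' : IsCircleOver X s') {z : ℂ} (hz : z ∈ s) (hz' : z ∈ s') :
    z ∈ plane X := by
  obtain ⟨a, ha, b, hb, c, hc, F, hF, e, he, hab, hFℓ, he0, rfl⟩ := h
  obtain ⟨O, hO, r, hr, hr0, rfl⟩ := h'
  rw [mem_sphere_iff hr0.le] at hz'
  have two : (2 : ℝ) ∈ X := ofNat_mem X 2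
  obtain ⟨U, hU⟩ : ∃ U, U = a * O.re + b * O.im - c := ⟨_, rfl⟩
  obtain ⟨V, hV⟩ : ∃ V, V = -b * (O.re - F.re) + a * (O.im - F.im) := ⟨_, rfl⟩
  have mU : U ∈ X := hU ▸ sub_mem (add_mem (mul_mem ha hO.1) (mul_mem hb hO.2)) hc
  have mV : V ∈ X := hV ▸ add_mem (mul_mem (neg_mem hb) (sub_mem hO.1 hF.1))
    (mul_mem ha (sub_mem hO.2 hF.2))
  refine mem_plane_of_conic_of_quadratic hX hX' ha hb hc hF he hab hFℓ he0 hz (one_mem X)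
    (zero_mem X) (one_mem X) (k₄ := -2 * U) (k₅ := -2 * V) (k₆ := U ^ 2 + V ^ 2 - r ^ 2)
    (mul_mem (neg_mem two) mU) (mul_mem (neg_mem two) mV)
    (sub_mem (add_mem (pow_mem mU 2) (pow_mem mV 2)) (pow_mem hr 2)) ?_ rfl rfl ?_
  -- Proportional equations would give the conic equal coefficients of `u ^ 2` and `v ^ 2`, hence
  -- eccentricity zero.
  · rintro ⟨e1, -⟩
    have : e ^ 2 = 0 := by linear_combination e1
    exact he0.ne' ((pow_eq_zero_iff two_ne_zero).1 this)
  · rw [hU, hV]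
    linear_combination hz' + ((z.re - O.re) ^ 2 + (z.im - O.im) ^ 2) * hab

theorem IsConicOver.inter_conic (hX : SqrtClosed X) (hX' : CubicClosed X) {s s' : Set ℂ}
    (h : IsConicOver X s) (h' : IsConicOver X s') (hne : s ≠ s') {z : ℂ} (hz : z ∈ s)
    (hz' : z ∈ s') : z ∈ plane X := by
  obtain ⟨a, ha, b, hb, c, hc, F, hF, e, he, hab, hFℓ, he0, rfl⟩ := h
  obtain ⟨p, hp, q, hq, r, hr, G, hG, e', he', hpq, -, he0', rfl⟩ := h'
  have two : (2 : ℝ) ∈ X := ofNat_mem X 2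
  obtain ⟨U, hU⟩ : ∃ U, U = a * G.re + b * G.im - c := ⟨_, rfl⟩
  obtain ⟨V, hV⟩ : ∃ V, V = -b * (G.re - F.re) + a * (G.im - F.im) := ⟨_, rfl⟩
  obtain ⟨α, hα⟩ : ∃ α, α = e' * (p * a + q * b) := ⟨_, rfl⟩
  obtain ⟨β, hβ⟩ : ∃ β, β = e' * (-p * b + q * a) := ⟨_, rfl⟩
  obtain ⟨γ, hγ⟩ : ∃ γ, γ = e' * ((p * a + q * b) * c +
    (-p * b + q * a) * (-b * F.re + a * F.im) - r) := ⟨_, rfl⟩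
  have mU : U ∈ X := hU ▸ sub_mem (add_mem (mul_mem ha hG.1) (mul_mem hb hG.2)) hc
  have mV : V ∈ X := hV ▸ add_mem (mul_mem (neg_mem hb) (sub_mem hG.1 hF.1))
    (mul_mem ha (sub_mem hG.2 hF.2))
  have mα : α ∈ X := hα ▸ mul_mem he' (add_mem (mul_mem hp ha) (mul_mem hq hb))
  have mβ : β ∈ X := hβ ▸ mul_mem he' (add_mem (mul_mem (neg_mem hp) hb) (mul_mem hq ha))
  have mγ : γ ∈ X := hγ ▸ mul_mem he'
    (sub_mem (add_mem (mul_mem (add_mem (mul_mem hp ha) (mul_mem hq hb)) hc)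
      (mul_mem (add_mem (mul_mem (neg_mem hp) hb) (mul_mem hq ha))
        (add_mem (mul_mem (neg_mem hb) hF.1) (mul_mem ha hF.2)))) hr)
  -- The second conic in the frame of the first is `(u - U) ^ 2 + (v - V) ^ 2 = (α u + β v + γ) ^
  -- 2`.
  have eqn : ∀ z : ℂ, z ∈ conicSet (eqLine p q r) G e' ↔
      (1 - α ^ 2) * (a * z.re + b * z.im - c) ^ 2 + (-2 * α * β) * (a * z.re + b * z.im - c) *
        (-b * (z.re - F.re) + a * (z.im - F.im)) +
      (1 - β ^ 2) * (-b * (z.re - F.re) + a * (z.im - F.im)) ^ 2 +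
      (-2 * (U + α * γ)) * (a * z.re + b * z.im - c) +
      (-2 * (V + β * γ)) * (-b * (z.re - F.re) + a * (z.im - F.im)) +
      (U ^ 2 + V ^ 2 - γ ^ 2) = 0 := by
    intro z
    rw [mem_conicSet_eqLine hpq he0']
    have e1 : (z.re - G.re) ^ 2 + (z.im - G.im) ^ 2 = (a * z.re + b * z.im - c - U) ^ 2 +
        (-b * (z.re - F.re) + a * (z.im - F.im) - V) ^ 2 := by
      rw [hU, hV]
      linear_combination -((z.re - G.re) ^ 2 + (z.im - G.im) ^ 2) * hab
    have e2 : e' * (p * z.re + q * z.im - r) = α * (a * z.re + b * z.im - c) +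
        β * (-b * (z.re - F.re) + a * (z.im - F.im)) + γ := by
      rw [hα, hβ, hγ]
      linear_combination -e' * (p * z.re + q * z.im) * hab
    rw [← mul_pow, e1, e2]
    constructor <;> intro h <;> linear_combination h
  refine mem_plane_of_conic_of_quadratic hX hX' ha hb hc hF he hab hFℓ he0 hz
    (sub_mem (one_mem X) (pow_mem mα 2)) (mul_mem (mul_mem (neg_mem two) mα) mβ)
    (sub_mem (one_mem X) (pow_mem mβ 2)) (mul_mem (neg_mem two) (add_mem mU (mul_mem mα mγ)))
    (mul_mem (neg_mem two) (add_mem mV (mul_mem mβ mγ)))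
    (sub_mem (add_mem (pow_mem mU 2) (pow_mem mV 2)) (pow_mem mγ 2)) ?_ rfl rfl ((eqn z).1 hz')
  -- If the equations are proportional, the factor is `1 - β ^ 2`. It is nonzero, since otherwise `α
  -- ^ 2 = β ^ 2 = 1` and `α β = 0`; so the two conics would coincide.
  rintro ⟨e1, e2, e4, e5, e6⟩
  have hk : 1 - β ^ 2 ≠ 0 := by
    intro H
    rw [H] at e1
    have : (1 : ℝ) = 0 := by linear_combination e1 + α ^ 2 * H - α * β / 2 * e2
    norm_num at this
  apply hne
  ext w
  rw [eqn, mem_conicSet_eqLine hab he0, e1, e2, e4, e5, e6]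
  have e7 : (w.re - F.re) ^ 2 + (w.im - F.im) ^ 2 =
      (a * w.re + b * w.im - c - (a * F.re + b * F.im - c)) ^ 2 +
        (-b * (w.re - F.re) + a * (w.im - F.im)) ^ 2 := by
    linear_combination -((w.re - F.re) ^ 2 + (w.im - F.im) ^ 2) * hab
  rw [e7]
  constructor
  · intro h
    linear_combination (1 - β ^ 2) * h
  · intro h
    apply mul_left_cancel₀ hk
    linear_combination h

/-! ### Upper bounds for the constructible points -/

variable {X : Subfield ℝ}

theorem rulerCompass_points_subset (hX : SqrtClosed X) {M : ToolMap}
    (hc : M.tool.construction ⊆ rulerCompass.construction)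
    (hi : M.tool.intersection ⊆ rulerCompass.intersection)
    (h₀ : M.initial.curves = ∅) (h₁ : M.initial.points ⊆ plane X) :
    M.constructible.points ⊆ plane X := by
  refine M.forall_constructible_points (p := fun c => IsLineOver X c ∨ IsCircleOver X c)
    (by simp [h₀]) h₁ ?_ ?_
  · rintro U hUc hUp a ha c ⟨I, hI, hg⟩
    have ha' := hc ha
    cases hg <;> simp [rulerCompass] at ha' <;> simp at hI
    case line A B h => exact Or.inl (isLineOver_line hX (hUp A hI.1) (hUp B hI.2) h)
    case circle A B h =>
      exact Or.inr (isCircleOver_sphere hX (hUp A hI.1) (hUp A hI.1) (hUp B hI.2) h)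
    case radiusCircle A B C h =>
      exact Or.inr (isCircleOver_sphere hX (hUp A hI.1) (hUp B hI.2.1) (hUp C hI.2.2) h)
  · rintro U hUc hUp a ha P ⟨I, hI, hg⟩
    have key : ∀ c ∈ U.curves, ∀ c' ∈ U.curves, c ≠ c' → P ∈ c ∩ c' → P ∈ plane X := by
      rintro c hc c' hc' hne ⟨hP, hP'⟩
      rcases hUc c hc with h | h <;> rcases hUc c' hc' with h' | h'
      · exact h.inter_line h' hne hP hP'
      · exact h.inter_circle hX h' hP hP'
      · exact h'.inter_circle hX h hP' hP
      · exact h.inter_circle hX h' hne hP hP'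
    have ha' := hi ha
    cases hg <;> simp [rulerCompass] at ha' <;> simp only [List.forall_mem_cons,
      Figure.curve_mem_elements] at hI
    case lineIntersect ℓ ℓ' hℓ hℓ' h hP => exact key _ hI.1 _ hI.2.1 h hP
    case circleIntersect ℓ ℓ' hℓ hℓ' h hP => exact key _ hI.1 _ hI.2.1 h hP
    case lineCircleIntersect ℓ c hℓ hc hP =>
      exact key _ hI.1 _ hI.2.1 (fun H => not_isCircle_of_isLine hℓ (H ▸ hc)) hP

theorem conics_points_subset (hX : SqrtClosed X) (hX' : CubicClosed X) {M : ToolMap}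
    (hM : M.tool = conics) (h₀ : M.initial.curves = ∅) (h₁ : M.initial.points ⊆ plane X) :
    M.constructible.points ⊆ plane X := by
  refine M.forall_constructible_points
    (p := fun c => IsLineOver X c ∨ IsCircleOver X c ∨ IsConicOver X c) (by simp [h₀]) h₁ ?_ ?_
  · rintro U hUc hUp a ha c ⟨I, hI, hg⟩
    rw [hM] at ha
    cases hg <;> simp [conics] at ha <;> simp at hI
    case line A B h => exact Or.inl (isLineOver_line hX (hUp A hI.1) (hUp B hI.2) h)
    case circle A B h =>
      exact Or.inr (Or.inl (isCircleOver_sphere hX (hUp A hI.1) (hUp A hI.1) (hUp B hI.2) h))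
    case radiusCircle A B C h =>
      exact Or.inr (Or.inl (isCircleOver_sphere hX (hUp A hI.1) (hUp B hI.2.1) (hUp C hI.2.2) h))
    case conic ℓ F A B hℓ hF h =>
      rcases hUc ℓ hI.1 with ⟨a, ha, b, hb, c, hc, hab, rfl⟩ | h' | h'
      · exact Or.inr (Or.inr ⟨a, ha, b, hb, c, hc, F, hUp F hI.2.1, _,
          dist_mem hX (hUp A hI.2.2.1) (hUp B hI.2.2.2), hab, hF, dist_pos.2 h, rfl⟩)
      · obtain ⟨O, -, r, -, hr, hs⟩ := h'
        exact absurd ⟨O, r, hr, hs⟩ (not_isCircle_of_isLine hℓ)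
      · obtain ⟨a, -, b, -, c, -, F, -, e, -, hab, hF, he, hs⟩ := h'
        exact absurd ⟨_, F, e, isLine_eqLine (ne_zero_of_unit hab), hF, he, hs⟩
          (not_isConic_of_isLine hℓ)
  · rintro U hUc hUp a ha P ⟨I, hI, hg⟩
    have key : ∀ c ∈ U.curves, ∀ c' ∈ U.curves, c ≠ c' → P ∈ c ∩ c' → P ∈ plane X := by
      rintro c hc c' hc' hne ⟨hP, hP'⟩
      rcases hUc c hc with h | h | h <;> rcases hUc c' hc' with h' | h' | h'
      · exact h.inter_line h' hne hP hP'
      · exact h.inter_circle hX h' hP hP'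
      · exact h'.inter_line hX hX' h hP' hP
      · exact h'.inter_circle hX h hP' hP
      · exact h.inter_circle hX h' hne hP hP'
      · exact h'.inter_circle hX hX' h hP' hP
      · exact h.inter_line hX hX' h' hP hP'
      · exact h.inter_circle hX hX' h' hP hP'
      · exact h.inter_conic hX hX' h' hne hP hP'
    cases hg <;> simp only [List.forall_mem_cons, Figure.curve_mem_elements] at hI
    case lineIntersect ℓ ℓ' hℓ hℓ' h hP => exact key _ hI.1 _ hI.2.1 h hP
    case circleIntersect ℓ ℓ' hℓ hℓ' h hP => exact key _ hI.1 _ hI.2.1 h hP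
    case conicIntersect ℓ ℓ' hℓ hℓ' h hP => exact key _ hI.1 _ hI.2.1 h hP
    case lineCircleIntersect ℓ c hℓ hc hP =>
      exact key _ hI.1 _ hI.2.1 (fun H => not_isCircle_of_isLine hℓ (H ▸ hc)) hP
    case lineConicIntersect ℓ c hℓ hc hP =>
      exact key _ hI.1 _ hI.2.1 (fun H => not_isConic_of_isLine hℓ (H ▸ hc)) hP
    case circleConicIntersect ℓ c hℓ hc hP =>
      exact key _ hI.1 _ hI.2.1 (fun H => not_isConic_of_isCircle hℓ (H ▸ hc)) hP

/-! ### Folds stay defined over `X` -/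

theorem isLineOver_perpBisector (hX : SqrtClosed X) {A B : ℂ} (hA : A ∈ plane X) (hB : B ∈ plane X)
    (h : A ≠ B) : IsLineOver X (AffineSubspace.perpBisector A B : Set ℂ) := by
  have two : (2 : ℝ) ∈ X := ofNat_mem X 2
  rw [perpBisector_eq]
  refine isLineOver_eqLine hX (mul_mem two (sub_mem hB.1 hA.1)) (mul_mem two (sub_mem hB.2 hA.2))
    (sub_mem (sub_mem (add_mem (pow_mem hB.1 2) (pow_mem hB.2 2)) (pow_mem hA.1 2))
      (pow_mem hA.2 2)) ?_
  simpa using sub_ne_zero_re_im h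

/-- The vector `u` is `±(-b, a)`. Its coordinates have squares in `X`, which suffices and avoids
deciding the sign. -/
theorem direction_mem (hX : SqrtClosed X) {a b c : ℝ} (ha : a ∈ X) (hb : b ∈ X)
    (hab : a ^ 2 + b ^ 2 = 1) {O u : ℂ} (hu : ‖u‖ = 1) (hO : O ∈ eqLine a b c)
    (hOu : O + u ∈ eqLine a b c) : u ∈ plane X := by
  rw [mem_eqLine] at hO hOu
  have h1 : a * u.re + b * u.im = 0 := by
    simp only [Complex.add_re, Complex.add_im] at hOu
    linear_combination hOu - hO
  have h2 : u.re ^ 2 + u.im ^ 2 = 1 := by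
    have := Complex.sq_norm u
    rw [hu, Complex.normSq_apply] at this
    linear_combination -this
  constructor <;> apply hX
  · have : u.re ^ 2 = b ^ 2 := by
      linear_combination (a * u.re - b * u.im) * h1 - u.re ^ 2 * hab + b ^ 2 * h2
    rw [this]; exact pow_mem hb 2
  · have : u.im ^ 2 = a ^ 2 := by
      linear_combination (b * u.im - a * u.re) * h1 - u.im ^ 2 * hab + a ^ 2 * h2
    rw [this]; exact pow_mem ha 2

theorem IsLineOver.bisector (hX : SqrtClosed X) {ℓ ℓ' m : Set ℂ} (hℓ : IsLineOver X ℓ)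
    (hℓ' : IsLineOver X ℓ') (h : IsBisector m ℓ ℓ') : IsLineOver X m := by
  obtain ⟨O, u, v, hu, hv, hne, e, e', rfl⟩ := h
  have hOℓ : O ∈ ℓ := e ▸ left_mem_affineSpan_pair ℝ _ _
  have hOℓ' : O ∈ ℓ' := e' ▸ left_mem_affineSpan_pair ℝ _ _
  have huℓ : O + u ∈ ℓ := e ▸ right_mem_affineSpan_pair ℝ _ _
  have hvℓ : O + v ∈ ℓ' := e' ▸ right_mem_affineSpan_pair ℝ _ _
  have hO := hℓ.inter_line hℓ' hne hOℓ hOℓ'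
  obtain ⟨a, ha, b, hb, c, hc, hab, rfl⟩ := hℓ
  obtain ⟨a', ha', b', hb', c', hc', hab', rfl⟩ := hℓ'
  have mu := direction_mem hX ha hb hab hu hOℓ huℓ
  have mv := direction_mem hX ha' hb' hab' hv hOℓ' hvℓ
  refine isLineOver_line hX hO ⟨add_mem hO.1 (add_mem mu.1 mv.1), add_mem hO.2 (add_mem mu.2 mv.2)⟩
    fun H => hne ?_
  -- Opposite directions through the common point would make the two lines equal.
  have H' : u = -v := by linear_combination -H
  have hu0 : u ≠ 0 := by
    rintro rfl
    simp at hu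
  rw [← line_eq_eqLine (A := O) (B := O + u) (by simpa using hu0)
    (ne_zero_of_unit hab') hOℓ', ← e]
  rw [mem_eqLine] at hOℓ' hvℓ ⊢
  rw [H']
  simp only [Complex.add_re, Complex.add_im, Complex.neg_re, Complex.neg_im] at hvℓ ⊢
  linear_combination 2 * hOℓ' - hvℓ

theorem IsLineOver.perpendicular {ℓ m : Set ℂ} (hℓ : IsLineOver X ℓ)
    {P : ℂ} (hP : P ∈ plane X) (h : Perp m ℓ) (hPm : P ∈ m) : IsLineOver X m := by
  obtain ⟨a, ha, b, hb, c, hc, hab, rfl⟩ := hℓ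
  obtain ⟨a', b', c', hab', rfl⟩ := h.1.exists_unit_eqLine
  rw [perp_eqLine_iff (ne_zero_of_unit hab') (ne_zero_of_unit hab)] at h
  rw [mem_eqLine] at hPm
  have hk : (a * b' - b * a') ^ 2 = 1 := by
    linear_combination (a ^ 2 + b ^ 2) * hab' + hab - (a * a' + b * b') * h
  have hk0 : a * b' - b * a' ≠ 0 := by
    intro h
    rw [h] at hk
    norm_num at hk
  have e1 : (a * b' - b * a') * -b = a' := by linear_combination a' * hab - a * h
  have e2 : (a * b' - b * a') * a = b' := by linear_combination b' * hab - b * h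
  refine ⟨-b, neg_mem hb, a, ha, -b * P.re + a * P.im,
    add_mem (mul_mem (neg_mem hb) hP.1) (mul_mem ha hP.2), by linear_combination hab, ?_⟩
  rw [← eqLine_mul (a := -b) hk0, e1, e2]
  congr 1
  linear_combination -(P.re * e1 + P.im * e2 + hPm)

/-- The tangent is the bisector of `F` and a point `F'` of the directrix. Since `A` lies on it, `F'`
is on the circle about `A` through `F`, and a quadratic equation determines it. -/
theorem IsLineOver.tangent (hX : SqrtClosed X) {ℓ m : Set ℂ} (hℓ : IsLineOver X ℓ) {F A : ℂ}
    (hF : F ∈ plane X) (hA : A ∈ plane X) (h : IsTangent m ℓ F) (hAm : A ∈ m) :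
    IsLineOver X m := by
  obtain ⟨a, ha, b, hb, c, hc, hab, rfl⟩ := hℓ
  obtain ⟨F', hF', rfl⟩ := h.exists_perpBisector hab
  have hne : F ≠ F' := fun H => h.2.2.1 (H ▸ hF')
  refine isLineOver_perpBisector hX hF ?_ hne
  have two : (2 : ℝ) ∈ X := ofNat_mem X 2
  rw [mem_eqLine] at hF'
  refine mem_plane_of_unit ha hb hc hab (by rw [hF', sub_self]; exact zero_mem X) ?_
  have hd : (F'.re - A.re) ^ 2 + (F'.im - A.im) ^ 2 = (F.re - A.re) ^ 2 + (F.im - A.im) ^ 2 := by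
    rw [SetLike.mem_coe, AffineSubspace.mem_perpBisector_iff_dist_eq, dist_eq_dist_iff] at hAm
    linear_combination -hAm
  refine hX.quadratic (one_mem X) (b := -(2 * (-b * A.re + a * A.im)))
    (c := c ^ 2 - 2 * c * (a * A.re + b * A.im) + A.re ^ 2 + A.im ^ 2 -
      ((F.re - A.re) ^ 2 + (F.im - A.im) ^ 2)) ?_ ?_ (by simp) ?_
  · exact neg_mem (mul_mem two (add_mem (mul_mem (neg_mem hb) hA.1) (mul_mem ha hA.2)))
  · exact sub_mem (add_mem (add_mem (sub_mem (pow_mem hc 2) (mul_mem (mul_mem two hc)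
      (add_mem (mul_mem ha hA.1) (mul_mem hb hA.2)))) (pow_mem hA.1 2)) (pow_mem hA.2 2))
      (add_mem (pow_mem (sub_mem hF.1 hA.1) 2) (pow_mem (sub_mem hF.2 hA.2) 2))
  · rw [← hF']
    linear_combination hd + ((F'.re ^ 2 + F'.im ^ 2) - 2 * (F'.re * A.re + F'.im * A.im)) * hab

/-- Here `F F'` is parallel to `ℓ'`, so `F'` is where the directrix meets the parallel to `ℓ'`
through `F`. -/
theorem IsLineOver.perpendicularTangent (hX : SqrtClosed X) {ℓ ℓ' m : Set ℂ} (hℓ : IsLineOver X ℓ)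
    (hℓ' : IsLineOver X ℓ') {F : ℂ} (hF : F ∈ plane X) (h : IsTangent m ℓ F) (h' : Perp m ℓ') :
    IsLineOver X m := by
  obtain ⟨a, ha, b, hb, c, hc, hab, rfl⟩ := id hℓ
  obtain ⟨a', ha', b', hb', c', hc', hab', rfl⟩ := hℓ'
  obtain ⟨F', hF', rfl⟩ := h.exists_perpBisector hab
  have hne : F ≠ F' := fun H => h.2.2.1 (H ▸ hF')
  refine isLineOver_perpBisector hX hF ?_ hne
  rw [perpBisector_eq, perp_eqLine_iff (by simpa using sub_ne_zero_re_im hne)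
    (ne_zero_of_unit hab')] at h'
  have hl : IsLineOver X (eqLine a' b' (a' * F.re + b' * F.im)) :=
    ⟨a', ha', b', hb', _, add_mem (mul_mem ha' hF.1) (mul_mem hb' hF.2), hab', rfl⟩
  refine hℓ.inter_line hl (fun H => h.2.2.1 ?_) hF' ?_
  · rw [H, mem_eqLine]
  · rw [mem_eqLine]
    linear_combination h' / 2

/-- The reflections `F'`, `G'` of the foci in `m` lie on the directrices, and `G' - G = k (F' - F)`.
With `s` the position of `F'` along its directrix, the incidence of `G'` and the equality of the two
bisectors are two equations linear in `k`; eliminating `k` leaves a cubic in `s`. -/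
theorem IsLineOver.commonTangent (hX : SqrtClosed X) (hX' : CubicClosed X) {ℓ ℓ' m : Set ℂ}
    (hℓ : IsLineOver X ℓ) (hℓ' : IsLineOver X ℓ') {F G : ℂ} (hF : F ∈ plane X) (hG : G ∈ plane X)
    (h : IsTangent m ℓ F) (h' : IsTangent m ℓ' G) (hne : parabola ℓ F ≠ parabola ℓ' G) :
    IsLineOver X m := by
  obtain ⟨a, ha, b, hb, c, hc, hab, rfl⟩ := hℓ
  obtain ⟨p, hp, q, hq, r, hr, hpq, rfl⟩ := hℓ'
  obtain ⟨F', hF', rfl⟩ := h.exists_perpBisector hab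
  obtain ⟨G', hG', hm⟩ := h'.exists_perpBisector hpq
  have hFF : F ≠ F' := fun H => h.2.2.1 (H ▸ hF')
  have hGG : G ≠ G' := fun H => h'.2.2.1 (H ▸ hG')
  have hFℓ := h.2.2.1
  have hGℓ := h'.2.2.1
  refine isLineOver_perpBisector hX hF ?_ hFF
  rw [perpBisector_eq, perpBisector_eq] at hm
  obtain ⟨k, hk, k1, k2, k3⟩ := eqLine_eq_eqLine (by simpa using sub_ne_zero_re_im hFF)
    (by simpa using sub_ne_zero_re_im hGG) hm
  have two : (2 : ℝ) ∈ X := ofNat_mem X 2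
  rw [mem_eqLine] at hF' hG' hFℓ hGℓ
  -- coordinates with respect to the first directrix, relative to the first focus
  obtain ⟨d, hd⟩ : ∃ d, d = a * F.re + b * F.im - c := ⟨_, rfl⟩
  obtain ⟨s, hs⟩ : ∃ s, s = -b * (F'.re - F.re) + a * (F'.im - F.im) := ⟨_, rfl⟩
  obtain ⟨δ, hδ⟩ : ∃ δ, δ = p * G.re + q * G.im - r := ⟨_, rfl⟩
  obtain ⟨α, hα⟩ : ∃ α, α = p * a + q * b := ⟨_, rfl⟩
  obtain ⟨β, hβ⟩ : ∃ β, β = -p * b + q * a := ⟨_, rfl⟩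
  obtain ⟨κ, hκ⟩ : ∃ κ, κ = a * (G.re - F.re) + b * (G.im - F.im) := ⟨_, rfl⟩
  obtain ⟨μ, hμ⟩ : ∃ μ, μ = -b * (G.re - F.re) + a * (G.im - F.im) := ⟨_, rfl⟩
  have md : d ∈ X := hd ▸ sub_mem (add_mem (mul_mem ha hF.1) (mul_mem hb hF.2)) hc
  have mδ : δ ∈ X := hδ ▸ sub_mem (add_mem (mul_mem hp hG.1) (mul_mem hq hG.2)) hr
  have mα : α ∈ X := hα ▸ add_mem (mul_mem hp ha) (mul_mem hq hb)
  have mβ : β ∈ X := hβ ▸ add_mem (mul_mem (neg_mem hp) hb) (mul_mem hq ha)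
  have mκ : κ ∈ X := hκ ▸ add_mem (mul_mem ha (sub_mem hG.1 hF.1)) (mul_mem hb (sub_mem hG.2 hF.2))
  have mμ : μ ∈ X := hμ ▸ add_mem (mul_mem (neg_mem hb) (sub_mem hG.1 hF.1))
    (mul_mem ha (sub_mem hG.2 hF.2))
  have hd0 : d ≠ 0 := hd ▸ sub_ne_zero.2 hFℓ
  have v1 : F'.re = F.re - d * a - s * b := by
    rw [hd, hs]; linear_combination -(F'.re - F.re) * hab + a * hF'
  have v2 : F'.im = F.im - d * b + s * a := by
    rw [hd, hs]; linear_combination -(F'.im - F.im) * hab + b * hF'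
  have g1 : G.re = F.re + κ * a - μ * b := by
    rw [hκ, hμ]; linear_combination -(G.re - F.re) * hab
  have g2 : G.im = F.im + κ * b + μ * a := by
    rw [hκ, hμ]; linear_combination -(G.im - F.im) * hab
  have w1 : G'.re = G.re + k * (F'.re - F.re) := by linear_combination k1 / 2
  have w2 : G'.im = G.im + k * (F'.im - F.im) := by linear_combination k2 / 2
  -- the second reflected focus lies on the second directrix
  have q1 : δ + k * (-d * α + s * β) = 0 := by
    rw [w1, w2, v1, v2] at hG'
    rw [hδ, hα, hβ]
    linear_combination hG'
  have q2 : k * (d ^ 2 + s ^ 2) = 2 * (d * κ - s * μ) + (d ^ 2 + s ^ 2) := by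
    apply mul_left_cancel₀ hk
    rw [w1, w2, v1, v2, g1, g2] at k3
    linear_combination k3 - (k ^ 2 * (d ^ 2 + s ^ 2) - k * (d ^ 2 + s ^ 2) -
      2 * k * (d * κ - s * μ)) * hab
  have cubic : β * s ^ 3 + (δ - d * α - 2 * μ * β) * s ^ 2 +
      (d ^ 2 * β + 2 * d * κ * β + 2 * d * μ * α) * s + (d ^ 2 * (δ - d * α) - 2 * d ^ 2 * κ * α) =
      0 := by
    linear_combination (d ^ 2 + s ^ 2) * q1 - (-d * α + s * β) * q2
  have ms : s ∈ X := by
    refine CubicClosed.cubic hX hX' mβ (sub_mem (sub_mem mδ (mul_mem md mα))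
      (mul_mem (mul_mem two mμ) mβ)) (add_mem (add_mem (mul_mem (pow_mem md 2) mβ)
        (mul_mem (mul_mem (mul_mem two md) mκ) mβ)) (mul_mem (mul_mem (mul_mem two md) mμ) mα))
      (sub_mem (mul_mem (pow_mem md 2) (sub_mem mδ (mul_mem md mα)))
        (mul_mem (mul_mem (mul_mem two (pow_mem md 2)) mκ) mα)) ?_ cubic
    -- If the cubic vanishes identically, the coefficients give in turn parallel directrices, equal
    -- distances from focus to directrix up to the sign `α`, and equal foci. Then the parabolas
    -- coincide.
    rintro ⟨c3, c2, c1, c0⟩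
    have hα2 : α ^ 2 = 1 := by
      have : α ^ 2 + β ^ 2 = 1 := by rw [hα, hβ]; linear_combination hpq + (p ^ 2 + q ^ 2) * hab
      rw [c3] at this
      linear_combination this
    have hα0 : α ≠ 0 := by
      rintro h
      rw [h] at hα2
      norm_num at hα2
    rw [c3] at c2 c1
    have hδ' : δ = d * α := by linear_combination c2
    have hμ0 : μ = 0 := by
      apply mul_left_cancel₀ (mul_ne_zero hd0 hα0)
      linear_combination c1 / 2
    have hκ0 : κ = 0 := by
      rw [hδ'] at c0
      apply mul_left_cancel₀ (mul_ne_zero (pow_ne_zero 2 hd0) hα0)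
      linear_combination -c0 / 2
    have hGF : G = F := by
      apply Complex.ext
      · rw [g1, hμ0, hκ0]; ring
      · rw [g2, hμ0, hκ0]; ring
    have hp' : α * a = p := by
      rw [hα]; rw [hβ] at c3; linear_combination p * hab + b * c3
    have hq' : α * b = q := by
      rw [hα]; rw [hβ] at c3; linear_combination q * hab - a * c3
    have hr' : α * c = r := by
      rw [hGF] at hδ
      linear_combination hδ' - hδ + F.re * hp' + F.im * hq' + α * hd
    apply hne
    rw [hGF, ← eqLine_mul hα0, hp', hq', hr']
  refine mem_plane_of_unit ha hb hc hab (by rw [hF', sub_self]; exact zero_mem X) ?_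
  have : -b * F'.re + a * F'.im = s + (-b * F.re + a * F.im) := by rw [hs]; ring
  rw [this]
  exact add_mem ms (add_mem (mul_mem (neg_mem hb) hF.1) (mul_mem ha hF.2))

theorem origami_points_subset (hX : SqrtClosed X) (hX' : CubicClosed X) {M : ToolMap}
    (hM : M.tool = origami) (h₀ : M.initial.curves = ∅) (h₁ : M.initial.points ⊆ plane X) :
    M.constructible.points ⊆ plane X := by
  refine M.forall_constructible_points (p := IsLineOver X) (by simp [h₀]) h₁ ?_ ?_
  · rintro U hUc hUp a ha c ⟨I, hI, hg⟩
    rw [hM] at ha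
    cases hg <;> simp [origami] at ha <;> simp at hI
    case line A B h => exact isLineOver_line hX (hUp A hI.1) (hUp B hI.2) h
    case bisector ℓ ℓ' h => exact (hUc ℓ hI.1).bisector hX (hUc ℓ' hI.2) h
    case perpendicularBisector A B h =>
      exact isLineOver_perpBisector hX (hUp A hI.1) (hUp B hI.2) h
    case perpendicular ℓ P h hP => exact (hUc ℓ hI.1).perpendicular (hUp P hI.2) h hP
    case tangent ℓ F A h hA =>
      exact (hUc ℓ hI.1).tangent hX (hUp F hI.2.1) (hUp A hI.2.2) h hA
    case commonTangent ℓ ℓ' F F' hne h h' =>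
      exact (hUc ℓ hI.1).commonTangent hX hX' (hUc ℓ' hI.2.2.1) (hUp F hI.2.1) (hUp F' hI.2.2.2)
        h h' hne
    case perpendicularTangent ℓ₁ ℓ₂ F h h₂ =>
      exact (hUc ℓ₁ hI.1).perpendicularTangent hX (hUc ℓ₂ hI.2.2) (hUp F hI.2.1) h h₂
  · rintro U hUc hUp a ha P ⟨I, hI, hg⟩
    rw [hM] at ha
    cases hg <;> simp [origami] at ha <;> simp only [List.forall_mem_cons,
      Figure.curve_mem_elements] at hI
    case lineIntersect ℓ ℓ' hℓ hℓ' h hP =>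
      exact (hUc ℓ hI.1).inter_line (hUc ℓ' hI.2.1) h hP.1 hP.2

/-! ### Lower bounds for the constructible points -/

/-- Horizontal and vertical pairs of antipodal points determine the center. This shows that circles
with different centers are distinct, as the intersection axiom requires. -/
theorem sphere_center_injective {A C : ℂ} {r s : ℝ} (hr : 0 < r)
    (h : Metric.sphere A r = Metric.sphere C s) : A = C := by
  have hs : 0 ≤ s := by
    by_contra! hs
    rw [Metric.sphere_eq_empty_of_neg hs] at h
    exact (NormedSpace.sphere_nonempty.2 hr.le).ne_empty h
  have key : ∀ x y : ℝ, x ^ 2 + y ^ 2 = r ^ 2 →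
      (A.re + x - C.re) ^ 2 + (A.im + y - C.im) ^ 2 = s ^ 2 := by
    intro x y hxy
    have : (⟨A.re + x, A.im + y⟩ : ℂ) ∈ Metric.sphere A r := by
      rw [mem_sphere_iff hr.le]
      linear_combination hxy
    rwa [h, mem_sphere_iff hs] at this
  apply Complex.ext <;> apply mul_left_cancel₀ hr.ne'
  · linear_combination (key r 0 (by ring) - key (-r) 0 (by ring)) / 4
  · linear_combination (key 0 r (by ring) - key 0 (-r) (by ring)) / 4

namespace ToolMap

variable {M : ToolMap}

theorem line_mem (h : .line ∈ M.tool.construction) {A B : ℂ} (hA : A ∈ M.constructible.points)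
    (hB : B ∈ M.constructible.points) (hAB : A ≠ B) {a b c : ℝ} (hab : a ≠ 0 ∨ b ≠ 0)
    (hA' : A ∈ eqLine a b c) (hB' : B ∈ eqLine a b c) : eqLine a b c ∈ M.constructible.curves := by
  rw [← line_eq_eqLine hAB hab hA' hB']
  exact curve_mem h (.line A B hAB) (by simp [hA, hB])

theorem circleClosed (hc : .circle ∈ M.tool.construction)
    (hi : .circleIntersect ∈ M.tool.intersection) : CircleClosed M.constructible.points := by
  intro A hA B hB C hC D hD hAC P h1 h2
  rcases eq_or_ne A B with rfl | hAB
  · rw [sub_self, norm_zero, norm_eq_zero, sub_eq_zero] at h1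
    rwa [h1]
  rcases eq_or_ne C D with rfl | hCD
  · rw [sub_self, norm_zero, norm_eq_zero, sub_eq_zero] at h2
    rwa [h2]
  refine point_mem hi (.circleIntersect _ _ P ⟨A, _, dist_pos.2 hAB, rfl⟩
    ⟨C, _, dist_pos.2 hCD, rfl⟩ (fun H => hAC (sphere_center_injective (dist_pos.2 hAB) H))
    ⟨?_, ?_⟩) (I := [.curve (Metric.sphere A (dist A B)), .curve (Metric.sphere C (dist C D))]) ?_
  · rw [Metric.mem_sphere, dist_eq_norm, h1, dist_eq_norm, norm_sub_rev]
  · rw [Metric.mem_sphere, dist_eq_norm, h2, dist_eq_norm, norm_sub_rev]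
  · have e1 := curve_mem hc (.circle A B hAB) (by simp [hA, hB])
    have e2 := curve_mem hc (.circle C D hCD) (by simp [hC, hD])
    simp [e1, e2]

theorem exists_eq_plane (hc : .circle ∈ M.tool.construction)
    (hi : .circleIntersect ∈ M.tool.intersection) (h0 : 0 ∈ M.initial.points)
    (h1 : 1 ∈ M.initial.points) : ∃ X : Subfield ℝ, SqrtClosed X ∧
      M.constructible.points = plane X :=
  (circleClosed hc hi).exists_eq_plane (M.initial_points_subset h0) (M.initial_points_subset h1)

/-- The parabola `y = x ^ 2` and the circle through `0` with center `(-q / 2, (1 - p) / 2)` meet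
where `x (x ^ 3 + p x + q) = 0`. -/
theorem cubicClosed_of_conics (hM : M.tool = conics) {X : Subfield ℝ}
    (hX : M.constructible.points = plane X) : CubicClosed X := by
  intro p hp q hq x hx
  have two : (2 : ℝ) ∈ X := ofNat_mem X 2
  have four : (4 : ℝ) ∈ X := ofNat_mem X 4
  have mem : ∀ x ∈ X, ∀ y ∈ X, (⟨x, y⟩ : ℂ) ∈ M.constructible.points := by
    intro x hx y hy
    rw [hX]
    exact ⟨hx, hy⟩
  -- The circle degenerates for `p = 1`, `q = 0`; then `x ^ 3 + x = 0` has only the real root `0`.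
  rcases eq_or_ne (⟨0, 0⟩ : ℂ) ⟨-q / 2, (1 - p) / 2⟩ with h | h
  · have e1 := congrArg Complex.re h
    have e2 := congrArg Complex.im h
    simp only at e1 e2
    have e3 : x * (x ^ 2 + 1) = 0 := by linear_combination hx - 2 * e1 - 2 * x * e2
    rcases mul_eq_zero.1 e3 with e3 | e3
    · rw [e3]; exact zero_mem X
    · exact absurd e3 (by positivity)
  have hline : eqLine 0 1 (-1 / 4) ∈ M.constructible.curves :=
    line_mem (by simp [hM, conics]) (mem 0 (zero_mem X) (-1 / 4)
      (div_mem (neg_mem (one_mem X)) four)) (mem 1 (one_mem X) (-1 / 4)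
      (div_mem (neg_mem (one_mem X)) four)) (fun H => zero_ne_one (congrArg Complex.re H))
      (by simp) (by simp [mem_eqLine]) (by simp [mem_eqLine])
  have hF : (⟨0, 1 / 4⟩ : ℂ) ∉ eqLine 0 1 (-1 / 4) := by
    rw [mem_eqLine]; norm_num
  have h01 : (⟨0, 0⟩ : ℂ) ≠ ⟨1, 0⟩ := fun H => zero_ne_one (congrArg Complex.re H)
  have hconic := curve_mem (M := M) (by simp [hM, conics])
    (.conic (eqLine 0 1 (-1 / 4)) ⟨0, 1 / 4⟩ ⟨0, 0⟩ ⟨1, 0⟩ (isLine_eqLine (by simp)) hF h01)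
    (by simp only [List.forall_mem_cons, Figure.curve_mem_elements, Figure.point_mem_elements]
        exact ⟨hline, mem 0 (zero_mem X) (1 / 4) (div_mem (one_mem X) four),
          mem 0 (zero_mem X) 0 (zero_mem X), mem 1 (one_mem X) 0 (zero_mem X), by simp⟩)
  have hcirc := curve_mem (M := M) (by simp [hM, conics])
    (.circle ⟨-q / 2, (1 - p) / 2⟩ ⟨0, 0⟩ h.symm)
    (by simpa using ⟨mem _ (div_mem (neg_mem hq) two) _ (div_mem (sub_mem (one_mem X) hp) two),
      mem 0 (zero_mem X) 0 (zero_mem X)⟩)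
  have hd : dist (⟨0, 0⟩ : ℂ) ⟨1, 0⟩ = 1 := by
    rw [dist_eq_iff zero_le_one]; norm_num
  have := point_mem (M := M) (by simp [hM, conics]) (.circleConicIntersect _ _ (⟨x, x ^ 2⟩ : ℂ)
    ⟨_, _, dist_pos.2 h.symm, rfl⟩ ⟨_, _, _, isLine_eqLine (by simp), hF, dist_pos.2 h01, rfl⟩
    ⟨?_, ?_⟩) (I := [.curve _, .curve _]) (by
      simp only [List.forall_mem_cons, Figure.curve_mem_elements]
      exact ⟨hcirc, hconic, by simp⟩)
  · rw [hX] at this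
    exact this.1
  · rw [Metric.mem_sphere, dist_eq_dist_iff]
    simp only
    linear_combination x * hx
  · rw [hd, mem_conicSet_eqLine (by norm_num) one_pos]
    simp only
    ring

/-- The line which is tangent to the parabola with focus `i` and directrix `y = -1` at the point
with first coordinate `2 t`. -/
theorem isTangent_standard (t : ℝ) : IsTangent (eqLine t (-1) (t ^ 2)) (eqLine 0 1 (-1))
    Complex.I := by
  have := isTangent_perpBisector (a := 0) (b := 1) (c := -1) (by norm_num) (F := Complex.I)
    (F' := ⟨2 * t, -1⟩) (by rw [mem_eqLine]; norm_num) (by simp [mem_eqLine])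
  rw [perpBisector_eq] at this
  rw [← eqLine_mul (k := 4) (by norm_num)]
  convert this using 2 <;> simp <;> ring

/-- A map of the origami tool whose initial points contain `0`, `1` and `i`. -/
structure OrigamiMap (M : ToolMap) : Prop where
  tool_eq : M.tool = origami
  zero_mem_initial : 0 ∈ M.initial.points
  one_mem_initial : 1 ∈ M.initial.points
  I_mem_initial : Complex.I ∈ M.initial.points

theorem OrigamiMap.zero_mem (hM : OrigamiMap M) : 0 ∈ M.constructible.points :=
  M.initial_points_subset hM.zero_mem_initial

theorem OrigamiMap.one_mem (hM : OrigamiMap M) : 1 ∈ M.constructible.points :=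
  M.initial_points_subset hM.one_mem_initial

theorem OrigamiMap.I_mem (hM : OrigamiMap M) : Complex.I ∈ M.constructible.points :=
  M.initial_points_subset hM.I_mem_initial

/-! ### Arithmetic by folding -/

theorem perpendicular_mem (hM : OrigamiMap M) {a b c : ℝ} (hab : a ≠ 0 ∨ b ≠ 0)
    (h : eqLine a b c ∈ M.constructible.curves) {P : ℂ} (hP : P ∈ M.constructible.points) :
    eqLine (-b) a (-b * P.re + a * P.im) ∈ M.constructible.curves := by
  refine curve_mem (by simp [hM.tool_eq, origami]) (.perpendicular (eqLine a b c) _ P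
    ((perp_eqLine_iff ?_ hab).2 ?_) rfl) (by simp [h, hP])
  · rw [neg_ne_zero]; exact hab.symm
  · ring

theorem parallel_mem (hM : OrigamiMap M) {a b c : ℝ} (hab : a ≠ 0 ∨ b ≠ 0)
    (h : eqLine a b c ∈ M.constructible.curves) {P : ℂ} (hP : P ∈ M.constructible.points) :
    eqLine a b (a * P.re + b * P.im) ∈ M.constructible.curves := by
  have := perpendicular_mem hM (by rw [neg_ne_zero]; exact hab.symm)
    (perpendicular_mem hM hab h hP) hP
  rw [← eqLine_mul (k := -1) (by norm_num)] at this
  convert this using 1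
  congr 1 <;> ring

theorem lineIntersect_mem (hM : OrigamiMap M) {a b c a' b' c' : ℝ}
    (h : eqLine a b c ∈ M.constructible.curves)
    (h' : eqLine a' b' c' ∈ M.constructible.curves) (hd : a * b' - a' * b ≠ 0) {P : ℂ}
    (hP : P ∈ eqLine a b c) (hP' : P ∈ eqLine a' b' c') : P ∈ M.constructible.points := by
  have hab : a ≠ 0 ∨ b ≠ 0 := by
    by_contra! H
    simp [H.1, H.2] at hd
  have hab' : a' ≠ 0 ∨ b' ≠ 0 := by
    by_contra! H
    simp [H.1, H.2] at hd
  refine point_mem (by simp [hM.tool_eq, origami]) (.lineIntersect (eqLine a b c)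
    (eqLine a' b' c') P
    (isLine_eqLine hab) (isLine_eqLine hab') (fun H => ?_) ⟨hP, hP'⟩) (by simp [h, h'])
  obtain ⟨k, -, rfl, rfl, -⟩ := eqLine_eq_eqLine hab hab' H
  apply hd
  ring

theorem realAxis_mem (hM : OrigamiMap M) : eqLine 0 1 0 ∈ M.constructible.curves :=
  line_mem (by simp [hM.tool_eq, origami]) (hM.zero_mem) (hM.one_mem)
    zero_ne_one (by simp) (by simp [mem_eqLine]) (by simp [mem_eqLine])

theorem imaginaryAxis_mem (hM : OrigamiMap M) : eqLine 1 0 0 ∈ M.constructible.curves :=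
  line_mem (by simp [hM.tool_eq, origami]) (hM.zero_mem) (hM.I_mem)
    Complex.I_ne_zero.symm (by simp) (by simp [mem_eqLine]) (by simp [mem_eqLine])

theorem diagonal_mem (hM : OrigamiMap M) : eqLine 1 (-1) 0 ∈ M.constructible.curves := by
  have := curve_mem (M := M) (by simp [hM.tool_eq, origami]) (.perpendicularBisector 1 Complex.I
    (fun H => by simpa using congrArg Complex.re H))
    (by simp [hM.one_mem, hM.I_mem])
  rw [perpBisector_eq, ← eqLine_mul (k := -1 / 2) (by norm_num)] at this
  convert this using 1
  norm_num

theorem horizontal_mem (hM : OrigamiMap M) {P : ℂ} (hP : P ∈ M.constructible.points) :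
    eqLine 0 1 P.im ∈ M.constructible.curves := by
  simpa using parallel_mem hM (by simp) (realAxis_mem hM) hP

theorem vertical_mem (hM : OrigamiMap M) {P : ℂ} (hP : P ∈ M.constructible.points) :
    eqLine 1 0 P.re ∈ M.constructible.curves := by
  simpa using parallel_mem hM (by simp) (imaginaryAxis_mem hM) hP

theorem re_mem (hM : OrigamiMap M) {P : ℂ} (hP : P ∈ M.constructible.points) :
    (P.re : ℂ) ∈ M.constructible.points :=
  lineIntersect_mem hM (vertical_mem hM hP) (realAxis_mem hM) (by simp)
    (by simp [mem_eqLine]) (by simp [mem_eqLine])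

theorem im_mem (hM : OrigamiMap M) {P : ℂ} (hP : P ∈ M.constructible.points) :
    (P.im : ℂ) ∈ M.constructible.points := by
  have : (⟨P.im, P.im⟩ : ℂ) ∈ M.constructible.points :=
    lineIntersect_mem hM (horizontal_mem hM hP) (diagonal_mem hM) (by simp)
      (by simp [mem_eqLine]) (by simp [mem_eqLine])
  exact re_mem hM this

theorem mk_mem (hM : OrigamiMap M) {x y : ℝ} (hx : (x : ℂ) ∈ M.constructible.points)
    (hy : (y : ℂ) ∈ M.constructible.points) : (⟨x, y⟩ : ℂ) ∈ M.constructible.points := by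
  have e1 : (⟨y, y⟩ : ℂ) ∈ M.constructible.points :=
    lineIntersect_mem hM (vertical_mem hM hy) (diagonal_mem hM) (by simp)
      (by simp [mem_eqLine]) (by simp [mem_eqLine])
  exact lineIntersect_mem hM (vertical_mem hM hx) (horizontal_mem hM e1) (by simp)
    (by simp [mem_eqLine]) (by simp [mem_eqLine])

/-- The parallel through `(x, 1)` to the line joining `0` and `(y, 1)` meets the real axis at `x -
y`. -/
theorem ofReal_sub_mem (hM : OrigamiMap M) {x y : ℝ} (hx : (x : ℂ) ∈ M.constructible.points)
    (hy : (y : ℂ) ∈ M.constructible.points) : ((x - y : ℝ) : ℂ) ∈ M.constructible.points := by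
  have o := hM.zero_mem
  have one : ((1 : ℝ) : ℂ) ∈ M.constructible.points := by simpa using hM.one_mem
  have hl : eqLine 1 (-y) 0 ∈ M.constructible.curves :=
    line_mem (by simp [hM.tool_eq, origami]) o (mk_mem hM hy one)
      (fun H => zero_ne_one (congrArg Complex.im H)) (by simp) (by simp [mem_eqLine])
      (by simp [mem_eqLine])
  have hp := parallel_mem hM (by simp) hl (mk_mem hM hx one)
  exact lineIntersect_mem hM hp (realAxis_mem hM) (by simp) (by simp [mem_eqLine]; ring)
    (by simp [mem_eqLine])

/-- The line through `0` with slope `y` has height `x y` above `x`. -/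
theorem ofReal_mul_mem (hM : OrigamiMap M) {x y : ℝ} (hx : (x : ℂ) ∈ M.constructible.points)
    (hy : (y : ℂ) ∈ M.constructible.points) : ((x * y : ℝ) : ℂ) ∈ M.constructible.points := by
  have o := hM.zero_mem
  have one : ((1 : ℝ) : ℂ) ∈ M.constructible.points := by simpa using hM.one_mem
  have hl : eqLine y (-1) 0 ∈ M.constructible.curves :=
    line_mem (by simp [hM.tool_eq, origami]) o (mk_mem hM one hy)
      (fun H => zero_ne_one (congrArg Complex.re H)) (by simp) (by simp [mem_eqLine])
      (by simp [mem_eqLine])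
  have : (⟨x, x * y⟩ : ℂ) ∈ M.constructible.points :=
    lineIntersect_mem hM hl (vertical_mem hM hx) (by simp) (by simp [mem_eqLine]; ring)
      (by simp [mem_eqLine])
  exact im_mem hM this

/-- The line through `0` and `(x, 1)` has height `x⁻¹` above `1`. -/
theorem ofReal_inv_mem (hM : OrigamiMap M) {x : ℝ} (hx : (x : ℂ) ∈ M.constructible.points) :
    ((x⁻¹ : ℝ) : ℂ) ∈ M.constructible.points := by
  have o := hM.zero_mem
  rcases eq_or_ne x 0 with rfl | hx0
  · simpa using o
  have one : ((1 : ℝ) : ℂ) ∈ M.constructible.points := by simpa using hM.one_mem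
  have hl : eqLine 1 (-x) 0 ∈ M.constructible.curves :=
    line_mem (by simp [hM.tool_eq, origami]) o (mk_mem hM hx one)
      (fun H => zero_ne_one (congrArg Complex.im H)) (by simp) (by simp [mem_eqLine])
      (by simp [mem_eqLine])
  have : (⟨1, x⁻¹⟩ : ℂ) ∈ M.constructible.points :=
    lineIntersect_mem hM hl (vertical_mem hM one) (by simpa using hx0)
      (by simp [mem_eqLine, hx0]) (by simp [mem_eqLine])
  exact im_mem hM this

/-- The field of the real constructible points. -/
def origamiField (hM : OrigamiMap M) : Subfield ℝ where
  carrier := {x | (x : ℂ) ∈ M.constructible.points}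
  zero_mem' := by simpa using hM.zero_mem
  one_mem' := by simpa using hM.one_mem
  add_mem' := fun {a b} ha hb => by
    have zero : ((0 : ℝ) : ℂ) ∈ M.constructible.points := by simpa using hM.zero_mem
    have := ofReal_sub_mem hM ha (ofReal_sub_mem hM zero hb)
    rwa [zero_sub, sub_neg_eq_add] at this
  mul_mem' := ofReal_mul_mem hM
  neg_mem' := fun {a} ha => by
    have zero : ((0 : ℝ) : ℂ) ∈ M.constructible.points := by simpa using hM.zero_mem
    have := ofReal_sub_mem hM zero ha
    rwa [zero_sub] at this
  inv_mem' := fun _ => ofReal_inv_mem hM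

theorem points_eq_plane_origamiField (hM : OrigamiMap M) :
    M.constructible.points = plane (origamiField hM) :=
  Set.Subset.antisymm (fun _ hz => ⟨re_mem hM hz, im_mem hM hz⟩)
    fun _ hz => mk_mem hM hz.1 hz.2

theorem directrix_mem (hM : OrigamiMap M) : eqLine 0 1 (-1) ∈ M.constructible.curves := by
  have h : (-1 : ℝ) ∈ origamiField hM := neg_mem (one_mem _)
  exact horizontal_mem hM (mk_mem hM h h)

/-- This tangent of the standard parabola meets the real axis at `t`. A number is therefore in the
field once the tangent with that slope can be folded. -/
theorem mem_origamiField_of_tangent_mem (hM : OrigamiMap M) {t : ℝ}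
    (h : eqLine t (-1) (t ^ 2) ∈ M.constructible.curves) : t ∈ origamiField hM := by
  rcases eq_or_ne t 0 with rfl | ht
  · exact zero_mem _
  exact lineIntersect_mem hM h (realAxis_mem hM) (by simpa using ht)
    (by simp [mem_eqLine]; ring) (by simp [mem_eqLine])

/-- The tangent with slope `t` passes through `(0, -t ^ 2)`, which is available when `t ^ 2` is. -/
theorem sqrtClosed_origamiField (hM : OrigamiMap M) : SqrtClosed (origamiField hM) := by
  intro t ht
  apply mem_origamiField_of_tangent_mem
  refine curve_mem (by simp [hM.tool_eq, origami]) (.tangent _ _ _ ⟨0, -t ^ 2⟩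
    (isTangent_standard t) (by simp [mem_eqLine])) ?_
  simpa using ⟨directrix_mem hM, hM.I_mem,
    mk_mem hM (zero_mem (origamiField hM)) (neg_mem ht)⟩

/-- The line `y = t x - t ^ 2` always touches the standard parabola. It touches `(y - p) ^ 2 = 4 q
x`, with focus `(q, p)` and directrix `x = -q`, when `p + q / t = -t ^ 2`, which is the cubic
equation. -/
theorem cubicClosed_origamiField (hM : OrigamiMap M) : CubicClosed (origamiField hM) := by
  intro p hp q hq t ht
  rcases eq_or_ne t 0 with rfl | ht0
  · exact zero_mem _
  rcases eq_or_ne q 0 with rfl | hq0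
  · apply sqrtClosed_origamiField
    have : t ^ 2 = -p := by
      apply mul_left_cancel₀ ht0
      linear_combination ht
    rw [this]
    exact neg_mem hp
  apply mem_origamiField_of_tangent_mem
  have hF' : (⟨q, p⟩ : ℂ) ∉ eqLine 1 0 (-q) := by
    rw [mem_eqLine]
    simp only
    intro H
    apply hq0
    linarith
  have htan : IsTangent (eqLine t (-1) (t ^ 2)) (eqLine 1 0 (-q)) ⟨q, p⟩ := by
    -- The witness `F'` is the reflection of the focus `(q, p)` in that line.
    have := isTangent_perpBisector (a := 1) (b := 0) (c := -q) (by norm_num) hF'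
      (F' := ⟨-q, p + 2 * q / t⟩) (by simp [mem_eqLine])
    rw [perpBisector_eq] at this
    rw [← eqLine_mul (k := -4 * q / t) (by positivity)]
    convert this using 2
    · simp only; field_simp; ring
    · simp only; field_simp; ring
    · simp only
      field_simp
      linear_combination -4 * q * ht
  refine curve_mem (by simp [hM.tool_eq, origami]) (.commonTangent _ _ _ _ _
    (isTangent_standard t) htan fun H => ?_) ?_
  -- The points `(±2, 1)` of the standard parabola cannot both lie on the second one, because `q ≠
  -- 0`.
  · have e : ∀ x : ℝ, x ^ 2 = 4 → (x - q) ^ 2 + (1 - p) ^ 2 = (x + q) ^ 2 := by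
      intro x hx
      have : (⟨x, 1⟩ : ℂ) ∈ parabola (eqLine 0 1 (-1)) Complex.I := by
        rw [parabola, mem_conicSet_eqLine (by norm_num) one_pos]
        simp
        linear_combination hx
      rw [H, parabola, mem_conicSet_eqLine (by norm_num) one_pos] at this
      simp only at this
      linear_combination this
    apply hq0
    linear_combination (e (-2) (by norm_num) - e 2 (by norm_num)) / 16
  · have hv := vertical_mem hM (mk_mem hM (neg_mem hq :) hp)
    simpa using ⟨directrix_mem hM, hM.I_mem, hv,
      mk_mem hM hq hp⟩

end ToolMap

/-! ### All axioms are used -/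

namespace ToolMap

variable {M : ToolMap}

/-- The construction axiom `a` yields a curve which is not in the same layer. -/
def UsesConstruction (M : ToolMap) (a : ConstructionAxiom) : Prop :=
  ∃ n, ∃ c ∈ a.obtained (M.layer n), c ∉ (M.layer n).curves

/-- The intersection axiom `a` yields a point which is not in the previous layer. -/
def UsesIntersection (M : ToolMap) (a : IntersectionAxiom) : Prop :=
  ∃ n, ∃ P ∈ a.obtained ⟨(M.layer (n + 1)).curves, (M.layer n).points⟩, P ∉ (M.layer n).points

theorem mem_layer_one_curves {a : ConstructionAxiom} (ha : a ∈ M.tool.construction)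
    {I : List Element} {c : Set ℂ} (hc : a.Generates I c)
    (hI : ∀ x ∈ I, x ∈ M.initial.elements) : c ∈ (M.layer 1).curves :=
  mem_layer_succ_curves ha ⟨I, hI, hc⟩

theorem mem_layer_two_curves {a : ConstructionAxiom} (ha : a ∈ M.tool.construction)
    {I : List Element} {c : Set ℂ} (hc : a.Generates I c)
    (hI : ∀ x ∈ I, x ∈ (M.layer 1).elements) : c ∈ (M.layer 2).curves :=
  mem_layer_succ_curves ha ⟨I, hI, hc⟩

theorem mem_layer_one_points {a : IntersectionAxiom} (ha : a ∈ M.tool.intersection)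
    {I : List Element} {P : ℂ} (hP : a.Generates I P)
    (hI : ∀ x ∈ I, x ∈ (⟨(M.layer 1).curves, M.initial.points⟩ : Figure).elements) :
    P ∈ (M.layer 1).points :=
  mem_layer_succ_points ha ⟨I, hI, hP⟩

theorem initial_subset_layer_one : M.initial.points ⊆ (M.layer 1).points :=
  M.monotone_points (Nat.zero_le 1)

theorem usesConstruction_of_initial (h₀ : M.initial.curves = ∅) {a : ConstructionAxiom}
    {I : List Element} {c : Set ℂ} (hc : a.Generates I c)
    (hI : ∀ x ∈ I, x ∈ M.initial.elements) : M.UsesConstruction a :=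
  ⟨0, c, ⟨I, hI, hc⟩, by simp [layer, h₀]⟩

/-- A map whose initial points are `0` and `1`, with a tool which contains the Euclidean compass
and whose construction axioms are among those of the conics tool. -/
structure StandardMap (M : ToolMap) : Prop where
  curves_eq : M.initial.curves = ∅
  points_eq : M.initial.points = {0, 1}
  construction_subset : M.tool.construction ⊆ conics.construction
  circle_mem : .circle ∈ M.tool.construction
  circleIntersect_mem : .circleIntersect ∈ M.tool.intersection

namespace StandardMap

theorem usesConstruction_line (hM : StandardMap M) : M.UsesConstruction .line :=
  usesConstruction_of_initial hM.curves_eq (.line 0 1 zero_ne_one) (by simp [hM.points_eq])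

theorem usesConstruction_circle (hM : StandardMap M) : M.UsesConstruction .circle :=
  usesConstruction_of_initial hM.curves_eq (.circle 0 1 zero_ne_one) (by simp [hM.points_eq])

theorem usesConstruction_radiusCircle (hM : StandardMap M) : M.UsesConstruction .radiusCircle :=
  usesConstruction_of_initial hM.curves_eq (.radiusCircle 0 0 1 zero_ne_one)
    (by simp [hM.points_eq])

theorem sphere_zero_mem (hM : StandardMap M) : Metric.sphere 0 1 ∈ (M.layer 1).curves := by
  have := mem_layer_one_curves hM.circle_mem (.circle 0 1 zero_ne_one) (by simp [hM.points_eq])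
  simpa using this

theorem sphere_one_mem (hM : StandardMap M) : Metric.sphere 1 1 ∈ (M.layer 1).curves := by
  have := mem_layer_one_curves hM.circle_mem (.circle 1 0 one_ne_zero) (by simp [hM.points_eq])
  simpa using this

theorem realAxis_mem (hM : StandardMap M) (h : .line ∈ M.tool.construction) :
    eqLine 0 1 0 ∈ (M.layer 1).curves := by
  have := mem_layer_one_curves h (.line 0 1 zero_ne_one) (by simp [hM.points_eq])
  rwa [line_eq_eqLine zero_ne_one (a := 0) (b := 1) (c := 0) (by simp) (by simp [mem_eqLine])
    (by simp [mem_eqLine])] at this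

theorem sixthRoot_generates {y : ℝ} (hy : y ^ 2 = 3 / 4) :
    IntersectionAxiom.circleIntersect.Generates
      [.curve (Metric.sphere 0 1), .curve (Metric.sphere 1 1)] ⟨1 / 2, y⟩ := by
  refine .circleIntersect _ _ _ ⟨0, 1, one_pos, rfl⟩ ⟨1, 1, one_pos, rfl⟩
    (fun H => zero_ne_one (sphere_center_injective one_pos H)) ⟨?_, ?_⟩ <;>
  · rw [mem_sphere_iff zero_le_one]
    simp
    linarith

theorem sixthRoot_mem (hM : StandardMap M) {y : ℝ} (hy : y ^ 2 = 3 / 4) :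
    (⟨1 / 2, y⟩ : ℂ) ∈ (M.layer 1).points :=
  mem_layer_one_points hM.circleIntersect_mem (sixthRoot_generates hy)
    (by simp [hM.sphere_zero_mem, hM.sphere_one_mem])

theorem usesIntersection_circleIntersect (hM : StandardMap M) :
    M.UsesIntersection .circleIntersect := by
  refine ⟨0, ⟨1 / 2, √3 / 2⟩, ⟨_, ?_, sixthRoot_generates ?_⟩, ?_⟩
  · simp [hM.sphere_zero_mem, hM.sphere_one_mem]
  · rw [div_pow, Real.sq_sqrt (by norm_num)]; norm_num
  · simp [layer, hM.points_eq, Complex.ext_iff]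

theorem neg_one_generates : IntersectionAxiom.lineCircleIntersect.Generates
    [.curve (eqLine 0 1 0), .curve (Metric.sphere 0 1)] (-1) :=
  .lineCircleIntersect _ _ _ (isLine_eqLine (by simp)) ⟨0, 1, one_pos, rfl⟩
    ⟨by simp [mem_eqLine], by simp⟩

theorem usesIntersection_lineCircleIntersect (hM : StandardMap M)
    (h : .line ∈ M.tool.construction) : M.UsesIntersection .lineCircleIntersect := by
  refine ⟨0, -1, ⟨_, ?_, neg_one_generates⟩, ?_⟩
  · simp [hM.sphere_zero_mem, hM.realAxis_mem h]
  · simp only [layer, hM.points_eq, Set.mem_insert_iff, Set.mem_singleton_iff]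
    norm_num

theorem two_mem (hM : StandardMap M) (h : .line ∈ M.tool.construction)
    (h' : .lineCircleIntersect ∈ M.tool.intersection) : 2 ∈ (M.layer 1).points :=
  mem_layer_one_points h' (.lineCircleIntersect (eqLine 0 1 0) _ 2 (isLine_eqLine (by simp))
    ⟨1, 1, one_pos, rfl⟩ ⟨by simp [mem_eqLine], by rw [mem_sphere_iff zero_le_one]; norm_num⟩)
    (by simp [hM.sphere_one_mem, hM.realAxis_mem h])

theorem neg_one_mem (hM : StandardMap M) (h : .line ∈ M.tool.construction)
    (h' : .lineCircleIntersect ∈ M.tool.intersection) : -1 ∈ (M.layer 1).points :=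
  mem_layer_one_points h' neg_one_generates (by simp [hM.sphere_zero_mem, hM.realAxis_mem h])

/-- The only possible curves here are the real axis and the unit circles about `0` and `1`. The
point `(2, √3)` avoids them, while second-layer curves of every kind pass through it in the conics
map, so it witnesses several intersection axioms at once. -/
theorem not_mem_layer_one_curve (hM : StandardMap M) {c : Set ℂ} (hc : c ∈ (M.layer 1).curves) :
    (⟨2, √3⟩ : ℂ) ∉ c := by
  have h3 : √3 ^ 2 = 3 := Real.sq_sqrt (by norm_num)
  have h3' : √3 ≠ 0 := by positivity
  rcases hc with hc | hc
  · simp [layer, hM.curves_eq] at hc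
  obtain ⟨a, ha, I, hI, hg⟩ := Set.mem_iUnion₂.1 hc
  have ha' := hM.construction_subset ha
  cases hg <;> simp [conics] at ha' <;> simp [layer, hM.points_eq, hM.curves_eq] at hI
  case line A B h =>
    rw [line_eq_eqLine h (a := 0) (b := 1) (c := 0) (by simp)
      (by rcases hI.1 with rfl | rfl <;> simp [mem_eqLine])
      (by rcases hI.2 with rfl | rfl <;> simp [mem_eqLine])]
    simp [mem_eqLine]
  case circle A B h =>
    rw [Metric.mem_sphere, dist_eq_dist_iff]
    rcases hI with ⟨rfl | rfl, rfl | rfl⟩ <;> simp [h3] <;> norm_num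
  case radiusCircle A B C h =>
    rw [Metric.mem_sphere, dist_eq_dist_iff]
    rcases hI with ⟨rfl | rfl, rfl | rfl, rfl | rfl⟩ <;> simp [h3] <;> norm_num

/-- A new point of the first layer lies on a first-layer curve, whichever intersection axiom gave
it. -/
theorem not_mem_layer_one_points (hM : StandardMap M) : (⟨2, √3⟩ : ℂ) ∉ (M.layer 1).points := by
  rintro (h | h)
  · simp [layer, hM.points_eq, Complex.ext_iff] at h
  obtain ⟨a, ha, I, hI, hg⟩ := Set.mem_iUnion₂.1 h
  have key : ∀ c c' : Set ℂ, Element.curve c ∈ I → (⟨2, √3⟩ : ℂ) ∈ c ∩ c' → False := by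
    intro c c' hc hP
    exact hM.not_mem_layer_one_curve (by simpa [layer] using hI _ hc) hP.1
  cases hg <;> exact key _ _ List.mem_cons_self (by assumption)

theorem usesIntersection_of_mem (hM : StandardMap M) {a : IntersectionAxiom} {I : List Element}
    (ha : a.Generates I ⟨2, √3⟩)
    (hI : ∀ x ∈ I, x ∈ (⟨(M.layer 2).curves, (M.layer 1).points⟩ : Figure).elements) :
    M.UsesIntersection a :=
  ⟨1, _, ⟨I, hI, ha⟩, hM.not_mem_layer_one_points⟩

theorem firstLine_mem (hM : StandardMap M) (h : .line ∈ M.tool.construction)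
    (h' : .lineCircleIntersect ∈ M.tool.intersection) :
    eqLine 1 (-√3) (-1) ∈ (M.layer 2).curves := by
  have h3 : √3 ^ 2 = 3 := Real.sq_sqrt (by norm_num)
  have hne : (-1 : ℂ) ≠ ⟨1 / 2, √3 / 2⟩ := by
    intro H
    have := congrArg Complex.re H
    norm_num at this
  have := mem_layer_two_curves h (.line (-1) ⟨1 / 2, √3 / 2⟩ hne)
    (by simp only [List.forall_mem_cons, Figure.point_mem_elements]
        exact ⟨hM.neg_one_mem h h', hM.sixthRoot_mem (by rw [div_pow, h3]; norm_num), by simp⟩)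
  rwa [line_eq_eqLine hne (a := 1) (b := -√3) (c := -1) (by simp) (by simp [mem_eqLine])
    (by rw [mem_eqLine]; linear_combination -h3 / 2)] at this

theorem secondLine_mem (hM : StandardMap M) (h : .line ∈ M.tool.construction) :
    eqLine √3 (-1) √3 ∈ (M.layer 2).curves := by
  have h3 : √3 ^ 2 = 3 := Real.sq_sqrt (by norm_num)
  have hne : (1 : ℂ) ≠ ⟨1 / 2, -√3 / 2⟩ := by
    intro H
    have := congrArg Complex.re H
    norm_num at this
  have := mem_layer_two_curves h (.line 1 ⟨1 / 2, -√3 / 2⟩ hne)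
    (by simp only [List.forall_mem_cons, Figure.point_mem_elements]
        exact ⟨initial_subset_layer_one (by simp [hM.points_eq]), hM.sixthRoot_mem
          (by rw [div_pow, neg_sq, h3]; norm_num), by simp⟩)
  rwa [line_eq_eqLine hne (a := √3) (b := -1) (c := √3) (by simp) (by simp [mem_eqLine])
    (by rw [mem_eqLine]; ring)] at this

theorem usesIntersection_lineIntersect (hM : StandardMap M) (h : .line ∈ M.tool.construction)
    (h' : .lineCircleIntersect ∈ M.tool.intersection) : M.UsesIntersection .lineIntersect := by
  have h3 : √3 ^ 2 = 3 := Real.sq_sqrt (by norm_num)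
  refine hM.usesIntersection_of_mem (.lineIntersect _ _ _ (isLine_eqLine (by simp))
    (isLine_eqLine (by simp)) ?_ ⟨?_, ?_⟩) (I := [.curve (eqLine 1 (-√3) (-1)),
      .curve (eqLine √3 (-1) √3)]) ?_
  · intro H
    have h1 : (1 : ℂ) ∈ eqLine √3 (-1) √3 := by simp [mem_eqLine]
    rw [← H, mem_eqLine] at h1
    norm_num at h1
  · rw [mem_eqLine]; linear_combination -h3
  · rw [mem_eqLine]; ring
  · simp [hM.firstLine_mem h h', hM.secondLine_mem h]

end StandardMap

theorem StandardMap.sixthRoots_mem (hM : StandardMap M) :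
    (⟨1 / 2, √3 / 2⟩ : ℂ) ∈ (M.layer 1).points ∧ (⟨1 / 2, -√3 / 2⟩ : ℂ) ∈ (M.layer 1).points := by
  have h3 : √3 ^ 2 = 3 := Real.sq_sqrt (by norm_num)
  exact ⟨hM.sixthRoot_mem (by rw [div_pow, h3]; norm_num),
    hM.sixthRoot_mem (by rw [div_pow, neg_sq, h3]; norm_num)⟩

theorem dist_sixthRoots : dist (⟨1 / 2, √3 / 2⟩ : ℂ) ⟨1 / 2, -√3 / 2⟩ = √3 := by
  rw [dist_eq_iff (by positivity)]
  ring

theorem sixthRoots_ne : (⟨1 / 2, √3 / 2⟩ : ℂ) ≠ ⟨1 / 2, -√3 / 2⟩ := by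
  rw [← dist_pos, dist_sixthRoots]
  positivity

theorem StandardMap.conic_obtained (hM : StandardMap M) (h : .line ∈ M.tool.construction)
    {F A B : ℂ} (hF : F ∈ (M.layer 1).points) (hA : A ∈ (M.layer 1).points)
    (hB : B ∈ (M.layer 1).points) (hF0 : F.im ≠ 0) (hAB : A ≠ B) :
    conicSet (eqLine 0 1 0) F (dist A B) ∈ ConstructionAxiom.conic.obtained (M.layer 1) ∧
      IsConic (conicSet (eqLine 0 1 0) F (dist A B)) := by
  have hF' : F ∉ eqLine 0 1 0 := by simpa [mem_eqLine] using hF0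
  refine ⟨⟨_, ?_, .conic (eqLine 0 1 0) F A B (isLine_eqLine (by simp)) hF' hAB⟩,
    ⟨_, F, _, isLine_eqLine (by simp), hF', dist_pos.2 hAB, rfl⟩⟩
  simpa using ⟨hM.realAxis_mem h, hF, hA, hB⟩

theorem StandardMap.usesAllAxioms_conics (hM : StandardMap M) (ht : M.tool = conics) :
    M.UsesAllAxioms := by
  have h3 : √3 ^ 2 = 3 := Real.sq_sqrt (by norm_num)
  have h3' : (√3 : ℝ) ≠ 0 := by positivity
  have hl : .line ∈ M.tool.construction := by simp [ht, conics]
  have hi : .lineCircleIntersect ∈ M.tool.intersection := by simp [ht, conics]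
  have hc : .conic ∈ M.tool.construction := by simp [ht, conics]
  obtain ⟨r₁, r₂⟩ := hM.sixthRoots_mem
  obtain ⟨o₁, c₁⟩ := hM.conic_obtained hl r₁ (initial_subset_layer_one (by simp [hM.points_eq]))
    (initial_subset_layer_one (by simp [hM.points_eq])) (by simp) zero_ne_one
  obtain ⟨o₂, c₂⟩ := hM.conic_obtained hl r₂ r₁ r₂ (by simp) sixthRoots_ne
  have m₁ := mem_layer_succ_curves hc o₁
  have m₂ := mem_layer_succ_curves hc o₂
  rw [dist_zero_left, norm_one] at o₁ c₁ m₁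
  rw [dist_sixthRoots] at o₂ c₂ m₂
  have p₁ : (⟨2, √3⟩ : ℂ) ∈ conicSet (eqLine 0 1 0) ⟨1 / 2, √3 / 2⟩ 1 := by
    rw [mem_conicSet_eqLine (by norm_num) one_pos]
    linear_combination -3 / 4 * h3
  have p₂ : (⟨2, √3⟩ : ℂ) ∈ conicSet (eqLine 0 1 0) ⟨1 / 2, -√3 / 2⟩ √3 := by
    rw [mem_conicSet_eqLine (by norm_num) (by positivity)]
    linear_combination (-3 / 4 - √3 ^ 2) * h3
  have hne : conicSet (eqLine 0 1 0) ⟨1 / 2, √3 / 2⟩ 1 ≠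
      conicSet (eqLine 0 1 0) ⟨1 / 2, -√3 / 2⟩ √3 := by
    intro H
    -- The vertex of the parabola, halfway between focus and directrix, separates the two conics.
    have p : (⟨1 / 2, √3 / 4⟩ : ℂ) ∈ conicSet (eqLine 0 1 0) ⟨1 / 2, √3 / 2⟩ 1 := by
      rw [mem_conicSet_eqLine (by norm_num) one_pos]
      ring
    rw [H, mem_conicSet_eqLine (by norm_num) (by positivity)] at p
    have : (9 : ℝ) / 8 = 0 := by
      linear_combination p + (√3 ^ 2 / 16 + 3 / 16 - 9 / 16) * h3
    norm_num at this
  have hcirc : Metric.sphere 2 √3 ∈ (M.layer 2).curves := by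
    have := mem_layer_two_curves (M := M) (by simp [ht, conics])
      (.radiusCircle 2 _ _ sixthRoots_ne)
      (by simp only [List.forall_mem_cons, Figure.point_mem_elements]
          exact ⟨hM.two_mem hl hi, r₁, r₂, by simp⟩)
    rwa [dist_sixthRoots] at this
  constructor
  · intro a ha
    cases a <;> simp [ht, conics] at ha
    case line => exact hM.usesConstruction_line
    case circle => exact hM.usesConstruction_circle
    case radiusCircle => exact hM.usesConstruction_radiusCircle
    case conic => exact ⟨1, _, o₁, fun H => hM.not_mem_layer_one_curve H p₁⟩
  · intro a _
    cases a
    case lineIntersect => exact hM.usesIntersection_lineIntersect hl hi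
    case circleIntersect => exact hM.usesIntersection_circleIntersect
    case lineCircleIntersect => exact hM.usesIntersection_lineCircleIntersect hl
    case conicIntersect =>
      exact hM.usesIntersection_of_mem (.conicIntersect _ _ _ c₁ c₂ hne ⟨p₁, p₂⟩)
        (by simpa using ⟨by simpa using m₁, by simpa using m₂⟩)
    case lineConicIntersect =>
      refine hM.usesIntersection_of_mem (.lineConicIntersect (eqLine 1 (-√3) (-1)) _ _
        (isLine_eqLine (by simp)) c₁ ⟨?_, p₁⟩) ?_
      · rw [mem_eqLine]; linear_combination -h3
      · simpa using ⟨hM.firstLine_mem hl hi, by simpa using m₁⟩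
    case circleConicIntersect =>
      refine hM.usesIntersection_of_mem (.circleConicIntersect (Metric.sphere 2 √3) _ _
        ⟨2, √3, by positivity, rfl⟩ c₁ ⟨?_, p₁⟩)
        (by simpa using ⟨hcirc, by simpa using m₁⟩)
      rw [mem_sphere_iff (by positivity)]
      simp

theorem StandardMap.usesAllAxioms_of_subset (hM : StandardMap M)
    (hc : M.tool.construction ⊆ rulerCompass.construction)
    (hi : M.tool.intersection ⊆ rulerCompass.intersection)
    (h : M.tool.intersection ⊆ {.circleIntersect} ∨
      .line ∈ M.tool.construction ∧ .lineCircleIntersect ∈ M.tool.intersection) :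
    M.UsesAllAxioms := by
  constructor
  · intro a ha
    have ha' := hc ha
    cases a <;> simp [rulerCompass] at ha'
    case line => exact hM.usesConstruction_line
    case circle => exact hM.usesConstruction_circle
    case radiusCircle => exact hM.usesConstruction_radiusCircle
  · intro a ha
    rcases h with h | ⟨hl, hlc⟩
    · rw [Finset.mem_singleton.1 (h ha)]
      exact hM.usesIntersection_circleIntersect
    · have ha' := hi ha
      cases a <;> simp [rulerCompass] at ha'
      case lineIntersect => exact hM.usesIntersection_lineIntersect hl hlc
      case circleIntersect => exact hM.usesIntersection_circleIntersect
      case lineCircleIntersect => exact hM.usesIntersection_lineCircleIntersect hl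

/-! ### Use of the origami axioms -/

/-- Without initial curves only lines and perpendicular bisectors of the three points arise. Any
line that misses both `0` and `(1/2, 1/2)` is therefore new in the second layer. -/
theorem mem_layer_one_curve_of_origami (ht : M.tool = origami) (h₀ : M.initial.curves = ∅)
    (h₁ : M.initial.points = {0, 1, Complex.I}) {c : Set ℂ} (hc : c ∈ (M.layer 1).curves) :
    0 ∈ c ∨ (⟨1 / 2, 1 / 2⟩ : ℂ) ∈ c := by
  rcases hc with hc | hc
  · simp [layer, h₀] at hc
  obtain ⟨a, ha, I, hI, hg⟩ := Set.mem_iUnion₂.1 hc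
  rw [ht] at ha
  cases hg <;> simp [origami] at ha <;> simp [layer, h₀, h₁] at hI
  case line A B h =>
    rw [line_eq h, mem_eqLine, mem_eqLine]
    rcases hI with ⟨rfl | rfl | rfl, rfl | rfl | rfl⟩ <;> simp <;> norm_num
  case perpendicularBisector A B h =>
    rw [perpBisector_eq, mem_eqLine, mem_eqLine]
    rcases hI with ⟨rfl | rfl | rfl, rfl | rfl | rfl⟩ <;> simp at h ⊢

/-- The single new line `x + y = 1/2` witnesses the five axioms that need curves. It is a bisector
at `(1/2, 0)`, is perpendicular to the diagonal, and touches the parabolas with focus `0` and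
directrices `y = 1/2` and `x = 1/2`. -/
theorem usesAllAxioms_origami (ht : M.tool = origami) (h₀ : M.initial.curves = ∅)
    (h₁ : M.initial.points = {0, 1, Complex.I}) : M.UsesAllAxioms := by
  have hl : .line ∈ M.tool.construction := by simp [ht, origami]
  have hb : .perpendicularBisector ∈ M.tool.construction := by simp [ht, origami]
  have i₀ : 0 ∈ M.initial.points := by simp [h₁]
  have i₁ : 1 ∈ M.initial.points := by simp [h₁]
  have i₂ : Complex.I ∈ M.initial.points := by simp [h₁]
  have h1I : (1 : ℂ) ≠ Complex.I := fun H => by simpa using congrArg Complex.re H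
  have realAxis : eqLine 0 1 0 ∈ (M.layer 1).curves := by
    have := mem_layer_one_curves hl (.line 0 1 zero_ne_one) (by simp [i₀, i₁])
    rwa [line_eq_eqLine zero_ne_one (a := 0) (b := 1) (c := 0) (by simp) (by simp [mem_eqLine])
      (by simp [mem_eqLine])] at this
  have vertical : eqLine 1 0 (1 / 2) ∈ (M.layer 1).curves := by
    have := mem_layer_one_curves hb (.perpendicularBisector 0 1 zero_ne_one) (by simp [i₀, i₁])
    rw [perpBisector_eq, ← eqLine_mul (k := 1 / 2) (by norm_num)] at this
    convert this using 2 <;> simp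
  have horizontal : eqLine 0 1 (1 / 2) ∈ (M.layer 1).curves := by
    have := mem_layer_one_curves hb (.perpendicularBisector 0 Complex.I Complex.I_ne_zero.symm)
      (by simp [i₀, i₂])
    rw [perpBisector_eq, ← eqLine_mul (k := 1 / 2) (by norm_num)] at this
    convert this using 2 <;> simp
  have diagonal : eqLine 1 (-1) 0 ∈ (M.layer 1).curves := by
    have := mem_layer_one_curves hb (.perpendicularBisector 1 Complex.I h1I)
      (by simp [i₁, i₂])
    rw [perpBisector_eq, ← eqLine_mul (k := -1 / 2) (by norm_num)] at this
    convert this using 2 <;> simp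
  have generates : IntersectionAxiom.lineIntersect.Generates
      [.curve (eqLine 0 1 0), .curve (eqLine 1 0 (1 / 2))] ⟨1 / 2, 0⟩ := by
    refine .lineIntersect _ _ _ (isLine_eqLine (by simp)) (isLine_eqLine (by simp)) (fun H => ?_)
      ⟨by simp [mem_eqLine], by simp [mem_eqLine]⟩
    have : (0 : ℂ) ∈ eqLine 0 1 0 := by simp [mem_eqLine]
    rw [H, mem_eqLine] at this
    norm_num at this
  have half : (⟨1 / 2, 0⟩ : ℂ) ∈ (M.layer 1).points :=
    mem_layer_one_points (by simp [ht, origami]) generates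
      (by simpa using ⟨realAxis, by simpa using vertical⟩)
  have zero : 0 ∈ (M.layer 1).points := initial_subset_layer_one i₀
  have new : eqLine 1 1 (1 / 2) ∉ (M.layer 1).curves := by
    intro H
    rcases mem_layer_one_curve_of_origami ht h₀ h₁ H with h | h <;> rw [mem_eqLine] at h <;>
      norm_num at h
  have hperp : Perp (eqLine 1 1 (1 / 2)) (eqLine 1 (-1) 0) :=
    (perp_eqLine_iff (by simp) (by simp)).2 (by norm_num)
  have hm : (AffineSubspace.perpBisector (0 : ℂ) ⟨1 / 2, 1 / 2⟩ : Set ℂ) = eqLine 1 1 (1 / 2) := by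
    rw [perpBisector_eq]
    congr 1 <;> norm_num
  have t₁ : IsTangent (eqLine 1 1 (1 / 2)) (eqLine 0 1 (1 / 2)) 0 := by
    rw [← hm]
    exact isTangent_perpBisector (by norm_num) (by simp [mem_eqLine]) (by simp [mem_eqLine])
  have t₂ : IsTangent (eqLine 1 1 (1 / 2)) (eqLine 1 0 (1 / 2)) 0 := by
    rw [← hm]
    exact isTangent_perpBisector (by norm_num) (by simp [mem_eqLine]) (by simp [mem_eqLine])
  have uses : ∀ {a : ConstructionAxiom} {I : List Element}, a.Generates I (eqLine 1 1 (1 / 2)) →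
      (∀ x ∈ I, x ∈ (M.layer 1).elements) → M.UsesConstruction a :=
    fun hg hI => ⟨1, _, ⟨_, hI, hg⟩, new⟩
  constructor
  · intro a ha
    cases a <;> simp [ht, origami] at ha
    case line => exact usesConstruction_of_initial h₀ (.line 0 1 zero_ne_one) (by simp [i₀, i₁])
    case perpendicularBisector =>
      exact usesConstruction_of_initial h₀ (.perpendicularBisector 0 1 zero_ne_one)
        (by simp [i₀, i₁])
    case bisector =>
      refine uses (.bisector (eqLine 0 1 0) (eqLine 1 0 (1 / 2)) _
        ⟨⟨1 / 2, 0⟩, 1, -Complex.I, by simp, by simp, ?_, ?_, ?_, ?_⟩)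
        (by simpa using ⟨realAxis, by simpa using vertical⟩)
      · cases generates
        assumption
      · rw [line_eq_eqLine (a := 0) (b := 1) (c := 0)] <;> simp [mem_eqLine]
      · rw [line_eq_eqLine (a := 1) (b := 0) (c := 1 / 2)] <;> simp [mem_eqLine]
      · rw [line_eq_eqLine (a := 1) (b := 1) (c := 1 / 2)] <;> simp [mem_eqLine]
        intro H
        simpa using congrArg Complex.re H
    case perpendicular =>
      exact uses (.perpendicular _ _ ⟨1 / 2, 0⟩ hperp (by simp [mem_eqLine]))
        (by simpa using ⟨diagonal, by simpa using half⟩)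
    case tangent =>
      exact uses (.tangent _ _ _ ⟨1 / 2, 0⟩ t₁ (by simp [mem_eqLine]))
        (by simpa using ⟨by simpa using horizontal, zero, by simpa using half⟩)
    case commonTangent =>
      refine uses (.commonTangent _ _ _ _ _ t₁ t₂ fun H => ?_)
        (by simpa using ⟨by simpa using horizontal, zero, by simpa using vertical, zero⟩)
      -- The vertex of the first parabola is not on the second, so the parabolas differ.
      have p : (⟨0, 1 / 4⟩ : ℂ) ∈ parabola (eqLine 0 1 (1 / 2)) 0 := by
        rw [parabola, mem_conicSet_eqLine (by norm_num) one_pos]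
        norm_num
      rw [H, parabola, mem_conicSet_eqLine (by norm_num) one_pos] at p
      norm_num at p
    case perpendicularTangent =>
      exact uses (.perpendicularTangent _ _ _ _ t₁ hperp)
        (by simpa using ⟨by simpa using horizontal, zero, diagonal⟩)
  · intro a ha
    cases a <;> simp [ht, origami] at ha
    refine ⟨0, _, ⟨_, ?_, generates⟩, ?_⟩
    · simpa using ⟨realAxis, by simpa using vertical⟩
    · simp [layer, h₁, Complex.ext_iff]

end ToolMap

/-! ### Arithmetic equivalence -/

open ToolMap

/-- The map of a tool with the initial points `0` and `1`. -/
noncomputable def standardMap (E : Tool) : ToolMap := ofPoints E {0, 1} (by simp)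

theorem standardMap_isStandard {E : Tool} (h : E.construction ⊆ conics.construction)
    (hc : .circle ∈ E.construction) (hi : .circleIntersect ∈ E.intersection) :
    StandardMap (standardMap E) where
  curves_eq := rfl
  points_eq := by simp [standardMap, ofPoints]
  construction_subset := h
  circle_mem := hc
  circleIntersect_mem := hi

/-- A tool which lies between the Euclidean compass and ruler and compass, and which intersects
only circles or can intersect lines with circles. -/
structure IsEuclidean (E : Tool) : Prop where
  construction_subset : E.construction ⊆ rulerCompass.construction
  intersection_subset : E.intersection ⊆ rulerCompass.intersection
  circle_mem : .circle ∈ E.construction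
  circleIntersect_mem : .circleIntersect ∈ E.intersection
  subset_or_mem : E.intersection ⊆ {.circleIntersect} ∨
    .line ∈ E.construction ∧ .lineCircleIntersect ∈ E.intersection

theorem IsEuclidean.isStandard {E : Tool} (h : IsEuclidean E) : StandardMap (standardMap E) :=
  standardMap_isStandard (h.construction_subset.trans (by decide)) h.circle_mem
    h.circleIntersect_mem

theorem zero_mem_standardMap (E : Tool) : 0 ∈ (standardMap E).initial.points := by
  simp [standardMap, ofPoints]

theorem one_mem_standardMap (E : Tool) : 1 ∈ (standardMap E).initial.points := by
  simp [standardMap, ofPoints]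

theorem standardMap_initial_subset (E : Tool) (X : Subfield ℝ) :
    (standardMap E).initial.points ⊆ plane X := by
  intro z hz
  have : z = 0 ∨ z = 1 := by simpa [standardMap, ofPoints] using hz
  rcases this with rfl | rfl
  · exact ⟨zero_mem X, zero_mem X⟩
  · exact ⟨one_mem X, zero_mem X⟩

/-- The points of the second map form the plane over some square-root closed field, and the upper
bound for the first map holds over every such field. -/
theorem IsEuclidean.points_subset {E E' : Tool} (h : IsEuclidean E) (h' : IsEuclidean E') :
    (standardMap E).constructible.points ⊆ (standardMap E').constructible.points := by
  obtain ⟨X, hX, e⟩ := exists_eq_plane h'.circle_mem h'.circleIntersect_mem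
    (zero_mem_standardMap E') (one_mem_standardMap E')
  rw [e]
  exact rulerCompass_points_subset hX h.construction_subset h.intersection_subset rfl
    (standardMap_initial_subset E X)

theorem standardMap_isInfinite {E : Tool} (hc : .circle ∈ E.construction)
    (hi : .circleIntersect ∈ E.intersection) : (standardMap E).IsInfinite := by
  obtain ⟨X, -, e⟩ := exists_eq_plane (M := standardMap E) hc hi (zero_mem_standardMap E)
    (one_mem_standardMap E)
  exact isInfinite_of_plane_subset e.ge

theorem IsEuclidean.arithmeticallyEquivalent {E E' : Tool} (h : IsEuclidean E)
    (h' : IsEuclidean E') : ArithmeticallyEquivalent E E' :=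
  ⟨standardMap E, standardMap E', rfl, rfl, rfl, rfl,
    standardMap_isInfinite h.circle_mem h.circleIntersect_mem,
    standardMap_isInfinite h'.circle_mem h'.circleIntersect_mem,
    (h.points_subset h').antisymm (h'.points_subset h),
    h.isStandard.usesAllAxioms_of_subset h.construction_subset h.intersection_subset
      h.subset_or_mem,
    h'.isStandard.usesAllAxioms_of_subset h'.construction_subset h'.intersection_subset
      h'.subset_or_mem⟩

theorem compass_isEuclidean : IsEuclidean compass := by
  constructor <;> decide

theorem rulerCompass_isEuclidean : IsEuclidean rulerCompass := by
  constructor <;> decide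

theorem euclideanCompass_isEuclidean : IsEuclidean euclideanCompass := by
  constructor <;> decide

theorem rulerEuclideanCompass_isEuclidean : IsEuclidean rulerEuclideanCompass := by
  constructor <;> decide

/-- The initial sets may differ: origami also receives `i`, which lies in the plane over every
subfield. -/
theorem origami_arithmeticallyEquivalent_conics : ArithmeticallyEquivalent origami conics := by
  obtain ⟨M, hM⟩ : ∃ M, M = ofPoints origami {0, 1, Complex.I} (by simp) := ⟨_, rfl⟩
  have ht : M.tool = origami := by rw [hM]; rfl
  have h₀ : M.initial.curves = ∅ := by rw [hM]; rfl
  have h₁ : M.initial.points = {0, 1, Complex.I} := by simp [hM, ofPoints]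
  have ho : OrigamiMap M := ⟨ht, by simp [h₁], by simp [h₁], by simp [h₁]⟩
  have hc : ConstructionAxiom.circle ∈ conics.construction := by decide
  have hi : IntersectionAxiom.circleIntersect ∈ conics.intersection := by decide
  obtain ⟨X, hX, e⟩ := exists_eq_plane (M := standardMap conics) hc hi
    (zero_mem_standardMap conics) (one_mem_standardMap conics)
  refine ⟨M, standardMap conics, ht, rfl, h₀, rfl,
    isInfinite_of_plane_subset (points_eq_plane_origamiField ho).ge,
    standardMap_isInfinite hc hi, Set.Subset.antisymm ?_ ?_,
    usesAllAxioms_origami ht h₀ h₁,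
    (standardMap_isStandard subset_rfl hc hi).usesAllAxioms_conics rfl⟩
  · rw [e]
    refine origami_points_subset hX (cubicClosed_of_conics rfl e) ht h₀ ?_
    rw [h₁]
    rintro z (rfl | rfl | rfl)
    · exact ⟨zero_mem X, zero_mem X⟩
    · exact ⟨one_mem X, zero_mem X⟩
    · exact ⟨zero_mem X, one_mem X⟩
  · rw [points_eq_plane_origamiField ho]
    exact conics_points_subset (sqrtClosed_origamiField ho) (cubicClosed_origamiField ho) rfl rfl
      (standardMap_initial_subset _ _)

end GeometricTools

theorem mainTheorem1 :
    (GeometricTools.ArithmeticallyEquivalent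
        GeometricTools.compass GeometricTools.rulerCompass ∧
      GeometricTools.ArithmeticallyEquivalent
        GeometricTools.compass GeometricTools.euclideanCompass ∧
      GeometricTools.ArithmeticallyEquivalent
        GeometricTools.compass GeometricTools.rulerEuclideanCompass ∧
      GeometricTools.ArithmeticallyEquivalent
        GeometricTools.rulerCompass GeometricTools.euclideanCompass ∧
      GeometricTools.ArithmeticallyEquivalent
        GeometricTools.rulerCompass GeometricTools.rulerEuclideanCompass ∧
      GeometricTools.ArithmeticallyEquivalent
        GeometricTools.euclideanCompass GeometricTools.rulerEuclideanCompass) ∧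
    GeometricTools.ArithmeticallyEquivalent
      GeometricTools.origami GeometricTools.conics := by
  have c := GeometricTools.compass_isEuclidean
  have rc := GeometricTools.rulerCompass_isEuclidean
  have ec := GeometricTools.euclideanCompass_isEuclidean
  have rec' := GeometricTools.rulerEuclideanCompass_isEuclidean
  exact ⟨⟨c.arithmeticallyEquivalent rc, c.arithmeticallyEquivalent ec,
    c.arithmeticallyEquivalent rec', rc.arithmeticallyEquivalent ec,
    rc.arithmeticallyEquivalent rec', ec.arithmeticallyEquivalent rec'⟩,
    GeometricTools.origami_arithmeticallyEquivalent_conics⟩
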